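/- **Setting.** Let $(M,g,J,\omega)$ be a non-empty Kähler manifold, $\omega=g(J\cdot,\cdot)$, with a hamiltonian 2-form $\varphi$, that is, a smooth $J$-invariant 2-form with $\nabla_U\varphi=\tfrac12\,(d\,\mathrm{tr}_\omega\varphi\wedge (JU)^\flat-d^c\,\mathrm{tr}_\omega\varphi\wedge U^\flat)$ for every vector field $U$. Let $\ell\ge 2$. We say that $\varphi$ has order $\ell$ with momentum domain $\mathcal D=I_1\times\dots\times I_\ell$ if $(M,\varphi)$ is given by the hamiltonian 2-form Ansatz, as follows. There are Kähler manifolds $(B_a,\check g_a,\check\omega_a)$, numbers $\varepsilon_a\in\{-1,1\}$, $\eta_a\in\mathbb R$ ($a=1,\dots,N$), a principal $\ell$-torus bundle $P\to\prod_a B_a$ with connection form $\theta=(\theta_1,\dots,\theta_\ell)$ satisfying $d\theta_r=\sum_a(-1)^r\varepsilon_a\eta_a^{\ell-r}\check\omega_a$, smooth functions $F_j$ on $I_j$, and a diffeomorphism of $\mathcal D\times P$ onto an open dense subset $M^0\subset M$ under which $$g=\sum_a\varepsilon_a p_{nc}(\eta_a)\check g_a+\sum_{j}\frac{p_c(\xi_j)\Delta(\xi_j)}{F_j(\xi_j)}d\xi_j^2+\sum_j\frac{F_j(\xi_j)}{p_c(\xi_j)\Delta(\xi_j)}\Big(\sum_{r=1}^\ell\sigma_{r-1}(\hat\xi_j)\theta_r\Big)^2,$$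 $$\omega=\sum_a\varepsilon_a p_{nc}(\eta_a)\check\omega_a+\sum_{r=1}^\ell d\sigma_r\wedge\theta_r,\qquad \varphi=\sum_a\varepsilon_a\eta_a p_{nc}(\eta_a)\check\omega_a+\sum_{r=1}^\ell(\sigma_r\,d\sigma_1-d\sigma_{r+1})\wedge\theta_r .$$ Here $(\xi_1,\dots,\xi_\ell)\in\mathcal D$, $\sigma_r$ (resp. $\sigma_r(\hat\xi_j)$) is the $r$-th elementary symmetric function of all $\xi_i$ (resp. of the $\xi_i$ with $i\ne j$), $\sigma_{\ell+1}=0$, $p_{nc}(t)=\prod_j(t-\xi_j)$, $p_c(t)=\prod_a(t-\eta_a)^{\dim_{\mathbb C}B_a}$, $\Delta(\xi_j)=\prod_{i\ne j}(\xi_j-\xi_i)$, and it is required that $\varepsilon_ap_{nc}(\eta_a)>0$ on $\mathcal D$ and $(-1)^{\ell-j}F_jp_c>0$ on $I_j$. Let $K_1$ be the vector field with hamiltonian potential $\sigma_1$, i.e. $\omega(K_1,\cdot)=-d\sigma_1$, so that $JK_1=-\nabla^g\sigma_1$. The domain is of Type 2 if $$\mathcal D=\mathcal D_2=(-\infty,\alpha_1)\times(\alpha_1,\alpha_2)\times\dots\times(\alpha_{\ell-2},\alpha_{\ell-1})\times(\alpha_\ell,\infty),\qquad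 \alpha_1<\dots<\alpha_{\ell-1}<0<\alpha_\ell .$$ A gradient Kähler–Ricci soliton is a Kähler metric together with a real holomorphic vector field $X=\nabla^g f$, $f$ smooth, such that $\mathrm{Ric}_\omega+\tfrac12\mathcal L_X\omega=\lambda\omega$ with $\lambda\in\mathbb R$; it is shrinking if $\lambda>0$ and expanding if $\lambda<0$. **Statement.** Let $(M,g,J,\omega)$ carry a hamiltonian 2-form of order $\ell\ge 2$ whose momentum domain is of Type 2, let $a\in\mathbb R$ and $\lambda\ne0$, and suppose that $a\neq 0$ if $\lambda<0$ (so the trivial expanding case, a Kähler–Einstein metric of negative Ricci curvature with $X=0$, is excluded). Then it is not possible that $g$ is complete and that $(\omega, X)$ with $X=aJK_1$ is a gradient Kähler–Ricci soliton with constant $\lambda$. That is, there is no complete shrinking gradient Kähler–Ricci soliton of this kind for any $a\in\mathbb R$, and no complete expanding one for any $a\ne0$. -/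

import Mathlib

open scoped Manifold ContDiff Topology ENNReal
open Set Filter Bundle

universe u v w

noncomputable section

namespace KRS

/-- The model space `ℂⁿ` of a complex manifold of complex dimension `n`. -/
abbrev Cn (n : ℕ) : Type := EuclideanSpace ℂ (Fin n)

/-- A complex manifold is in particular a smooth real manifold, for the same atlas. -/
instance realManifold (n : ℕ) (M : Type u) [TopologicalSpace M] [ChartedSpace (Cn n) M]
    [IsManifold 𝓘(ℂ, Cn n) ω M] : IsManifold 𝓘(ℝ, Cn n) ∞ M := by
  refine isManifold_of_contDiffOn _ _ _ ?_
  intro e e' he he'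
  have h := (contDiffGroupoid ω 𝓘(ℂ, Cn n)).compatible he he'
  rw [contDiffGroupoid, mem_groupoid_of_pregroupoid] at h
  have h1 := h.1
  simp only [contDiffPregroupoid, modelWithCornersSelf_coe, modelWithCornersSelf_coe_symm] at h1
  exact (ContDiffOn.restrict_scalars ℝ h1).of_le (by exact_mod_cast le_top)

/-! ### Tensors on a complex manifold, in holomorphic charts -/

section Tensors

variable {n : ℕ} {M : Type u} [TopologicalSpace M] [ChartedSpace (Cn n) M]

variable (n) in
/-- The real tangent space of a complex manifold. -/
abbrev RT (x : M) : Type := TangentSpace 𝓘(ℝ, Cn n) x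

/-- The complex structure `J` on the real tangent space: multiplication by `i` (the transition
maps are holomorphic, so this does not depend on the chart). -/
def J (x : M) : RT n x →L[ℝ] RT n x :=
  (Complex.I • ContinuousLinearMap.id ℝ (Cn n) : Cn n →L[ℝ] Cn n)

variable (n M) in
/-- Real bilinear forms on the tangent spaces: metrics and 2-forms. -/
abbrev TwoTensor : Type u := ∀ x : M, RT n x →L[ℝ] RT n x →L[ℝ] ℝ

/-- The coordinate frame of a chart `c` at the point with coordinates `z`. -/
def frame (c : OpenPartialHomeomorph M (Cn n)) (z : Cn n) : Cn n →L[ℝ] RT n (c.symm z) :=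
  mfderiv 𝓘(ℝ, Cn n) 𝓘(ℝ, Cn n) c.symm z

/-- A bilinear form in the coordinates of a chart. -/
def localForm (c : OpenPartialHomeomorph M (Cn n)) (β : TwoTensor n M) (z : Cn n) :
    Cn n →L[ℝ] Cn n →L[ℝ] ℝ :=
  (ContinuousLinearMap.precomp ℝ (frame c z)).comp ((β (c.symm z)).comp (frame c z))

/-- A vector field in the coordinates of a chart. -/
def localField (c : OpenPartialHomeomorph M (Cn n)) (X : ∀ x : M, RT n x) (z : Cn n) : Cn n :=
  mfderiv 𝓘(ℝ, Cn n) 𝓘(ℝ, Cn n) c (c.symm z) (X (c.symm z))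

/-- The fundamental form `ω = g(J·, ·)`. -/
def fundamentalForm (g : TwoTensor n M) : TwoTensor n M := fun x => (g x).comp (J x)

/-- Closedness of a 2-form: the exterior derivative vanishes in every chart. -/
def IsClosedForm (β : TwoTensor n M) : Prop :=
  ∀ c ∈ atlas (Cn n) M, ∀ z ∈ c.target, ∀ u v w : Cn n,
    fderiv ℝ (localForm c β) z u v w + fderiv ℝ (localForm c β) z v w u
      + fderiv ℝ (localForm c β) z w u v = 0

/-- Smoothness of a bilinear form. -/
def IsSmoothForm (β : TwoTensor n M) : Prop :=
  ∀ c ∈ atlas (Cn n) M, ContDiffOn ℝ ∞ (localForm c β) c.target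

end Tensors

/-- A Kähler manifold: a Hausdorff complex manifold with a smooth Riemannian metric that is
`J`-invariant and whose fundamental form is closed. -/
structure KahlerManifold : Type (u + 1) where
  /-- the complex dimension -/
  dim : ℕ
  Carrier : Type u
  [top : TopologicalSpace Carrier]
  [t2 : T2Space Carrier]
  [charted : ChartedSpace (Cn dim) Carrier]
  [complexManifold : IsManifold 𝓘(ℂ, Cn dim) ω Carrier]
  metric : ContMDiffRiemannianMetric 𝓘(ℝ, Cn dim) ∞ (Cn dim)
    (fun x : Carrier => TangentSpace 𝓘(ℝ, Cn dim) x)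
  J_invariant : ∀ (x : Carrier) (v w : RT dim x),
    metric.inner x (J x v) (J x w) = metric.inner x v w
  closed : IsClosedForm (fundamentalForm (n := dim) metric.inner)

namespace KahlerManifold

attribute [instance] top t2 charted complexManifold

variable (M : KahlerManifold.{u})

/-- The real tangent space. -/
abbrev T (x : M.Carrier) : Type := RT M.dim x

/-- The Riemannian metric `g`. -/
def g : TwoTensor M.dim M.Carrier := M.metric.inner

/-- The Kähler form `ω = g(J·, ·)`. -/
def kahlerForm : TwoTensor M.dim M.Carrier := fundamentalForm M.g

/-- Completeness for the Riemannian distance (the infimum of the lengths of `C¹` paths). -/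
def IsComplete : Prop :=
  letI : RiemannianBundle (fun x : M.Carrier => TangentSpace 𝓘(ℝ, Cn M.dim) x) :=
    ⟨M.metric.toRiemannianMetric⟩
  ∀ s : ℕ → M.Carrier,
    (∀ ε : ℝ≥0∞, 0 < ε → ∃ N : ℕ, ∀ i ≥ N, ∀ j ≥ N,
      Manifold.riemannianEDist 𝓘(ℝ, Cn M.dim) (s i) (s j) < ε) →
    ∃ x : M.Carrier, Tendsto s atTop (𝓝 x)

end KahlerManifold

/-! ### The Ricci form and gradient Kähler–Ricci solitons -/

section Soliton

/-- `i∂∂̄u` for a real function `u` on an open subset of `ℂⁿ`, as a real 2-form: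
`(i∂∂̄u)(v, w) = ½ (D²u(iv, w) - D²u(v, iw))`. -/
def iddbar {n : ℕ} (u : Cn n → ℝ) (z v w : Cn n) : ℝ :=
  (1 / 2) * (fderiv ℝ (fderiv ℝ u) z (Complex.I • v) w
    - fderiv ℝ (fderiv ℝ u) z v (Complex.I • w))

/-- The Hermitian matrix of a `J`-invariant real bilinear form on `ℂⁿ`, in the standard basis. -/
def hermitianMatrix {n : ℕ} (G : Cn n →L[ℝ] Cn n →L[ℝ] ℝ) : Matrix (Fin n) (Fin n) ℂ :=
  Matrix.of fun j k =>
    (G (EuclideanSpace.single j 1) (EuclideanSpace.single k 1) : ℂ)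
      + Complex.I * (G (EuclideanSpace.single j 1) (Complex.I • EuclideanSpace.single k 1) : ℂ)

variable (M : KahlerManifold.{u})

/-- The Ricci form `-i∂∂̄ log det (h_{jk̄})` in the coordinates of a holomorphic chart. -/
def ricciForm (c : OpenPartialHomeomorph M.Carrier (Cn M.dim)) (z v w : Cn M.dim) : ℝ :=
  iddbar (fun z' => -Real.log (hermitianMatrix (localForm c M.g z')).det.re) z v w

/-- The Lie derivative `𝓛_X ω` of the Kähler form in the coordinates of a chart. -/
def lieKahlerForm (c : OpenPartialHomeomorph M.Carrier (Cn M.dim)) (X : ∀ x, M.T x)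
    (z v w : Cn M.dim) : ℝ :=
  fderiv ℝ (localForm c M.kahlerForm) z (localField c X z) v w
    + localForm c M.kahlerForm z (fderiv ℝ (localField c X) z v) w
    + localForm c M.kahlerForm z v (fderiv ℝ (localField c X) z w)

/-- `(ω, X)` is a gradient Kähler–Ricci soliton with constant `lam`: `X = ∇f` is a real
holomorphic vector field and `Ric_ω + ½ 𝓛_X ω = lam · ω`. It is shrinking if `lam > 0`, steady if
`lam = 0` and expanding if `lam < 0`. -/
structure IsGradientKahlerRicciSoliton (X : ∀ x, M.T x) (lam : ℝ) : Prop where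
  gradient : ∃ f : M.Carrier → ℝ, ContMDiff 𝓘(ℝ, Cn M.dim) 𝓘(ℝ, ℝ) ∞ f ∧
    ∀ (x : M.Carrier) (v : M.T x), M.g x (X x) v = mfderiv 𝓘(ℝ, Cn M.dim) 𝓘(ℝ, ℝ) f x v
  holomorphic : ∀ c ∈ atlas (Cn M.dim) M.Carrier, DifferentiableOn ℂ (localField c X) c.target
  equation : ∀ c ∈ atlas (Cn M.dim) M.Carrier, ∀ z ∈ c.target, ∀ v w : Cn M.dim,
    ricciForm M c z v w + (1 / 2) * lieKahlerForm M c X z v w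
      = lam * localForm c M.kahlerForm z v w

end Soliton

/-! ### Hamiltonian 2-forms -/

section Hamiltonian

variable (M : KahlerManifold.{u})

/-- `s = tr_ω φ`, half the real trace of the endomorphism `A` with `φ(v, w) = ω(A v, w)`. -/
def IsKahlerTrace (φ : TwoTensor M.dim M.Carrier) (s : M.Carrier → ℝ) : Prop :=
  ∀ x, ∃ A : M.T x →ₗ[ℝ] M.T x, (∀ v w, φ x v w = M.kahlerForm x (A v) w) ∧
    s x = (1 / 2) * LinearMap.trace ℝ (M.T x) A

/-- `γ` is the value at `z` of the Levi-Civita derivative of the coordinate field `v` in the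
direction `u`, for the metric `G` on an open subset of `ℂⁿ`. -/
def IsChristoffel {n : ℕ} (G : Cn n → Cn n →L[ℝ] Cn n →L[ℝ] ℝ) (z u v γ : Cn n) : Prop :=
  ∀ w, G z γ w = (1 / 2) * (fderiv ℝ G z u v w + fderiv ℝ G z v u w - fderiv ℝ G z w u v)

/-- A hamiltonian 2-form: a smooth `J`-invariant 2-form `φ` such that, with `s = tr_ω φ`,
`∇_U φ = ½ (ds ∧ (JU)♭ - dᶜs ∧ U♭)` for every vector `U`, where `dᶜs = -ds ∘ J`. -/
structure IsHamiltonianTwoForm (φ : TwoTensor M.dim M.Carrier) : Prop where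
  antisymm : ∀ x v w, φ x v w = -φ x w v
  J_invariant : ∀ x v w, φ x (J x v) (J x w) = φ x v w
  smooth : IsSmoothForm φ
  equation : ∃ s : M.Carrier → ℝ, ContMDiff 𝓘(ℝ, Cn M.dim) 𝓘(ℝ, ℝ) ∞ s ∧ IsKahlerTrace M φ s ∧
    ∀ c ∈ atlas (Cn M.dim) M.Carrier, ∀ z ∈ c.target, ∀ u v w γv γw : Cn M.dim,
      IsChristoffel (localForm c M.g) z u v γv → IsChristoffel (localForm c M.g) z u w γw →
      fderiv ℝ (localForm c φ) z u v w - localForm c φ z γv w - localForm c φ z v γw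
        = (1 / 2) *
          (fderiv ℝ (s ∘ c.symm) z v * localForm c M.g z (Complex.I • u) w
            - fderiv ℝ (s ∘ c.symm) z w * localForm c M.g z (Complex.I • u) v
            + fderiv ℝ (s ∘ c.symm) z (Complex.I • v) * localForm c M.g z u w
            - fderiv ℝ (s ∘ c.symm) z (Complex.I • w) * localForm c M.g z u v)

end Hamiltonian

/-! ### Principal torus bundles over products of Kähler manifolds -/

/-- A principal bundle `P` over `∏ₐ Bₐ` for the torus `ℝ^ℓ / Λ`, with a connection 1-form
`θ = (θ₁, …, θ_ℓ)`. The torus action is recorded as an action of `ℝ^ℓ` with stabilizer `Λ`. -/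
structure TorusBundle (ℓ : ℕ) {N : ℕ} (B : Fin N → KahlerManifold.{v}) :
    Type (max v (w + 1)) where
  /-- the real dimension of `P` -/
  dimP : ℕ
  P : Type w
  [top : TopologicalSpace P]
  [t2 : T2Space P]
  [charted : ChartedSpace (EuclideanSpace ℝ (Fin dimP)) P]
  [manifold : IsManifold 𝓘(ℝ, EuclideanSpace ℝ (Fin dimP)) ∞ P]
  /-- the components of the projection -/
  proj : ∀ a, P → (B a).Carrier
  proj_smooth : ∀ a, ContMDiff 𝓘(ℝ, EuclideanSpace ℝ (Fin dimP)) 𝓘(ℝ, Cn (B a).dim) ∞ (proj a)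
  proj_surjective : ∀ b : ∀ a, (B a).Carrier, ∃ p, ∀ a, proj a p = b a
  /-- the lattice of the torus -/
  Λ : Submodule ℤ (Fin ℓ → ℝ)
  Λ_discrete : DiscreteTopology Λ
  Λ_spans : Submodule.span ℝ (Λ : Set (Fin ℓ → ℝ)) = ⊤
  act : (Fin ℓ → ℝ) → P → P
  act_zero : ∀ p, act 0 p = p
  act_add : ∀ s t p, act (s + t) p = act s (act t p)
  act_smooth : ContMDiff (𝓘(ℝ, Fin ℓ → ℝ).prod 𝓘(ℝ, EuclideanSpace ℝ (Fin dimP)))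
    𝓘(ℝ, EuclideanSpace ℝ (Fin dimP)) ∞ (fun x : (Fin ℓ → ℝ) × P => act x.1 x.2)
  act_eq_self : ∀ s p, act s p = p ↔ s ∈ Λ
  fiber_eq_orbit : ∀ p p', (∀ a, proj a p = proj a p') ↔ ∃ s, p' = act s p
  θ : ∀ p : P, TangentSpace 𝓘(ℝ, EuclideanSpace ℝ (Fin dimP)) p →L[ℝ] (Fin ℓ → ℝ)
  θ_smooth : ∀ c ∈ atlas (EuclideanSpace ℝ (Fin dimP)) P,
    ContDiffOn ℝ ∞ (fun z => (θ (c.symm z)).comp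
      (mfderiv 𝓘(ℝ, EuclideanSpace ℝ (Fin dimP)) 𝓘(ℝ, EuclideanSpace ℝ (Fin dimP)) c.symm z))
      c.target
  θ_fundamental : ∀ (p : P) (t : Fin ℓ → ℝ),
    θ (act 0 p) (mfderiv 𝓘(ℝ, Fin ℓ → ℝ) 𝓘(ℝ, EuclideanSpace ℝ (Fin dimP))
      (fun s => act s p) 0 t) = t
  θ_invariant : ∀ (t : Fin ℓ → ℝ) (p : P) (v : TangentSpace 𝓘(ℝ, EuclideanSpace ℝ (Fin dimP)) p),
    θ (act t p) (mfderiv 𝓘(ℝ, EuclideanSpace ℝ (Fin dimP)) 𝓘(ℝ, EuclideanSpace ℝ (Fin dimP))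
      (act t) p v) = θ p v
  /-- `ker θ` is a complement of the vertical space and projects isomorphically to the base. -/
  splitting : ∀ p : P, Function.Bijective
    (fun v : TangentSpace 𝓘(ℝ, EuclideanSpace ℝ (Fin dimP)) p =>
      ((fun a => mfderiv 𝓘(ℝ, EuclideanSpace ℝ (Fin dimP)) 𝓘(ℝ, Cn (B a).dim) (proj a) p v, θ p v) :
        (∀ a, (B a).T (proj a p)) × (Fin ℓ → ℝ)))

namespace TorusBundle

attribute [instance] top t2 charted manifold

variable {ℓ N : ℕ} {B : Fin N → KahlerManifold.{v}} (Q : TorusBundle.{v, w} ℓ B)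

/-- The model space of `P`. -/
abbrev E : Type := EuclideanSpace ℝ (Fin Q.dimP)

/-- The connection form in the coordinates of a chart of `P`. -/
def localθ (c : OpenPartialHomeomorph Q.P Q.E) (z : Q.E) : Q.E →L[ℝ] (Fin ℓ → ℝ) :=
  (Q.θ (c.symm z)).comp (mfderiv 𝓘(ℝ, Q.E) 𝓘(ℝ, Q.E) c.symm z)

/-- The pull-back to `P` of the metric of the `a`-th factor of the base. -/
def baseMetric (a : Fin N) (p : Q.P) (v w : TangentSpace 𝓘(ℝ, Q.E) p) : ℝ :=
  (B a).g (Q.proj a p) (mfderiv 𝓘(ℝ, Q.E) 𝓘(ℝ, Cn (B a).dim) (Q.proj a) p v)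
    (mfderiv 𝓘(ℝ, Q.E) 𝓘(ℝ, Cn (B a).dim) (Q.proj a) p w)

/-- The pull-back to `P` of the Kähler form of the `a`-th factor of the base. -/
def baseForm (a : Fin N) (p : Q.P) (v w : TangentSpace 𝓘(ℝ, Q.E) p) : ℝ :=
  (B a).kahlerForm (Q.proj a p) (mfderiv 𝓘(ℝ, Q.E) 𝓘(ℝ, Cn (B a).dim) (Q.proj a) p v)
    (mfderiv 𝓘(ℝ, Q.E) 𝓘(ℝ, Cn (B a).dim) (Q.proj a) p w)

/-- `dθ_r = ∑ₐ (-1)^r εₐ ηₐ^{ℓ-r} ω̌ₐ` for `r = 1, …, ℓ`; the index `r : Fin ℓ` stands for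
`r + 1`. -/
def HasCurvature (ε η : Fin N → ℝ) : Prop :=
  ∀ c ∈ atlas Q.E Q.P, ∀ z ∈ c.target, ∀ (v w : Q.E) (r : Fin ℓ),
    fderiv ℝ (Q.localθ c) z v w r - fderiv ℝ (Q.localθ c) z w v r
      = ∑ a, (-1) ^ (r.val + 1) * ε a * η a ^ (ℓ - (r.val + 1)) *
          Q.baseForm a (c.symm z)
            (mfderiv 𝓘(ℝ, Q.E) 𝓘(ℝ, Q.E) c.symm z v) (mfderiv 𝓘(ℝ, Q.E) 𝓘(ℝ, Q.E) c.symm z w)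

end TorusBundle

/-! ### The hamiltonian 2-form Ansatz of order `ℓ` -/

section Ansatz

variable {ℓ : ℕ}

/-- The `r`-th elementary symmetric function of the variables `ξ_i`, `i ∈ s`. -/
def esym (s : Finset (Fin ℓ)) (r : ℕ) (ξ : Fin ℓ → ℝ) : ℝ :=
  ∑ t ∈ s.powersetCard r, ∏ i ∈ t, ξ i

/-- `σ_r`, the `r`-th elementary symmetric function of all `ξ_i`. -/
def σ (r : ℕ) (ξ : Fin ℓ → ℝ) : ℝ := esym Finset.univ r ξ

/-- `σ_r(ξ̂_j)`, the `r`-th elementary symmetric function of the `ξ_i` with `i ≠ j`. -/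
def σhat (j : Fin ℓ) (r : ℕ) (ξ : Fin ℓ → ℝ) : ℝ := esym (Finset.univ.erase j) r ξ

/-- `dσ_r` -/
def dσ (r : ℕ) (ξ u : Fin ℓ → ℝ) : ℝ := fderiv ℝ (σ r) ξ u

/-- `Δ(ξ_j) = ∏_{i ≠ j} (ξ_j - ξ_i)` -/
def Δ (ξ : Fin ℓ → ℝ) (j : Fin ℓ) : ℝ := ∏ i ∈ Finset.univ.erase j, (ξ j - ξ i)

/-- `p_nc(t) = ∏_j (t - ξ_j)` -/
def pnc (ξ : Fin ℓ → ℝ) (t : ℝ) : ℝ := ∏ j, (t - ξ j)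

/-- `p_c(t) = ∏ₐ (t - ηₐ)^{dim Bₐ}` -/
def pc {N : ℕ} (B : Fin N → KahlerManifold.{v}) (η : Fin N → ℝ) (t : ℝ) : ℝ :=
  ∏ a, (t - η a) ^ (B a).dim

/-- The Kähler manifold `M` with the 2-form `φ` is given by the hamiltonian 2-form Ansatz of
order `ℓ`, with `(ξ_1, …, ξ_ℓ)` ranging over `D = I_1 × ⋯ × I_ℓ`: an open dense subset `M⁰` of `M`
is identified with `D × P` so that `g`, `ω` and `φ` take their normal forms there. In particular
`ξ_1, …, ξ_ℓ` are the non-constant and the `ηₐ` the constant eigenvalues of `φ` relative to `ω`. -/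
structure HamiltonianAnsatz (M : KahlerManifold.{u}) (φ : TwoTensor M.dim M.Carrier)
    (I : Fin ℓ → Set ℝ) : Type (max u (v + 1) (w + 1)) where
  N : ℕ
  B : Fin N → KahlerManifold.{v}
  Q : TorusBundle.{v, w} ℓ B
  ε : Fin N → ℝ
  ε_sign : ∀ a, ε a = 1 ∨ ε a = -1
  η : Fin N → ℝ
  curvature : Q.HasCurvature ε η
  F : Fin ℓ → ℝ → ℝ
  F_smooth : ∀ j, ContDiffOn ℝ ∞ (F j) (I j)
  pnc_pos : ∀ ξ ∈ univ.pi I, ∀ a, 0 < ε a * pnc ξ (η a)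
  /-- here `j : Fin ℓ` stands for the index `j + 1` -/
  F_pos : ∀ j, ∀ t ∈ I j, 0 < (-1) ^ (ℓ - (j.val + 1)) * F j t * pc B η t
  /-- the identification of `D × P` with `M⁰` -/
  Φ : (Fin ℓ → ℝ) × Q.P → M.Carrier
  Φ_smooth : ContMDiffOn (𝓘(ℝ, Fin ℓ → ℝ).prod 𝓘(ℝ, Q.E)) 𝓘(ℝ, Cn M.dim) ∞ Φ
    (univ.pi I ×ˢ univ)
  Φ_injective : InjOn Φ (univ.pi I ×ˢ univ)
  Φ_derivative : ∀ ξ ∈ univ.pi I, ∀ p, Function.Bijective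
    (mfderiv (𝓘(ℝ, Fin ℓ → ℝ).prod 𝓘(ℝ, Q.E)) 𝓘(ℝ, Cn M.dim) Φ (ξ, p))
  Φ_dense : Dense (Φ '' (univ.pi I ×ˢ univ))
  metric_eq : ∀ ξ ∈ univ.pi I, ∀ p, ∀ x y : (Fin ℓ → ℝ) × Q.E,
    M.g (Φ (ξ, p))
        (mfderiv (𝓘(ℝ, Fin ℓ → ℝ).prod 𝓘(ℝ, Q.E)) 𝓘(ℝ, Cn M.dim) Φ (ξ, p) x)
        (mfderiv (𝓘(ℝ, Fin ℓ → ℝ).prod 𝓘(ℝ, Q.E)) 𝓘(ℝ, Cn M.dim) Φ (ξ, p) y)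
      = ∑ a, ε a * pnc ξ (η a) * Q.baseMetric a p x.2 y.2
        + ∑ j, pc B η (ξ j) * Δ ξ j / F j (ξ j) * (x.1 j * y.1 j)
        + ∑ j, F j (ξ j) / (pc B η (ξ j) * Δ ξ j) *
            ((∑ r : Fin ℓ, σhat j r.val ξ * Q.θ p x.2 r) * (∑ r : Fin ℓ, σhat j r.val ξ * Q.θ p y.2 r))
  kahlerForm_eq : ∀ ξ ∈ univ.pi I, ∀ p, ∀ x y : (Fin ℓ → ℝ) × Q.E,
    M.kahlerForm (Φ (ξ, p))
        (mfderiv (𝓘(ℝ, Fin ℓ → ℝ).prod 𝓘(ℝ, Q.E)) 𝓘(ℝ, Cn M.dim) Φ (ξ, p) x)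
        (mfderiv (𝓘(ℝ, Fin ℓ → ℝ).prod 𝓘(ℝ, Q.E)) 𝓘(ℝ, Cn M.dim) Φ (ξ, p) y)
      = ∑ a, ε a * pnc ξ (η a) * Q.baseForm a p x.2 y.2
        + ∑ r : Fin ℓ, (dσ (r.val + 1) ξ x.1 * Q.θ p y.2 r - dσ (r.val + 1) ξ y.1 * Q.θ p x.2 r)
  /-- `φ = ∑ₐ εₐ ηₐ p_nc(ηₐ) ω̌ₐ + ∑_r (σ_r dσ_1 - dσ_{r+1}) ∧ θ_r`, where `σ_{ℓ+1} = 0` -/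
  form_eq : ∀ ξ ∈ univ.pi I, ∀ p, ∀ x y : (Fin ℓ → ℝ) × Q.E,
    φ (Φ (ξ, p))
        (mfderiv (𝓘(ℝ, Fin ℓ → ℝ).prod 𝓘(ℝ, Q.E)) 𝓘(ℝ, Cn M.dim) Φ (ξ, p) x)
        (mfderiv (𝓘(ℝ, Fin ℓ → ℝ).prod 𝓘(ℝ, Q.E)) 𝓘(ℝ, Cn M.dim) Φ (ξ, p) y)
      = ∑ a, ε a * η a * pnc ξ (η a) * Q.baseForm a p x.2 y.2
        + ∑ r : Fin ℓ,
          ((σ (r.val + 1) ξ * dσ 1 ξ x.1 - dσ (r.val + 2) ξ x.1) * Q.θ p y.2 r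
            - (σ (r.val + 1) ξ * dσ 1 ξ y.1 - dσ (r.val + 2) ξ y.1) * Q.θ p x.2 r)

/-- `K` is the vector field `K_r` with hamiltonian potential `σ_r`, i.e. `ω(K_r, ·) = -dσ_r` on
the dense open set `M⁰` where the `ξ_j` are coordinates. -/
def HamiltonianAnsatz.IsHamiltonianField {M : KahlerManifold.{u}}
    {φ : TwoTensor M.dim M.Carrier} {I : Fin ℓ → Set ℝ}
    (A : HamiltonianAnsatz.{u, v, w} M φ I) (r : ℕ) (K : ∀ x, M.T x) : Prop :=
  ∀ ξ ∈ univ.pi I, ∀ p, ∀ x : (Fin ℓ → ℝ) × A.Q.E,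
    M.kahlerForm (A.Φ (ξ, p)) (K (A.Φ (ξ, p)))
        (mfderiv (𝓘(ℝ, Fin ℓ → ℝ).prod 𝓘(ℝ, A.Q.E)) 𝓘(ℝ, Cn M.dim) A.Φ (ξ, p) x)
      = -dσ r ξ x.1

/-- The parameters of a Type 2 domain: `α_1 < ⋯ < α_{ℓ-1} < 0 < α_ℓ`. -/
structure IsType2 (α : Fin ℓ → ℝ) : Prop where
  strictMono : StrictMono α
  neg : ∀ j : Fin ℓ, j.val + 1 < ℓ → α j < 0
  pos : ∀ j : Fin ℓ, j.val + 1 = ℓ → 0 < α j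

/-- The factors of `𝒟₂ = (-∞, α_1) × (α_1, α_2) × ⋯ × (α_{ℓ-2}, α_{ℓ-1}) × (α_ℓ, ∞)`, for
`ℓ ≥ 2`. -/
def type2Interval (α : Fin ℓ → ℝ) (j : Fin ℓ) : Set ℝ :=
  if j.val + 1 = ℓ then Ioi (α j)
  else if j.val = 0 then Iio (α j)
  else Ioo (α ⟨j.val - 1, lt_of_le_of_lt (Nat.sub_le _ _) j.isLt⟩) (α j)

end Ansatz

end KRS

end

/-!
Let `q_j = F_j / p_c` and let `Y` be the gradient of `σ_1`, with components
`Y_j = q_j(ξ_j) / Δ(ξ_j) = |∇ξ_j|²`. The Lie derivatives of `g` and `ω` along `Y` are diagonal in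
the coordinates of the Ansatz, so `Y` is holomorphic, `iY` is Killing and
`Ric(iY, ·) = ½ d(Laplacian of σ_1)`. Contracting the soliton equation with `iY` shows that
`Laplacian of σ_1 + a |∇σ_1|² + 2λ σ_1` is locally constant.

Fix all coordinates but `ξ_j` and put `ξ_j = δt`, where `t → ∞` stays in the momentum domain. On
this ray the conserved quantity becomes a scalar equation for `h = |∇ξ_j|² > 0`,
`h' = -(δa + r) h - 2λδ² t + b`, with `r ≥ 0` tending to `0` and `b` convergent. As the domain is
unbounded in both directions, the sign of `δ` is free. If `λ > 0`, choose `δa ≥ 0`: then `h' → -∞`,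
against `h > 0`. If `λ < 0`, choose `δa < 0`: then `h` grows exponentially, so the ray has finite
length and converges in a complete `M`, although the potential of `aJK_1` has slope `-aδ ≠ 0` along
it.
-/

noncomputable section

namespace KRS

section Determinant

theorem hasDerivAt_det {𝕜 A m : Type*} [NontriviallyNormedField 𝕜] [NormedCommRing A]
    [NormedAlgebra 𝕜 A] [Fintype m] [DecidableEq m] {H : 𝕜 → Matrix m m A} {H' : Matrix m m A}
    {t : 𝕜} (hH : ∀ i j, HasDerivAt (fun s => H s i j) (H' i j) t) :
    HasDerivAt (fun s => (H s).det) ((H t).adjugate * H').trace t := by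
  have hcol : ∀ i, ((H t).adjugate * H') i i = ((H t).updateCol i fun k => H' k i).det :=
      fun i => by
    rw [← Matrix.cramer_apply, Matrix.cramer_eq_adjugate_mulVec]
    rfl
  have hperm : ∀ (τ : Equiv.Perm m) (i : m),
      ∏ k, (H t).updateCol i (fun k => H' k i) (τ k) k
        = (∏ k ∈ Finset.univ.erase i, H t (τ k) k) * H' (τ i) i := fun τ i => by
    rw [← Finset.prod_erase_mul _ _ (Finset.mem_univ i), Matrix.updateCol_self]
    congr 1
    exact Finset.prod_congr rfl fun k hk => Matrix.updateCol_ne (Finset.ne_of_mem_erase hk)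
  simp only [Matrix.trace, Matrix.diag, hcol, Matrix.det_apply, hperm]
  rw [Finset.sum_comm]
  refine HasDerivAt.fun_sum fun τ _ => ?_
  rw [← Finset.smul_sum]
  exact (HasDerivAt.fun_finsetProd fun i _ => hH (τ i) i).const_smul (Equiv.Perm.sign τ)

theorem trace_adjugate_mul_transpose_mul {R m : Type*} [CommRing R] [Fintype m] [DecidableEq m]
    (H A : Matrix m m R) : (H.adjugate * (A.transpose * H)).trace = H.det * A.trace := by
  rw [← Matrix.mul_assoc, Matrix.trace_mul_comm, ← Matrix.mul_assoc, Matrix.mul_adjugate,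
    Matrix.smul_mul, Matrix.one_mul, Matrix.trace_smul, Matrix.trace_transpose, smul_eq_mul]

theorem trace_adjugate_mul_mul {R m : Type*} [CommRing R] [Fintype m] [DecidableEq m]
    (H A : Matrix m m R) : (H.adjugate * (H * A)).trace = H.det * A.trace := by
  rw [← Matrix.mul_assoc, Matrix.adjugate_mul, Matrix.smul_mul, Matrix.one_mul, Matrix.trace_smul,
    smul_eq_mul]

theorem det_fromBlocks_complex_structure {m : Type*} [Fintype m] [DecidableEq m]
    (S T : Matrix m m ℂ) : (Matrix.fromBlocks S T (-T) S).det
      = (S + Complex.I • T).det * (S - Complex.I • T).det := by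
  have hreduce : Matrix.fromBlocks 1 (Complex.I • 1) 0 1 * Matrix.fromBlocks S T (-T) S
      * Matrix.fromBlocks 1 (-(Complex.I • 1)) 0 1
        = Matrix.fromBlocks (S - Complex.I • T) 0 (-T) (S + Complex.I • T) := by
    simp only [Matrix.fromBlocks_multiply, Matrix.fromBlocks_inj]
    refine ⟨?_, ?_, ?_, ?_⟩ <;> simp [smul_smul, sub_eq_add_neg, add_comm (Complex.I • T)]
    abel
  have hdet := congrArg Matrix.det hreduce
  rwa [Matrix.det_mul, Matrix.det_mul, Matrix.det_fromBlocks_zero₂₁, Matrix.det_fromBlocks_zero₂₁,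
    Matrix.det_one, one_mul, one_mul, mul_one, Matrix.det_fromBlocks_zero₁₂, mul_comm] at hdet

end Determinant

section HermitianForm

variable {n : ℕ}

theorem I_smul_I_smul (u : Cn n) : Complex.I • Complex.I • u = -u := by
  rw [smul_smul, Complex.I_mul_I, neg_one_smul]

theorem apply_I_smul_left {G : Cn n →L[ℝ] Cn n →L[ℝ] ℝ}
    (hG : ∀ u w, G (Complex.I • u) (Complex.I • w) = G u w) (u w : Cn n) :
    G (Complex.I • u) w = -G u (Complex.I • w) := by
  rw [← hG u, I_smul_I_smul, map_neg, neg_neg]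

/-- The real basis `e_1, …, e_n, i e_1, …, i e_n` of `ℂⁿ`. -/
def realBasis (n : ℕ) : Module.Basis (Fin n ⊕ Fin n) ℝ (Cn n) :=
  (Complex.basisOneI.smulTower (EuclideanSpace.basisFun (Fin n) ℂ).toBasis).reindex
    ((finTwoEquiv.prodCongr (Equiv.refl _)).trans (Equiv.boolProdEquivSum _))

theorem realBasis_inl (j : Fin n) : realBasis n (.inl j) = EuclideanSpace.single j 1 := by
  simp [realBasis, Module.Basis.smulTower_apply, finTwoEquiv]

theorem realBasis_inr (j : Fin n) :
    realBasis n (.inr j) = Complex.I • EuclideanSpace.single j 1 := by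
  simp [realBasis, Module.Basis.smulTower_apply, finTwoEquiv]

/-- The real Gram matrix of a bilinear form on `ℂⁿ`. -/
def gram (G : Cn n →L[ℝ] Cn n →L[ℝ] ℝ) : Matrix (Fin n ⊕ Fin n) (Fin n ⊕ Fin n) ℝ :=
  LinearMap.BilinForm.toMatrix (realBasis n) G.toBilinForm

theorem gram_apply (G : Cn n →L[ℝ] Cn n →L[ℝ] ℝ) (i j : Fin n ⊕ Fin n) :
    gram G i j = G (realBasis n i) (realBasis n j) :=
  LinearMap.BilinForm.toMatrix_apply _ _ _ _

theorem ofReal_det_gram {G : Cn n →L[ℝ] Cn n →L[ℝ] ℝ}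
    (hG : ∀ u w, G (Complex.I • u) (Complex.I • w) = G u w) :
    ((gram G).det : ℂ)
      = (hermitianMatrix G).det * ((hermitianMatrix G).map (starRingEnd ℂ)).det := by
  set S : Matrix (Fin n) (Fin n) ℂ :=
    Matrix.of fun j k => (G (EuclideanSpace.single j 1) (EuclideanSpace.single k 1) : ℂ)
  set T : Matrix (Fin n) (Fin n) ℂ :=
    Matrix.of fun j k => (G (EuclideanSpace.single j 1) (Complex.I • EuclideanSpace.single k 1) : ℂ)
  have hgram : (gram G).map (Complex.ofRealHom) = Matrix.fromBlocks S T (-T) S := by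
    ext (j | j) (k | k) <;>
      simp [gram_apply, realBasis_inl, realBasis_inr, hG, apply_I_smul_left hG, S, T]
  have hconj : (hermitianMatrix G).map (starRingEnd ℂ) = S - Complex.I • T := by
    ext j k
    simp [hermitianMatrix, S, T, sub_eq_add_neg]
  rw [hconj, show hermitianMatrix G = S + Complex.I • T from rfl,
    ← det_fromBlocks_complex_structure, ← hgram]
  exact Complex.ofRealHom.map_det _

/-- A positive definite `J`-invariant real inner product on `ℂⁿ`. -/
structure IsHermitianForm (G : Cn n →L[ℝ] Cn n →L[ℝ] ℝ) : Prop where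
  symm : ∀ u w, G u w = G w u
  pos : ∀ u, u ≠ 0 → 0 < G u u
  inv : ∀ u w, G (Complex.I • u) (Complex.I • w) = G u w

namespace IsHermitianForm

variable {G : Cn n →L[ℝ] Cn n →L[ℝ] ℝ}

theorem eq_of_forall (hG : IsHermitianForm G) {u u' : Cn n} (h : ∀ w, G u w = G u' w) :
    u = u' := by
  by_contra hne
  have hpos := hG.pos (u - u') (sub_ne_zero.2 hne)
  rw [map_sub G, sub_apply, h, sub_self] at hpos
  exact hpos.false

theorem det_gram_ne_zero (hG : IsHermitianForm G) : (gram G).det ≠ 0 := by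
  have hleft : G.toBilinForm.SeparatingLeft := fun u hu => by
    by_contra hne
    exact (hG.pos u hne).ne' (hu u)
  exact (LinearMap.BilinForm.nondegenerate_iff_det_ne_zero (realBasis n)).1
    (LinearMap.BilinForm.nondegenerate_iff_ker_eq_bot.2
      (LinearMap.separatingLeft_iff_ker_eq_bot.1 hleft))

theorem det_gram (hG : IsHermitianForm G) : (gram G).det = (hermitianMatrix G).det.re ^ 2 := by
  have hherm : (hermitianMatrix G).map (starRingEnd ℂ) = (hermitianMatrix G).transpose := by
    ext j k
    have hI := apply_I_smul_left hG.inv (EuclideanSpace.single k 1) (EuclideanSpace.single j 1)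
    rw [hG.symm] at hI
    simp [hermitianMatrix, hI, hG.symm (EuclideanSpace.single k 1) (EuclideanSpace.single j 1)]
  have hreal : (starRingEnd ℂ) (hermitianMatrix G).det = (hermitianMatrix G).det := by
    rw [RingHom.map_det, RingHom.mapMatrix_apply, hherm, Matrix.det_transpose]
  have hdet := ofReal_det_gram hG.inv
  rw [hherm, Matrix.det_transpose, ← Complex.conj_eq_iff_re.1 hreal] at hdet
  rw [sq]
  exact_mod_cast hdet

end IsHermitianForm

end HermitianForm

section LieDerivative

variable {E : Type*} [NormedAddCommGroup E] [NormedSpace ℝ E]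

theorem fderiv_form_apply {F : Type*} [NormedAddCommGroup F] [NormedSpace ℝ F]
    {G : E → F →L[ℝ] F →L[ℝ] ℝ} {z : E} (hG : DifferentiableAt ℝ G z) (y : E) (u w : F) :
    fderiv ℝ G z y u w = fderiv ℝ (fun z => G z u w) z y := by
  rw [((hG.hasFDerivAt.clm_apply (hasFDerivAt_const u z)).clm_apply
    (hasFDerivAt_const w z)).fderiv]
  simp

theorem fderiv_fderiv_apply_comm {F : Type*} [NormedAddCommGroup F] [NormedSpace ℝ F] {f : E → F}
    {z : E} (hf : ContDiffAt ℝ 2 f z) (u w : E) :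
    fderiv ℝ (fderiv ℝ f) z u w = fderiv ℝ (fderiv ℝ f) z w u :=
  hf.isSymmSndFDerivAt minSmoothness_of_isRCLikeNormedField.le u w

theorem differentiableAt_fderiv {F : Type*} [NormedAddCommGroup F] [NormedSpace ℝ F] {f : E → F}
    {z : E} (hf : ContDiffAt ℝ 2 f z) : DifferentiableAt ℝ (fderiv ℝ f) z :=
  (hf.fderiv_right (m := 1) le_rfl).differentiableAt one_ne_zero

/-- The Lie derivative of the bilinear form `G` along the vector field `Y` on a vector space. -/
def lieDeriv (G : E → E →L[ℝ] E →L[ℝ] ℝ) (Y : E → E) (z u w : E) : ℝ :=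
  fderiv ℝ G z (Y z) u w + G z (fderiv ℝ Y z u) w + G z u (fderiv ℝ Y z w)

theorem lieDeriv_const_smul (G : E → E →L[ℝ] E →L[ℝ] ℝ) (Y : E → E) (z : E) (a : ℝ) (u w : E) :
    lieDeriv G (a • Y) z u w = a * lieDeriv G Y z u w := by
  simp only [lieDeriv, fderiv_const_smul_field, Pi.smul_apply, ContinuousLinearMap.map_smul,
    smul_apply, smul_eq_mul]
  ring

theorem lieDeriv_congr (G : E → E →L[ℝ] E →L[ℝ] ℝ) {Y Y' : E → E} {z : E} (h : Y =ᶠ[𝓝 z] Y')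
    (u w : E) : lieDeriv G Y z u w = lieDeriv G Y' z u w := by
  simp only [lieDeriv, h.fderiv_eq, h.self_of_nhds]

end LieDerivative

section Divergence

variable {n : ℕ}

/-- `log det h`, the logarithm of the volume density of a field of real bilinear forms. -/
def logDet (G : Cn n → Cn n →L[ℝ] Cn n →L[ℝ] ℝ) (z : Cn n) : ℝ :=
  Real.log (hermitianMatrix (G z)).det.re

theorem logDet_eq {G : Cn n → Cn n →L[ℝ] Cn n →L[ℝ] ℝ} {z : Cn n} (hG : IsHermitianForm (G z)) :
    logDet G z = (1 / 2) * Real.log (gram (G z)).det := by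
  rw [hG.det_gram, Real.log_pow, logDet]
  push_cast
  ring

theorem contDiffAt_logDet {m : ℕ∞ω} {G : Cn n → Cn n →L[ℝ] Cn n →L[ℝ] ℝ} {z : Cn n}
    (hG : ContDiffAt ℝ m G z) (hH : IsHermitianForm (G z)) : ContDiffAt ℝ m (logDet G) z := by
  have hentry : ∀ u w : Cn n, ContDiffAt ℝ m (fun z => ((G z u w : ℝ) : ℂ)) z := fun u w =>
    Complex.ofRealCLM.contDiff.contDiffAt.comp z
      ((hG.clm_apply contDiffAt_const).clm_apply contDiffAt_const)
  have hdet : ContDiffAt ℝ m (fun z => (hermitianMatrix (G z)).det) z := by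
    simp only [Matrix.det_apply]
    exact ContDiffAt.sum fun τ _ => (contDiffAt_prod fun i _ =>
      (hentry _ _).add (contDiffAt_const.mul (hentry _ _))).const_smul (Equiv.Perm.sign τ : ℤˣ)
  refine (Complex.reCLM.contDiff.contDiffAt.comp z hdet).log fun h0 => hH.det_gram_ne_zero ?_
  rw [hH.det_gram, show (hermitianMatrix (G z)).det.re = 0 from h0, zero_pow two_ne_zero]

/-- The divergence of the vector field `Y` with respect to the volume density `exp v`. -/
def divergence (v : Cn n → ℝ) (Y : Cn n → Cn n) (z : Cn n) : ℝ :=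
  fderiv ℝ v z (Y z) + LinearMap.trace ℝ (Cn n) (fderiv ℝ Y z)

/-- The real trace of an endomorphism of `ℂⁿ` as a continuous linear functional. -/
def traceCLM (n : ℕ) : (Cn n →L[ℝ] Cn n) →L[ℝ] ℝ :=
  LinearMap.toContinuousLinearMap
    ((LinearMap.trace ℝ (Cn n)).comp (ContinuousLinearMap.coeLM ℝ))

theorem hasFDerivAt_divergence {v : Cn n → ℝ} {Y : Cn n → Cn n} {z : Cn n}
    (hv : ContDiffAt ℝ 2 v z) (hY : ContDiffAt ℝ 2 Y z) :
    HasFDerivAt (divergence v Y) ((fderiv ℝ (fderiv ℝ v) z).flip (Y z)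
      + (fderiv ℝ v z).comp (fderiv ℝ Y z) + (traceCLM n).comp (fderiv ℝ (fderiv ℝ Y) z)) z := by
  refine (((differentiableAt_fderiv hv).hasFDerivAt.clm_apply
    (hY.differentiableAt two_ne_zero).hasFDerivAt).add ((traceCLM n).hasFDerivAt.comp z
      (differentiableAt_fderiv hY).hasFDerivAt)).congr_fderiv ?_
  abel

theorem hasDerivAt_det_gram {G : Cn n → Cn n →L[ℝ] Cn n →L[ℝ] ℝ} {z y : Cn n}
    (hG : DifferentiableAt ℝ G z) {C d : Cn n →ₗ[ℝ] Cn n}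
    (hL : ∀ u w, fderiv ℝ G z y u w + G z (d u) w + G z u (d w) = G z (C u) w) :
    HasDerivAt (fun t : ℝ => (gram (G (z + t • y))).det)
      ((gram (G z)).det * (LinearMap.trace ℝ (Cn n) C - 2 * LinearMap.trace ℝ (Cn n) d)) 0 := by
  have hentry : ∀ i j, HasDerivAt (fun t : ℝ => gram (G (z + t • y)) i j)
      (gram (fderiv ℝ G z y) i j) 0 := fun i j => by
    simp only [gram_apply, fderiv_form_apply hG]
    exact ((hG.clm_apply (differentiableAt_const _)).clm_apply
      (differentiableAt_const _)).hasFDerivAt.hasLineDerivAt y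
  have hgram : gram (fderiv ℝ G z y)
      = (LinearMap.toMatrix (realBasis n) (realBasis n) C).transpose * gram (G z)
        - (LinearMap.toMatrix (realBasis n) (realBasis n) d).transpose * gram (G z)
        - gram (G z) * LinearMap.toMatrix (realBasis n) (realBasis n) d := by
    simp only [gram]
    rw [← LinearMap.BilinForm.toMatrix_compLeft, ← LinearMap.BilinForm.toMatrix_compLeft,
      ← LinearMap.BilinForm.toMatrix_compRight, ← map_sub, ← map_sub]
    congr 1
    ext u w
    simpa [sub_sub] using eq_sub_of_add_eq ((add_assoc _ _ _).symm.trans (hL u w))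
  refine (hasDerivAt_det hentry).congr_deriv ?_
  simp only [zero_smul, add_zero, hgram, mul_sub, Matrix.trace_sub,
    trace_adjugate_mul_transpose_mul, trace_adjugate_mul_mul, ← LinearMap.trace_eq_matrix_trace]
  ring

theorem divergence_logDet {G : Cn n → Cn n →L[ℝ] Cn n →L[ℝ] ℝ} {Y : Cn n → Cn n} {z : Cn n}
    {C : Cn n →ₗ[ℝ] Cn n} (hG : ContDiffAt ℝ 1 G z) (hH : ∀ᶠ z' in 𝓝 z, IsHermitianForm (G z'))
    (hL : ∀ u w, lieDeriv G Y z u w = G z (C u) w) :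
    divergence (logDet G) Y z = (1 / 2) * LinearMap.trace ℝ (Cn n) C := by
  have hne := hH.self_of_nhds.det_gram_ne_zero
  have hline : HasDerivAt (fun t : ℝ => logDet G (z + t • Y z)) (fderiv ℝ (logDet G) z (Y z)) 0 :=
    ((contDiffAt_logDet hG hH.self_of_nhds).differentiableAt
      one_ne_zero).hasFDerivAt.hasLineDerivAt (Y z)
  have hray : Tendsto (fun t : ℝ => z + t • Y z) (𝓝 0) (𝓝 z) := by
    simpa using (show Continuous fun t : ℝ => z + t • Y z by fun_prop).tendsto 0
  have hgram := ((hasDerivAt_det_gram (hG.differentiableAt one_ne_zero) hL).log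
    (by rwa [zero_smul, add_zero])).const_mul (1 / 2 : ℝ)
  rw [divergence, hline.unique (hgram.congr_of_eventuallyEq
    ((hray.eventually hH).mono fun t ht => logDet_eq ht)), zero_smul, add_zero,
    mul_div_cancel_left₀ _ hne]
  ring

end Divergence

section KahlerMetric

variable {n : ℕ}

/-- The form `(u, w) ↦ G(iu, w)` attached to a field of bilinear forms on `ℂⁿ`. -/
def jForm (G : Cn n → Cn n →L[ℝ] Cn n →L[ℝ] ℝ) (z : Cn n) : Cn n →L[ℝ] Cn n →L[ℝ] ℝ :=
  (G z).comp (Complex.I • ContinuousLinearMap.id ℝ (Cn n))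

theorem jForm_apply (G : Cn n → Cn n →L[ℝ] Cn n →L[ℝ] ℝ) (z u w : Cn n) :
    jForm G z u w = G z (Complex.I • u) w := rfl

theorem form_neg_apply (b : Cn n →L[ℝ] Cn n →L[ℝ] ℝ) (u w : Cn n) : b (-u) w = -b u w :=
  congrArg (· w) (ContinuousLinearMap.map_neg b u)

theorem differentiableAt_jForm {G : Cn n → Cn n →L[ℝ] Cn n →L[ℝ] ℝ} {z : Cn n}
    (hG : DifferentiableAt ℝ G z) : DifferentiableAt ℝ (jForm G) z :=
  hG.clm_comp (differentiableAt_const _)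

theorem fderiv_jForm_apply {G : Cn n → Cn n →L[ℝ] Cn n →L[ℝ] ℝ} {z : Cn n}
    (hG : DifferentiableAt ℝ G z) (y u w : Cn n) :
    fderiv ℝ (jForm G) z y u w = fderiv ℝ G z y (Complex.I • u) w := by
  rw [fderiv_form_apply hG, fderiv_form_apply (differentiableAt_jForm hG)]
  simp only [jForm_apply]

theorem fderiv_I_smul (Y : Cn n → Cn n) (z u : Cn n) :
    fderiv ℝ (Complex.I • Y) z u = Complex.I • fderiv ℝ Y z u := by
  rw [fderiv_const_smul_field]
  rfl

theorem fderiv_fderiv_I_smul (Y : Cn n → Cn n) (z u w : Cn n) :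
    fderiv ℝ (fderiv ℝ (Complex.I • Y)) z u w = Complex.I • fderiv ℝ (fderiv ℝ Y) z u w := by
  rw [fderiv_const_smul_field, fderiv_const_smul_field (f := fderiv ℝ Y) Complex.I]
  rfl

theorem fderiv_fderiv_apply_I_smul {Y : Cn n → Cn n} {z : Cn n} (hY : ContDiffAt ℝ 2 Y z)
    (hhol : ∀ᶠ z' in 𝓝 z, ∀ u, fderiv ℝ Y z' (Complex.I • u) = Complex.I • fderiv ℝ Y z' u)
    (u w : Cn n) :
    fderiv ℝ (fderiv ℝ Y) z (Complex.I • u) w = Complex.I • fderiv ℝ (fderiv ℝ Y) z u w := by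
  have hY' := (differentiableAt_fderiv hY).hasFDerivAt
  have hleft := hY'.clm_apply (hasFDerivAt_const (Complex.I • u) z)
  have hright := (hY'.clm_apply (hasFDerivAt_const u z)).const_smul Complex.I
  have heq := congrArg (· w) (hleft.unique (hright.congr_of_eventuallyEq
    (hhol.mono fun z' hz' => hz' u)))
  rw [fderiv_fderiv_apply_comm hY, fderiv_fderiv_apply_comm hY u]
  simpa using heq

/-- A Kähler metric of class `C²` on an open subset `U` of `ℂⁿ`. -/
structure IsKahlerOn (G : Cn n → Cn n →L[ℝ] Cn n →L[ℝ] ℝ) (U : Set (Cn n)) : Prop where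
  isOpen : IsOpen U
  contDiffOn : ContDiffOn ℝ 2 G U
  hermitian : ∀ z ∈ U, IsHermitianForm (G z)
  closed : ∀ z ∈ U, ∀ u v w, fderiv ℝ (jForm G) z u v w + fderiv ℝ (jForm G) z v w u
    + fderiv ℝ (jForm G) z w u v = 0

/-- `Y` is the gradient on `U` of the function `s`, for the metric `G`. -/
structure IsGradientOn (G : Cn n → Cn n →L[ℝ] Cn n →L[ℝ] ℝ) (Y : Cn n → Cn n) (s : Cn n → ℝ)
    (U : Set (Cn n)) : Prop where
  contDiffOn : ContDiffOn ℝ 2 Y U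
  contDiffOn_potential : ContDiffOn ℝ 2 s U
  apply_eq : ∀ z ∈ U, ∀ w, G z (Y z) w = fderiv ℝ s z w

/-- The Lie derivatives along `Y` of the metric `G` and of its fundamental form are obtained by
composing these forms with one and the same field `C` of endomorphisms. -/
structure IsLieEndomorphism (G : Cn n → Cn n →L[ℝ] Cn n →L[ℝ] ℝ) (Y : Cn n → Cn n)
    (C : Cn n → Cn n →ₗ[ℝ] Cn n) (U : Set (Cn n)) : Prop where
  metric : ∀ z ∈ U, ∀ u w, lieDeriv G Y z u w = G z (C z u) w
  fundamentalForm : ∀ z ∈ U, ∀ u w, lieDeriv (jForm G) Y z u w = jForm G z (C z u) w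

variable {G : Cn n → Cn n →L[ℝ] Cn n →L[ℝ] ℝ} {Y : Cn n → Cn n} {s : Cn n → ℝ}
  {C : Cn n → Cn n →ₗ[ℝ] Cn n} {U : Set (Cn n)} {z : Cn n}

namespace IsKahlerOn

theorem contDiffAt (hG : IsKahlerOn G U) (hz : z ∈ U) : ContDiffAt ℝ 2 G z :=
  hG.contDiffOn.contDiffAt (hG.isOpen.mem_nhds hz)

theorem differentiableAt (hG : IsKahlerOn G U) (hz : z ∈ U) : DifferentiableAt ℝ G z :=
  (hG.contDiffAt hz).differentiableAt two_ne_zero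

theorem fderiv_symm (hG : IsKahlerOn G U) (hz : z ∈ U) (y u w : Cn n) :
    fderiv ℝ G z y u w = fderiv ℝ G z y w u := by
  rw [fderiv_form_apply (hG.differentiableAt hz), fderiv_form_apply (hG.differentiableAt hz)]
  rw [Filter.EventuallyEq.fderiv_eq (eventually_of_mem (hG.isOpen.mem_nhds hz)
    fun z' hz' => (hG.hermitian z' hz').symm u w)]

theorem fderiv_inv (hG : IsKahlerOn G U) (hz : z ∈ U) (y u w : Cn n) :
    fderiv ℝ G z y (Complex.I • u) (Complex.I • w) = fderiv ℝ G z y u w := by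
  rw [fderiv_form_apply (hG.differentiableAt hz), fderiv_form_apply (hG.differentiableAt hz)]
  rw [Filter.EventuallyEq.fderiv_eq (eventually_of_mem (hG.isOpen.mem_nhds hz)
    fun z' hz' => (hG.hermitian z' hz').inv u w)]

theorem contDiffAt_gradient (hG : IsKahlerOn G U) (hY : IsGradientOn G Y s U) (hz : z ∈ U) :
    ContDiffAt ℝ 2 Y z :=
  hY.contDiffOn.contDiffAt (hG.isOpen.mem_nhds hz)

theorem differentiableAt_gradient (hG : IsKahlerOn G U) (hY : IsGradientOn G Y s U) (hz : z ∈ U) :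
    DifferentiableAt ℝ Y z :=
  (hG.contDiffAt_gradient hY hz).differentiableAt two_ne_zero

theorem contDiffAt_potential (hG : IsKahlerOn G U) (hY : IsGradientOn G Y s U) (hz : z ∈ U) :
    ContDiffAt ℝ 2 s z :=
  hY.contDiffOn_potential.contDiffAt (hG.isOpen.mem_nhds hz)

theorem fderiv_fderiv_potential (hG : IsKahlerOn G U) (hY : IsGradientOn G Y s U) (hz : z ∈ U)
    (u w : Cn n) : fderiv ℝ (fderiv ℝ s) z u w
      = fderiv ℝ G z u (Y z) w + G z (fderiv ℝ Y z u) w := by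
  have hs := (differentiableAt_fderiv (hG.contDiffAt_potential hY hz)).hasFDerivAt.clm_apply
    (hasFDerivAt_const w z)
  have hGY := ((hG.differentiableAt hz).hasFDerivAt.clm_apply
    (hG.differentiableAt_gradient hY hz).hasFDerivAt).clm_apply (hasFDerivAt_const w z)
  have heq := congrArg (· u) (hs.unique (hGY.congr_of_eventuallyEq
    (eventually_of_mem (hG.isOpen.mem_nhds hz) fun z' hz' => (hY.apply_eq z' hz' w).symm)))
  simpa [add_comm] using heq

theorem lieDeriv_symm (hG : IsKahlerOn G U) (hz : z ∈ U) (u w : Cn n) :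
    lieDeriv G Y z u w = lieDeriv G Y z w u := by
  simp only [lieDeriv, hG.fderiv_symm hz _ u w, (hG.hermitian z hz).symm _ w,
    (hG.hermitian z hz).symm u]
  ring

theorem lieDeriv_jForm (hG : IsKahlerOn G U) (hz : z ∈ U) (u w : Cn n) :
    lieDeriv (jForm G) Y z u w = fderiv ℝ G z (Y z) (Complex.I • u) w
      + G z (Complex.I • fderiv ℝ Y z u) w + G z (Complex.I • u) (fderiv ℝ Y z w) := by
  rw [lieDeriv, fderiv_jForm_apply (hG.differentiableAt hz)]
  rfl

theorem lieDeriv_jForm_antisymm (hG : IsKahlerOn G U) (hz : z ∈ U) (u w : Cn n) :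
    lieDeriv (jForm G) Y z u w = -lieDeriv (jForm G) Y z w u := by
  have hH := hG.hermitian z hz
  have hfd := hG.fderiv_inv hz (Y z) (Complex.I • u) w
  rw [I_smul_I_smul, map_neg, neg_apply] at hfd
  have hfd' := hG.fderiv_symm hz (Y z) u (Complex.I • w)
  have h₁ := apply_I_smul_left hH.inv (fderiv ℝ Y z u) w
  have h₂ := apply_I_smul_left hH.inv u (fderiv ℝ Y z w)
  rw [hG.lieDeriv_jForm hz, hG.lieDeriv_jForm hz, hH.symm _ u, hH.symm (Complex.I • w)]
  linarith

theorem endomorphism_I_smul (hG : IsKahlerOn G U) (hC : IsLieEndomorphism G Y C U) (hz : z ∈ U)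
    (u : Cn n) : C z (Complex.I • u) = Complex.I • C z u := by
  have hH := hG.hermitian z hz
  refine hH.eq_of_forall fun w => ?_
  have hskew := hG.lieDeriv_jForm_antisymm (Y := Y) hz u w
  rw [hC.fundamentalForm z hz, hC.fundamentalForm z hz, jForm_apply, jForm_apply,
    apply_I_smul_left hH.inv (C z w), neg_neg] at hskew
  rw [hskew, ← hC.metric z hz, hG.lieDeriv_symm hz, hC.metric z hz]

theorem fderiv_gradient_I_smul (hG : IsKahlerOn G U) (hC : IsLieEndomorphism G Y C U) (hz : z ∈ U)
    (u : Cn n) : fderiv ℝ Y z (Complex.I • u) = Complex.I • fderiv ℝ Y z u := by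
  refine (hG.hermitian z hz).eq_of_forall fun w => ?_
  have hmetric := hC.metric z hz (Complex.I • u) w
  have hform := hC.fundamentalForm z hz u w
  rw [lieDeriv, hG.endomorphism_I_smul hC hz] at hmetric
  rw [hG.lieDeriv_jForm hz, jForm_apply] at hform
  linarith

theorem lieDeriv_I_smul_gradient (hG : IsKahlerOn G U) (hY : IsGradientOn G Y s U)
    (hhol : ∀ u, fderiv ℝ Y z (Complex.I • u) = Complex.I • fderiv ℝ Y z u) (hz : z ∈ U)
    (u w : Cn n) : lieDeriv G (Complex.I • Y) z u w = 0 := by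
  have hH := hG.hermitian z hz
  -- closedness at `(iY, iu, w)` expresses the derivative of `G` along `iY` by derivatives along
  -- `iu` and `w`, which pair with `Y` and hence are computed by the Hessian of `s`
  have hclosed := hG.closed z hz (Complex.I • Y z) (Complex.I • u) w
  have hneg : ∀ y u w, fderiv ℝ G z y (-u) w = -fderiv ℝ G z y u w := fun y u w => by
    rw [ContinuousLinearMap.map_neg (fderiv ℝ G z y), neg_apply]
  rw [fderiv_jForm_apply (hG.differentiableAt hz), fderiv_jForm_apply (hG.differentiableAt hz),
    fderiv_jForm_apply (hG.differentiableAt hz), I_smul_I_smul, I_smul_I_smul, form_neg_apply,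
    form_neg_apply, hG.fderiv_inv hz] at hclosed
  have hhess := fderiv_fderiv_apply_comm (hG.contDiffAt_potential hY hz) w (Complex.I • u)
  rw [hG.fderiv_fderiv_potential hY hz, hG.fderiv_fderiv_potential hY hz, hhol] at hhess
  have hcross := apply_I_smul_left hH.inv u (fderiv ℝ Y z w)
  rw [lieDeriv, Pi.smul_apply, fderiv_I_smul, fderiv_I_smul]
  have hsymm₁ := hG.fderiv_symm hz (Complex.I • u) w (Y z)
  have hsymm₂ := hH.symm (Complex.I • u) (fderiv ℝ Y z w)
  linarith

theorem divergence_I_smul_gradient (hG : IsKahlerOn G U) (hY : IsGradientOn G Y s U)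
    (hC : IsLieEndomorphism G Y C U) (hz : z ∈ U) :
    divergence (logDet G) (Complex.I • Y) z = 0 := by
  rw [divergence_logDet (C := 0) ((hG.contDiffAt hz).of_le one_le_two)
    (eventually_of_mem (hG.isOpen.mem_nhds hz) hG.hermitian) fun u w => ?_, map_zero, mul_zero]
  rw [hG.lieDeriv_I_smul_gradient hY (hG.fderiv_gradient_I_smul hC hz) hz, LinearMap.zero_apply,
    map_zero, zero_apply]

theorem metric_endomorphism_gradient (hG : IsKahlerOn G U) (hY : IsGradientOn G Y s U)
    (hC : IsLieEndomorphism G Y C U) (hz : z ∈ U) (w : Cn n) :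
    G z (C z (Y z)) w = fderiv ℝ (fun z' => fderiv ℝ s z' (Y z')) z w := by
  have hprod := (differentiableAt_fderiv (hG.contDiffAt_potential hY hz)).hasFDerivAt.clm_apply
    (hG.differentiableAt_gradient hY hz).hasFDerivAt
  rw [hprod.fderiv, ← hC.metric z hz, lieDeriv, hY.apply_eq z hz, add_comm (_ + _),
    ← hG.fderiv_fderiv_potential hY hz,
    fderiv_fderiv_apply_comm (hG.contDiffAt_potential hY hz)]
  simp

theorem iddbar_neg_logDet (hG : IsKahlerOn G U) (hY : IsGradientOn G Y s U)
    (hC : IsLieEndomorphism G Y C U) (hz : z ∈ U) (w : Cn n) :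
    iddbar (fun z' => -logDet G z') z (Complex.I • Y z) w
      = (1 / 2) * fderiv ℝ (divergence (logDet G) Y) z w := by
  have hU := hG.isOpen.mem_nhds hz
  have hv := contDiffAt_logDet (hG.contDiffAt hz) (hG.hermitian z hz)
  have hhol : ∀ᶠ z' in 𝓝 z, ∀ u, fderiv ℝ Y z' (Complex.I • u) = Complex.I • fderiv ℝ Y z' u :=
    eventually_of_mem hU fun z' hz' => hG.fderiv_gradient_I_smul hC hz'
  have hdiv := congrArg (· w) (hasFDerivAt_divergence hv (hG.contDiffAt_gradient hY hz)).fderiv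
  have hIY : ContDiffAt ℝ 2 (Complex.I • Y) z :=
    (hG.contDiffAt_gradient hY hz).const_smul Complex.I
  have hdivI := congrArg (· (Complex.I • w)) (((hasFDerivAt_divergence hv
    hIY).congr_of_eventuallyEq (eventually_of_mem hU fun z' hz' =>
      (hG.divergence_I_smul_gradient hY hC hz').symm)).unique (hasFDerivAt_const 0 z))
  have htrace : fderiv ℝ (fderiv ℝ (Complex.I • Y)) z (Complex.I • w)
      = -fderiv ℝ (fderiv ℝ Y) z w := ContinuousLinearMap.ext fun u => by
    rw [fderiv_fderiv_I_smul, fderiv_fderiv_apply_I_smul (hG.contDiffAt_gradient hY hz) hhol,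
      I_smul_I_smul]
    rfl
  simp only [add_apply, ContinuousLinearMap.comp_apply, ContinuousLinearMap.flip_apply,
    Pi.smul_apply, htrace, fderiv_I_smul, hhol.self_of_nhds, I_smul_I_smul,
    ContinuousLinearMap.map_neg, zero_apply] at hdiv hdivI
  have hneg : fderiv ℝ (fun z' => -logDet G z') = -fderiv ℝ (logDet G) :=
    funext fun _ => fderiv_fun_neg
  rw [iddbar, hneg, fderiv_neg, I_smul_I_smul, hdiv, ContinuousLinearMap.map_neg, neg_apply,
    neg_apply, neg_apply, neg_apply, neg_apply, fderiv_fderiv_apply_comm hv w (Y z),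
    fderiv_fderiv_apply_comm hv (Complex.I • Y z)]
  linarith

theorem divergence_eq_trace (hG : IsKahlerOn G U) (hC : IsLieEndomorphism G Y C U) (hz : z ∈ U) :
    divergence (logDet G) Y z = (1 / 2) * LinearMap.trace ℝ (Cn n) (C z) :=
  divergence_logDet ((hG.contDiffAt hz).of_le one_le_two)
    (eventually_of_mem (hG.isOpen.mem_nhds hz) hG.hermitian) (hC.metric z hz)

theorem hasFDerivAt_soliton (hG : IsKahlerOn G U) (hY : IsGradientOn G Y s U)
    (hC : IsLieEndomorphism G Y C U) (hz : z ∈ U) {a lam : ℝ}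
    (hsol : ∀ u w, iddbar (fun z' => -logDet G z') z u w
      + (1 / 2) * lieDeriv (jForm G) (-a • Y) z u w = lam * jForm G z u w) :
    HasFDerivAt (fun z' : Cn n => divergence (logDet G) Y z' + a * fderiv ℝ s z' (Y z')
      + 2 * lam * s z') (0 : Cn n →L[ℝ] ℝ) z := by
  have hv := contDiffAt_logDet (hG.contDiffAt hz) (hG.hermitian z hz)
  have hdiv := (hasFDerivAt_divergence hv (hG.contDiffAt_gradient hY hz)).differentiableAt
  have hsY : DifferentiableAt ℝ (fun z' : Cn n => fderiv ℝ s z' (Y z')) z :=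
    (differentiableAt_fderiv (hG.contDiffAt_potential hY hz)).clm_apply
      (hG.differentiableAt_gradient hY hz)
  have hs := (hG.contDiffAt_potential hY hz).differentiableAt two_ne_zero
  refine ((hdiv.hasFDerivAt.add (hsY.hasFDerivAt.const_mul a)).add
    (hs.hasFDerivAt.const_mul (2 * lam))).congr_fderiv (ContinuousLinearMap.ext fun w => ?_)
  have hcontract := hsol (Complex.I • Y z) w
  rw [hG.iddbar_neg_logDet hY hC hz, lieDeriv_const_smul, hC.fundamentalForm z hz, jForm_apply,
    jForm_apply, hG.endomorphism_I_smul hC hz, I_smul_I_smul, I_smul_I_smul,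
    form_neg_apply, form_neg_apply, hG.metric_endomorphism_gradient hY hC hz,
    hY.apply_eq z hz] at hcontract
  simp only [add_apply, smul_apply, smul_eq_mul, zero_apply]
  linarith

end IsKahlerOn

end KahlerMetric

section Symmetric

variable {ℓ : ℕ}

theorem esym_zero (s : Finset (Fin ℓ)) (ξ : Fin ℓ → ℝ) : esym s 0 ξ = 1 := by
  simp [esym]

theorem esym_empty_succ (r : ℕ) (ξ : Fin ℓ → ℝ) : esym ∅ (r + 1) ξ = 0 := by
  rw [esym, Finset.powersetCard_eq_empty.2 (by simp), Finset.sum_empty]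

theorem esym_insert_succ {s : Finset (Fin ℓ)} {k : Fin ℓ} (hk : k ∉ s) (r : ℕ)
    (ξ : Fin ℓ → ℝ) : esym (insert k s) (r + 1) ξ = esym s (r + 1) ξ + ξ k * esym s r ξ := by
  have hmem : ∀ t ∈ s.powersetCard r, k ∉ t := fun t ht h =>
    hk ((Finset.mem_powersetCard.1 ht).1 h)
  rw [esym, Finset.powersetCard_succ_insert hk, Finset.sum_union, Finset.sum_image]
  · congr 1
    rw [esym, Finset.mul_sum]
    exact Finset.sum_congr rfl fun t ht => Finset.prod_insert (hmem t ht)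
  · intro t ht t' ht' h
    rw [← Finset.erase_insert (hmem t ht), h, Finset.erase_insert (hmem t' ht')]
  · rw [Finset.disjoint_left]
    intro t ht ht'
    obtain ⟨t', -, rfl⟩ := Finset.mem_image.1 ht'
    exact hk ((Finset.mem_powersetCard.1 ht).1 (Finset.mem_insert_self _ _))

theorem differentiable_esym (s : Finset (Fin ℓ)) (r : ℕ) : Differentiable ℝ (esym s r) := by
  unfold esym
  fun_prop

theorem hasDerivAt_line {E : Type*} [NormedAddCommGroup E] [NormedSpace ℝ E] (x y : E) (t : ℝ) :
    HasDerivAt (fun t : ℝ => x + t • y) y t := by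
  simpa using ((hasDerivAt_id t).smul_const y).const_add x

variable {c : ℝ → Fin ℓ → ℝ} {y : Fin ℓ → ℝ} {t : ℝ}

theorem hasDerivAt_esym (hc : HasDerivAt c y t) (s : Finset (Fin ℓ)) (r : ℕ) :
    HasDerivAt (fun t => esym s (r + 1) (c t)) (∑ k ∈ s, esym (s.erase k) r (c t) * y k) t := by
  induction s using Finset.induction_on generalizing r with
  | empty =>
    simp only [esym_empty_succ, Finset.sum_empty]
    exact hasDerivAt_const _ _
  | insert k s hk ih =>
    simp only [esym_insert_succ hk]
    rw [Finset.sum_insert hk, Finset.erase_insert hk]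
    have hk' : ∀ i, k ∉ s.erase i := fun i h => hk (Finset.mem_of_mem_erase h)
    have hne : ∀ i ∈ s, (insert k s).erase i = insert k (s.erase i) := fun i hi =>
      Finset.erase_insert_of_ne fun h => hk (h ▸ hi)
    cases r with
    | zero =>
      simp only [esym_zero, mul_one, one_mul]
      refine ((ih 0).add (hasDerivAt_pi.1 hc k)).congr_deriv ?_
      simp only [esym_zero, one_mul, add_comm]
    | succ r =>
      refine ((ih (r + 1)).add ((hasDerivAt_pi.1 hc k).mul (ih r))).congr_deriv ?_
      have hsum : ∑ i ∈ s, esym ((insert k s).erase i) (r + 1) (c t) * y i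
          = ∑ i ∈ s, esym (s.erase i) (r + 1) (c t) * y i
            + c t k * ∑ i ∈ s, esym (s.erase i) r (c t) * y i := by
        rw [Finset.mul_sum, ← Finset.sum_add_distrib]
        refine Finset.sum_congr rfl fun i hi => ?_
        rw [hne i hi, esym_insert_succ (hk' i)]
        ring
      rw [hsum]
      ring

theorem dσ_succ (r : ℕ) (ξ x : Fin ℓ → ℝ) : dσ (r + 1) ξ x = ∑ j, σhat j r ξ * x j := by
  have hσ := (differentiable_esym Finset.univ (r + 1) ξ).hasFDerivAt.hasLineDerivAt x
  have hline := hasDerivAt_esym (hasDerivAt_line ξ x 0) Finset.univ r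
  rw [zero_smul, add_zero] at hline
  exact hσ.unique hline

theorem dσ_one (ξ x : Fin ℓ → ℝ) : dσ 1 ξ x = ∑ j, x j := by
  rw [dσ_succ]
  simp [σhat, esym_zero]

theorem hasDerivAt_σhat (hc : HasDerivAt c y t) (hinj : Function.Injective (c t)) (j : Fin ℓ)
    (r : ℕ) : HasDerivAt (fun t => σhat j r (c t))
      (∑ k, y k * (σhat j r (c t) - σhat k r (c t)) * (c t k - c t j)⁻¹) t := by
  cases r with
  | zero =>
    simp only [σhat, esym_zero, sub_self, mul_zero, zero_mul, Finset.sum_const_zero]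
    exact hasDerivAt_const _ _
  | succ r =>
    refine (hasDerivAt_esym hc (Finset.univ.erase j) r).congr_deriv ?_
    rw [← Finset.add_sum_erase Finset.univ _ (Finset.mem_univ j), sub_self, mul_zero, zero_mul,
      zero_add]
    refine Finset.sum_congr rfl fun k hk => ?_
    have hkj : k ≠ j := Finset.ne_of_mem_erase hk
    set s := (Finset.univ.erase j).erase k with hs
    have hks : k ∉ s := Finset.notMem_erase _ _
    have hjs : j ∉ s := fun h => Finset.notMem_erase j _ (Finset.mem_of_mem_erase h)
    have herase_j : Finset.univ.erase j = insert k s := (Finset.insert_erase hk).symm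
    have herase_k : Finset.univ.erase k = insert j s := by
      rw [hs, Finset.erase_right_comm, Finset.insert_erase]; simp [hkj.symm]
    have hne : c t k - c t j ≠ 0 := sub_ne_zero.2 fun h => hkj (hinj h)
    rw [σhat, σhat, herase_j, herase_k, esym_insert_succ hks, esym_insert_succ hjs]
    field_simp
    ring

end Symmetric

section Orthotoric

theorem sum_sum_eq_zero_of_antisymm {ι : Type*} [Fintype ι] {f : ι → ι → ℝ}
    (hf : ∀ i j, f i j = -f j i) : ∑ i, ∑ j, f i j = 0 := by
  refine self_eq_neg.1 ?_
  conv_lhs => rw [Finset.sum_comm]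
  simp only [← Finset.sum_neg_distrib]
  exact Finset.sum_congr rfl fun i _ => Finset.sum_congr rfl fun j _ => hf j i

theorem inv_sub_swap (a b : ℝ) : (a - b)⁻¹ = -(b - a)⁻¹ := by
  rw [← inv_neg, neg_sub]

variable {ℓ : ℕ}

/-- The components `Y_j = q_j(ξ_j) / Δ(ξ_j)` of the gradient of `σ_1`, where `q_j = F_j / p_c`. -/
def gradComp (q : Fin ℓ → ℝ → ℝ) (ξ : Fin ℓ → ℝ) (j : Fin ℓ) : ℝ := q j (ξ j) / Δ ξ j

/-- The partial derivative `∂Y_j/∂ξ_j`, where `q' j` is the value of `q_j'` at `ξ_j`. -/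
def gradCompDiag (q : Fin ℓ → ℝ → ℝ) (q' ξ : Fin ℓ → ℝ) (j : Fin ℓ) : ℝ :=
  q' j / Δ ξ j - gradComp q ξ j * ∑ i, (ξ j - ξ i)⁻¹

/-- The differential of `Y_j`. -/
def gradCompDeriv (q : Fin ℓ → ℝ → ℝ) (q' ξ x : Fin ℓ → ℝ) (j : Fin ℓ) : ℝ :=
  gradCompDiag q q' ξ j * x j + gradComp q ξ j * ∑ i, (ξ j - ξ i)⁻¹ * x i

/-- The eigenvalues of the Hessian of `σ_1` on the span of the `∂/∂ξ_j`. -/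
def hessEigen (q : Fin ℓ → ℝ → ℝ) (q' ξ : Fin ℓ → ℝ) (j : Fin ℓ) : ℝ :=
  gradCompDiag q q' ξ j + ∑ k, gradComp q ξ k * (ξ k - ξ j)⁻¹

/-- `τ_j = ∑_r σ_{r-1}(ξ̂_j) θ_r` -/
def tau (ξ θ : Fin ℓ → ℝ) (j : Fin ℓ) : ℝ := ∑ r : Fin ℓ, σhat j r.val ξ * θ r

/-- The fibre part of the metric, as a function of `ξ`. -/
def fibreMetric (q : Fin ℓ → ℝ → ℝ) (ξ x θx y θy : Fin ℓ → ℝ) : ℝ :=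
  ∑ j, (gradComp q ξ j)⁻¹ * (x j * y j) + ∑ j, gradComp q ξ j * (tau ξ θx j * tau ξ θy j)

/-- The fibre part of the Kähler form, as a function of `ξ`. -/
def fibreForm (ξ x θx y θy : Fin ℓ → ℝ) : ℝ :=
  ∑ j, (x j * tau ξ θy j - y j * tau ξ θx j)

theorem tau_zero (ξ : Fin ℓ → ℝ) (j : Fin ℓ) : tau ξ 0 j = 0 := by
  simp [tau]

theorem Δ_ne_zero {ξ : Fin ℓ → ℝ} (hinj : Function.Injective ξ) (j : Fin ℓ) : Δ ξ j ≠ 0 :=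
  Finset.prod_ne_zero_iff.2 fun _ hi =>
    sub_ne_zero.2 fun h => Finset.ne_of_mem_erase hi (hinj h).symm

theorem fibreForm_eq (ξ x θx y θy : Fin ℓ → ℝ) :
    ∑ r : Fin ℓ, (dσ (r.val + 1) ξ x * θy r - dσ (r.val + 1) ξ y * θx r)
      = fibreForm ξ x θx y θy := by
  have hpair : ∀ x θ : Fin ℓ → ℝ,
      ∑ r : Fin ℓ, dσ (r.val + 1) ξ x * θ r = ∑ j, x j * tau ξ θ j := fun x θ => by
    simp only [dσ_succ, tau, Finset.sum_mul, Finset.mul_sum]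
    rw [Finset.sum_comm]
    exact Finset.sum_congr rfl fun j _ => Finset.sum_congr rfl fun r _ => by ring
  rw [Finset.sum_sub_distrib, hpair, hpair, fibreForm, Finset.sum_sub_distrib]

section Derivatives

variable {c : ℝ → Fin ℓ → ℝ} {y : Fin ℓ → ℝ} {t : ℝ}

theorem hasDerivAt_Δ (hc : HasDerivAt c y t) (hinj : Function.Injective (c t)) (j : Fin ℓ) :
    HasDerivAt (fun t => Δ (c t) j) (Δ (c t) j * ∑ i, (c t j - c t i)⁻¹ * (y j - y i)) t := by
  refine (HasDerivAt.fun_finsetProd fun i _ =>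
    (hasDerivAt_pi.1 hc j).fun_sub (hasDerivAt_pi.1 hc i)).congr_deriv ?_
  rw [← Finset.add_sum_erase Finset.univ _ (Finset.mem_univ j), sub_self (y j), mul_zero,
    zero_add, Finset.mul_sum]
  refine Finset.sum_congr rfl fun i hi => ?_
  have hne : c t j - c t i ≠ 0 :=
    sub_ne_zero.2 fun h => Finset.ne_of_mem_erase hi (hinj h).symm
  rw [Δ, ← Finset.mul_prod_erase _ _ hi, smul_eq_mul]
  field_simp

theorem hasDerivAt_pnc (hc : HasDerivAt c y t) {e : ℝ} (he : ∀ j, c t j ≠ e) :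
    HasDerivAt (fun t => pnc (c t) e) ((∑ j, y j * (c t j - e)⁻¹) * pnc (c t) e) t := by
  refine (HasDerivAt.fun_finsetProd fun j _ => (hasDerivAt_pi.1 hc j).const_sub e).congr_deriv ?_
  rw [Finset.sum_mul]
  refine Finset.sum_congr rfl fun j _ => ?_
  have hne : c t j - e ≠ 0 := sub_ne_zero.2 (he j)
  rw [pnc, ← Finset.mul_prod_erase _ _ (Finset.mem_univ j), smul_eq_mul, ← neg_sub (c t j) e]
  field_simp

theorem hasDerivAt_tau (hc : HasDerivAt c y t) (hinj : Function.Injective (c t))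
    (θ : Fin ℓ → ℝ) (j : Fin ℓ) : HasDerivAt (fun t => tau (c t) θ j)
      (∑ k, y k * (tau (c t) θ j - tau (c t) θ k) * (c t k - c t j)⁻¹) t := by
  refine (HasDerivAt.fun_sum fun (r : Fin ℓ) _ =>
    (hasDerivAt_σhat hc hinj j r.val).mul_const (θ r)).congr_deriv ?_
  simp only [Finset.sum_mul, tau, ← Finset.sum_sub_distrib, Finset.mul_sum]
  rw [Finset.sum_comm]
  exact Finset.sum_congr rfl fun k _ => Finset.sum_congr rfl fun r _ => by ring

variable {q : Fin ℓ → ℝ → ℝ} {q' : Fin ℓ → ℝ}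

theorem hasDerivAt_gradComp (hc : HasDerivAt c y t) (hinj : Function.Injective (c t)) {j : Fin ℓ}
    (hq : HasDerivAt (q j) (q' j) (c t j)) :
    HasDerivAt (fun t => gradComp q (c t) j) (gradCompDeriv q q' (c t) y j) t := by
  have hΔ := Δ_ne_zero hinj j
  refine ((hq.comp t (hasDerivAt_pi.1 hc j)).fun_div (hasDerivAt_Δ hc hinj j) hΔ).congr_deriv ?_
  simp only [Function.comp_apply, gradCompDeriv, gradCompDiag, gradComp, mul_sub,
    Finset.sum_sub_distrib, ← Finset.sum_mul]
  field_simp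
  ring

end Derivatives

section LieDerivatives

variable {q : Fin ℓ → ℝ → ℝ} {q' ξ : Fin ℓ → ℝ}

theorem sum_hessEigen : ∑ j, hessEigen q q' ξ j = ∑ j, q' j / Δ ξ j := by
  simp only [hessEigen, gradCompDiag, Finset.sum_add_distrib, Finset.sum_sub_distrib,
    Finset.mul_sum]
  rw [Finset.sum_comm (f := fun j k => gradComp q ξ k * (ξ k - ξ j)⁻¹)]
  ring

theorem gradCompDeriv_self (j : Fin ℓ) : gradCompDeriv q q' ξ (gradComp q ξ) j
    = gradComp q ξ j * (2 * gradCompDiag q q' ξ j - hessEigen q q' ξ j) := by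
  have hswap : ∑ i, (ξ j - ξ i)⁻¹ * gradComp q ξ i = -∑ k, gradComp q ξ k * (ξ k - ξ j)⁻¹ := by
    rw [← Finset.sum_neg_distrib]
    refine Finset.sum_congr rfl fun i _ => ?_
    rw [inv_sub_swap]
    ring
  rw [gradCompDeriv, hswap, hessEigen]
  ring

theorem tau_deriv_eq (θ : Fin ℓ → ℝ) (j : Fin ℓ) :
    ∑ k, gradComp q ξ k * (tau ξ θ j - tau ξ θ k) * (ξ k - ξ j)⁻¹
      = (hessEigen q q' ξ j - gradCompDiag q q' ξ j) * tau ξ θ j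
        - ∑ k, gradComp q ξ k * tau ξ θ k * (ξ k - ξ j)⁻¹ := by
  rw [hessEigen, add_sub_cancel_left, Finset.sum_mul, ← Finset.sum_sub_distrib]
  exact Finset.sum_congr rfl fun k _ => by ring

theorem sum_gradCompDeriv_symm (hY : ∀ j, gradComp q ξ j ≠ 0) (x y : Fin ℓ → ℝ) :
    ∑ j, (gradComp q ξ j)⁻¹ * (gradCompDeriv q q' ξ x j * y j)
      + ∑ j, (gradComp q ξ j)⁻¹ * (x j * gradCompDeriv q q' ξ y j)
      = ∑ j, 2 * gradCompDiag q q' ξ j * (gradComp q ξ j)⁻¹ * (x j * y j) := by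
  have hoff : ∑ i, ∑ j, (ξ i - ξ j)⁻¹ * (x j * y i + x i * y j) = 0 :=
    sum_sum_eq_zero_of_antisymm fun i j => by rw [inv_sub_swap]; ring
  rw [← add_zero (∑ j, 2 * _ * _ * _), ← hoff, ← Finset.sum_add_distrib,
    ← Finset.sum_add_distrib]
  refine Finset.sum_congr rfl fun j _ => ?_
  have hsplit : ∑ i, (ξ j - ξ i)⁻¹ * (x i * y j + x j * y i)
      = (∑ i, (ξ j - ξ i)⁻¹ * x i) * y j + x j * ∑ i, (ξ j - ξ i)⁻¹ * y i := by
    rw [Finset.sum_mul, Finset.mul_sum, ← Finset.sum_add_distrib]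
    exact Finset.sum_congr rfl fun i _ => by ring
  have hYj := hY j
  rw [hsplit, gradCompDeriv, gradCompDeriv]
  field_simp
  ring

theorem sum_offDiag_symm (ξ Y s t : Fin ℓ → ℝ) :
    ∑ j, Y j * ((∑ k, Y k * s k * (ξ k - ξ j)⁻¹) * t j
      + s j * ∑ k, Y k * t k * (ξ k - ξ j)⁻¹) = 0 := by
  have hoff : ∑ i, ∑ j, (ξ j - ξ i)⁻¹ * (Y i * Y j * (s j * t i + s i * t j)) = 0 :=
    sum_sum_eq_zero_of_antisymm fun i j => by rw [inv_sub_swap]; ring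
  rw [← hoff]
  refine Finset.sum_congr rfl fun j _ => ?_
  rw [Finset.sum_mul, Finset.mul_sum, ← Finset.sum_add_distrib, Finset.mul_sum]
  exact Finset.sum_congr rfl fun i _ => by ring

theorem sum_gradCompDeriv_mul (x s : Fin ℓ → ℝ) : ∑ j, gradCompDeriv q q' ξ x j * s j
    = ∑ j, (gradCompDiag q q' ξ j * x j * s j
      + x j * ∑ k, gradComp q ξ k * s k * (ξ k - ξ j)⁻¹) := by
  simp only [gradCompDeriv, add_mul, Finset.sum_add_distrib, Finset.mul_sum, Finset.sum_mul]
  congr 1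
  rw [Finset.sum_comm]
  exact Finset.sum_congr rfl fun j _ => Finset.sum_congr rfl fun r _ => by ring

variable {c : ℝ → Fin ℓ → ℝ} {t : ℝ}

theorem hasDerivAt_fibreMetric (hc : HasDerivAt c (gradComp q (c t)) t)
    (hinj : Function.Injective (c t)) (hq : ∀ j, HasDerivAt (q j) (q' j) (c t j))
    (hY : ∀ j, gradComp q (c t) j ≠ 0) (x θx y θy : Fin ℓ → ℝ) :
    HasDerivAt (fun t => fibreMetric q (c t) x θx y θy)
      (∑ j, hessEigen q q' (c t) j * ((gradComp q (c t) j)⁻¹ * (x j * y j)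
          + gradComp q (c t) j * (tau (c t) θx j * tau (c t) θy j))
        - fibreMetric q (c t) (gradCompDeriv q q' (c t) x) 0 y θy
        - fibreMetric q (c t) x θx (gradCompDeriv q q' (c t) y) 0) t := by
  have hYd := fun j => hasDerivAt_gradComp hc hinj (hq j)
  refine ((HasDerivAt.fun_sum fun (j : Fin ℓ) _ =>
    ((hYd j).fun_inv (hY j)).mul_const (x j * y j)).fun_add
      (HasDerivAt.fun_sum fun (j : Fin ℓ) _ => (hYd j).fun_mul
        ((hasDerivAt_tau hc hinj θx j).fun_mul (hasDerivAt_tau hc hinj θy j)))).congr_deriv ?_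
  simp only [fibreMetric, tau_zero, zero_mul, mul_zero, Finset.sum_const_zero, add_zero,
    tau_deriv_eq (q := q) (q' := q'), gradCompDeriv_self]
  rw [sub_sub, sum_gradCompDeriv_symm hY, ← sub_zero (_ - _),
    ← sum_offDiag_symm (c t) (gradComp q (c t)) (tau (c t) θx) (tau (c t) θy),
    ← Finset.sum_sub_distrib, ← Finset.sum_sub_distrib, ← Finset.sum_add_distrib]
  refine Finset.sum_congr rfl fun j _ => ?_
  have hYj := hY j
  field_simp
  ring

theorem hasDerivAt_fibreForm (hc : HasDerivAt c (gradComp q (c t)) t)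
    (hinj : Function.Injective (c t)) (x θx y θy : Fin ℓ → ℝ) :
    HasDerivAt (fun t => fibreForm (c t) x θx y θy)
      (∑ j, hessEigen q q' (c t) j * (x j * tau (c t) θy j - y j * tau (c t) θx j)
        - fibreForm (c t) (gradCompDeriv q q' (c t) x) 0 y θy
        - fibreForm (c t) x θx (gradCompDeriv q q' (c t) y) 0) t := by
  refine (HasDerivAt.fun_sum fun (j : Fin ℓ) _ =>
    ((hasDerivAt_tau hc hinj θy j).const_mul (x j)).fun_sub
      ((hasDerivAt_tau hc hinj θx j).const_mul (y j))).congr_deriv ?_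
  simp only [tau_deriv_eq (q := q) (q' := q'), fibreForm, tau_zero, mul_zero, sub_zero, zero_sub,
    Finset.sum_neg_distrib, sum_gradCompDeriv_mul, sub_neg_eq_add]
  rw [← Finset.sum_sub_distrib, ← Finset.sum_add_distrib]
  exact Finset.sum_congr rfl fun j _ => by ring

end LieDerivatives

end Orthotoric

section Charts

variable {n : ℕ} {M : Type u} [TopologicalSpace M] [ChartedSpace (Cn n) M]

/-- The differential of a chart, in the coordinates of the preferred chart of the source: the
tangent spaces of `M` are all modelled on `ℂⁿ` by their preferred charts. -/
def chartDeriv (c : OpenPartialHomeomorph M (Cn n)) (x : M) : Cn n →L[ℝ] Cn n :=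
  mfderiv 𝓘(ℝ, Cn n) 𝓘(ℝ, Cn n) c x

/-- The coordinate frame of a chart, in the coordinates of the preferred chart. -/
def frameDeriv (c : OpenPartialHomeomorph M (Cn n)) (z : Cn n) : Cn n →L[ℝ] Cn n := frame c z

/-- The values of a bilinear form, in the coordinates of the preferred chart. -/
def formAt (β : TwoTensor n M) (x : M) : Cn n →L[ℝ] Cn n →L[ℝ] ℝ := β x

theorem localForm_apply (c : OpenPartialHomeomorph M (Cn n)) (β : TwoTensor n M) (z u w : Cn n) :
    localForm c β z u w = formAt β (c.symm z) (frameDeriv c z u) (frameDeriv c z w) := rfl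

theorem formAt_fundamentalForm (β : TwoTensor n M) (x : M) (u w : Cn n) :
    formAt (fundamentalForm β) x u w = formAt β x (Complex.I • u) w := rfl

variable [IsManifold 𝓘(ℂ, Cn n) ω M] {c : OpenPartialHomeomorph M (Cn n)}

theorem differentiableAt_transition (hc : c ∈ atlas (Cn n) M) {x : M} (hx : x ∈ c.source) :
    DifferentiableAt ℂ ((chartAt (Cn n) x).symm ≫ₕ c) (chartAt (Cn n) x x) := by
  have hcompat := (contDiffGroupoid ω 𝓘(ℂ, Cn n)).compatible (chart_mem_atlas (Cn n) x) hc
  rw [contDiffGroupoid, mem_groupoid_of_pregroupoid] at hcompat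
  have htrans := hcompat.1
  simp only [contDiffPregroupoid, modelWithCornersSelf_coe, modelWithCornersSelf_coe_symm,
    Function.comp_id, Function.id_comp, range_id, inter_univ, preimage_id] at htrans
  have hmem : chartAt (Cn n) x x ∈ ((chartAt (Cn n) x).symm ≫ₕ c).source := by simp [hx]
  exact ((htrans _ hmem).contDiffAt (((chartAt (Cn n) x).symm ≫ₕ c).open_source.mem_nhds
    hmem)).differentiableAt (by simp)

theorem chartDeriv_eq_fderiv (hc : c ∈ atlas (Cn n) M) {x : M} (hx : x ∈ c.source) :
    chartDeriv c x = (fderiv ℂ ((chartAt (Cn n) x).symm ≫ₕ c)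
      (chartAt (Cn n) x x)).restrictScalars ℝ :=
  HasMFDerivAt.mfderiv ⟨c.continuousAt hx, ((differentiableAt_transition hc
    hx).hasFDerivAt.restrictScalars ℝ).hasFDerivWithinAt⟩

theorem chartDeriv_I_smul (hc : c ∈ atlas (Cn n) M) {x : M} (hx : x ∈ c.source) (v : Cn n) :
    chartDeriv c x (Complex.I • v) = Complex.I • chartDeriv c x v := by
  rw [chartDeriv_eq_fderiv hc hx]
  exact (fderiv ℂ ((chartAt (Cn n) x).symm ≫ₕ c) (chartAt (Cn n) x x)).map_smul Complex.I v

theorem chartDeriv_frameDeriv (hc : c ∈ atlas (Cn n) M) {z : Cn n} (hz : z ∈ c.target)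
    (u : Cn n) : chartDeriv c (c.symm z) (frameDeriv c z u) = u :=
  congrArg (fun L : Cn n →L[ℝ] Cn n => L u)
    ((mdifferentiable_of_mem_atlas (I := 𝓘(ℝ, Cn n)) hc).comp_symm_deriv hz)

theorem frameDeriv_chartDeriv (hc : c ∈ atlas (Cn n) M) {x : M} (hx : x ∈ c.source) (u : Cn n) :
    frameDeriv c (c x) (chartDeriv c x u) = u :=
  congrArg (fun L : Cn n →L[ℝ] Cn n => L u)
    ((mdifferentiable_of_mem_atlas (I := 𝓘(ℝ, Cn n)) hc).symm_comp_deriv hx)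

theorem chartDeriv_bijective (hc : c ∈ atlas (Cn n) M) {x : M} (hx : x ∈ c.source) :
    Function.Bijective (chartDeriv c x) :=
  (mdifferentiable_of_mem_atlas (I := 𝓘(ℝ, Cn n)) hc).mfderiv_bijective hx

theorem frameDeriv_I_smul (hc : c ∈ atlas (Cn n) M) {z : Cn n} (hz : z ∈ c.target) (u : Cn n) :
    frameDeriv c z (Complex.I • u) = Complex.I • frameDeriv c z u := by
  apply (chartDeriv_bijective hc (c.map_target hz)).1
  rw [chartDeriv_I_smul hc (c.map_target hz), chartDeriv_frameDeriv hc hz,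
    chartDeriv_frameDeriv hc hz]

theorem localForm_fundamentalForm (hc : c ∈ atlas (Cn n) M) {z : Cn n} (hz : z ∈ c.target)
    (β : TwoTensor n M) (u w : Cn n) :
    localForm c (fundamentalForm β) z u w = localForm c β z (Complex.I • u) w := by
  rw [localForm_apply, localForm_apply, formAt_fundamentalForm, frameDeriv_I_smul hc hz]

theorem fderiv_comp_symm {e : OpenPartialHomeomorph M (Cn n)} (he : e ∈ atlas (Cn n) M)
    (hc : c ∈ atlas (Cn n) M) {z : Cn n} (hz : z ∈ c.target) (hz' : c.symm z ∈ e.source) :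
    fderiv ℝ (e ∘ c.symm) z = (chartDeriv e (c.symm z)).comp (frameDeriv c z) := by
  rw [← mfderiv_eq_fderiv]
  exact mfderiv_comp z (mdifferentiableAt_atlas he hz') (mdifferentiableAt_atlas_symm hc hz)

theorem trivializationAt_frame (hc : c ∈ atlas (Cn n) M) (x : M) {z : Cn n} (hz : z ∈ c.target)
    (hz' : c.symm z ∈ (chartAt (Cn n) x).source) (u : Cn n) :
    (trivializationAt (Cn n) (TangentSpace 𝓘(ℝ, Cn n)) x ⟨c.symm z, frame c z u⟩).2
      = fderiv ℝ (chartAt (Cn n) x ∘ c.symm) z u := by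
  have hlin : (trivializationAt (Cn n) (TangentSpace 𝓘(ℝ, Cn n)) x ⟨c.symm z, frame c z u⟩).2
      = (trivializationAt (Cn n) (TangentSpace 𝓘(ℝ, Cn n)) x).continuousLinearMapAt ℝ
        (c.symm z) (frame c z u) := by
    rw [Trivialization.continuousLinearMapAt_apply, Trivialization.coe_linearMapAt_of_mem]
    exact hz'
  rw [hlin, TangentBundle.continuousLinearMapAt_trivializationAt (I := 𝓘(ℝ, Cn n)) hz',
    fderiv_comp_symm (chart_mem_atlas _ _) hc hz hz']
  rfl

theorem contMDiffAt_frame (hc : c ∈ atlas (Cn n) M) {z : Cn n} (hz : z ∈ c.target) (u : Cn n) :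
    ContMDiffAt 𝓘(ℝ, Cn n) (𝓘(ℝ, Cn n).prod 𝓘(ℝ, Cn n)) ∞
      (fun z => (⟨c.symm z, frame c z u⟩ :
        TotalSpace (Cn n) (fun x : M => TangentSpace 𝓘(ℝ, Cn n) x))) z := by
  rw [contMDiffAt_totalSpace]
  refine ⟨contMDiffAt_symm_of_mem_maximalAtlas (IsManifold.subset_maximalAtlas hc) hz, ?_⟩
  have hmem : c.symm z ∈ (chartAt (Cn n) (c.symm z)).source := mem_chart_source _ _
  have hcomp : ContDiffAt ℝ ∞ (chartAt (Cn n) (c.symm z) ∘ c.symm) z :=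
    (ContMDiffAt.comp z (contMDiffAt_of_mem_maximalAtlas (IsManifold.chart_mem_maximalAtlas _) hmem)
      (contMDiffAt_symm_of_mem_maximalAtlas (IsManifold.subset_maximalAtlas hc) hz)).contDiffAt
  have hsmooth : ContDiffAt ℝ ∞
      (fun z' => fderiv ℝ (chartAt (Cn n) (c.symm z) ∘ c.symm) z' u) z :=
    (hcomp.fderiv_right (m := ∞) (by simp)).clm_apply contDiffAt_const
  refine hsmooth.contMDiffAt.congr_of_eventuallyEq ?_
  filter_upwards [c.open_target.mem_nhds hz,
    (c.symm.continuousAt hz).eventually (OpenPartialHomeomorph.open_source _ |>.mem_nhds hmem)]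
    with z' hz' hz''
  exact trivializationAt_frame hc _ hz' hz'' u

end Charts

namespace KahlerManifold

variable (M : KahlerManifold.{u}) {c : OpenPartialHomeomorph M.Carrier (Cn M.dim)}

theorem contDiffOn_localForm_g (hc : c ∈ atlas (Cn M.dim) M.Carrier) :
    ContDiffOn ℝ ∞ (localForm c M.g) c.target := by
  rw [contDiffOn_clm_apply]
  intro u
  rw [contDiffOn_clm_apply]
  intro w z hz
  refine ContDiffAt.contDiffWithinAt ?_
  have hg : ContMDiffAt 𝓘(ℝ, Cn M.dim)
      (𝓘(ℝ, Cn M.dim).prod 𝓘(ℝ, Cn M.dim →L[ℝ] Cn M.dim →L[ℝ] ℝ)) ∞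
      (fun z => (⟨c.symm z, M.metric.inner (c.symm z)⟩ :
        TotalSpace (Cn M.dim →L[ℝ] Cn M.dim →L[ℝ] ℝ)
          (fun x : M.Carrier => TangentSpace 𝓘(ℝ, Cn M.dim) x →L[ℝ]
            TangentSpace 𝓘(ℝ, Cn M.dim) x →L[ℝ] ℝ))) z :=
    ContMDiffAt.comp z M.metric.contMDiff.contMDiffAt
      (contMDiffAt_symm_of_mem_maximalAtlas (IsManifold.subset_maximalAtlas hc) hz)
  have h : ContMDiffAt 𝓘(ℝ, Cn M.dim) (𝓘(ℝ, Cn M.dim).prod 𝓘(ℝ, ℝ)) ∞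
      (fun z => TotalSpace.mk' ℝ (E := Bundle.Trivial M.Carrier ℝ) (c.symm z)
        (M.metric.inner (c.symm z) (frame c z u) (frame c z w))) z := by
    apply ContMDiffAt.clm_bundle_apply₂ (F₁ := Cn M.dim) (F₂ := Cn M.dim)
    · exact hg
    · exact contMDiffAt_frame hc hz u
    · exact contMDiffAt_frame hc hz w
  rw [contMDiffAt_totalSpace] at h
  exact h.2.contDiffAt

theorem contDiffAt_localForm_g (hc : c ∈ atlas (Cn M.dim) M.Carrier) {z : Cn M.dim}
    (hz : z ∈ c.target) : ContDiffAt ℝ ∞ (localForm c M.g) z :=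
  (M.contDiffOn_localForm_g hc).contDiffAt (c.open_target.mem_nhds hz)

theorem isHermitianForm_localForm (hc : c ∈ atlas (Cn M.dim) M.Carrier) {z : Cn M.dim}
    (hz : z ∈ c.target) : IsHermitianForm (localForm c M.g z) where
  symm u w := M.metric.symm _ _ _
  pos u hu := by
    refine M.metric.pos _ (frame c z u) fun h => hu ?_
    rw [← chartDeriv_frameDeriv hc hz u, show frameDeriv c z u = 0 from h, map_zero]
  inv u w := by
    rw [localForm_apply, localForm_apply, frameDeriv_I_smul hc hz, frameDeriv_I_smul hc hz]
    exact M.J_invariant _ _ _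

theorem localForm_kahlerForm (hc : c ∈ atlas (Cn M.dim) M.Carrier) {z : Cn M.dim}
    (hz : z ∈ c.target) : localForm c M.kahlerForm z = jForm (localForm c M.g) z := by
  ext u w
  exact localForm_fundamentalForm hc hz M.g u w

theorem localForm_kahlerForm_eventuallyEq (hc : c ∈ atlas (Cn M.dim) M.Carrier) {z : Cn M.dim}
    (hz : z ∈ c.target) : localForm c M.kahlerForm =ᶠ[𝓝 z] jForm (localForm c M.g) := by
  filter_upwards [c.open_target.mem_nhds hz] with z' hz' using M.localForm_kahlerForm hc hz'

theorem isKahlerOn_localForm (hc : c ∈ atlas (Cn M.dim) M.Carrier) {U : Set (Cn M.dim)}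
    (hU : IsOpen U) (hUc : U ⊆ c.target) : IsKahlerOn (localForm c M.g) U where
  isOpen := hU
  contDiffOn := ((M.contDiffOn_localForm_g hc).of_le ENat.LEInfty.out).mono hUc
  hermitian _ hz := M.isHermitianForm_localForm hc (hUc hz)
  closed z hz u v w := by
    rw [← (M.localForm_kahlerForm_eventuallyEq hc (hUc hz)).fderiv_eq]
    exact M.closed c hc z (hUc hz) u v w

theorem lieKahlerForm_eq_lieDeriv (hc : c ∈ atlas (Cn M.dim) M.Carrier) {z : Cn M.dim}
    (hz : z ∈ c.target) (X : ∀ x, M.T x) (u w : Cn M.dim) :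
    lieKahlerForm M c X z u w = lieDeriv (jForm (localForm c M.g)) (localField c X) z u w := by
  rw [lieKahlerForm, lieDeriv, M.localForm_kahlerForm hc hz,
    (M.localForm_kahlerForm_eventuallyEq hc hz).fderiv_eq]

end KahlerManifold

section Naturality

variable {E F : Type*} [NormedAddCommGroup E] [NormedSpace ℝ E] [NormedAddCommGroup F]
  [NormedSpace ℝ F] {Ψ : E → F} {Y : F → F} {y : E → E} {y' : E →L[ℝ] E} {x : E}

theorem fderiv_apply_fderiv_of_related (hΨ : ContDiffAt ℝ 2 Ψ x)
    (hY : DifferentiableAt ℝ Y (Ψ x)) (hy : HasFDerivAt y y' x)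
    (hYy : ∀ᶠ x' in 𝓝 x, Y (Ψ x') = fderiv ℝ Ψ x' (y x')) (u : E) :
    fderiv ℝ Y (Ψ x) (fderiv ℝ Ψ x u)
      = fderiv ℝ (fderiv ℝ Ψ) x (y x) u + fderiv ℝ Ψ x (y' u) := by
  have hΨ' := (hΨ.differentiableAt two_ne_zero).hasFDerivAt
  have hfield := (((differentiableAt_fderiv hΨ).hasFDerivAt.clm_apply hy).congr_of_eventuallyEq
    (f₁ := Y ∘ Ψ) hYy).unique (hY.hasFDerivAt.comp x hΨ')
  have hfield_u := congrArg (fun L : E →L[ℝ] F => L u) hfield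
  simp only [ContinuousLinearMap.comp_apply, add_apply, ContinuousLinearMap.flip_apply] at hfield_u
  rw [← hfield_u, fderiv_fderiv_apply_comm hΨ u, add_comm]

/-- Naturality of the Lie derivative: `Ψ` maps the field `y` to `Y` and pulls `G` back to `R`,
whose derivative along `y` is `r - R(y'·, ·) - R(·, y'·)`; then `L_Y G` is pulled back to `r`. -/
theorem lieDeriv_pullback {G : F → F →L[ℝ] F →L[ℝ] ℝ} {R : E → E → E → ℝ} {r : E → E → ℝ}
    (hΨ : ContDiffAt ℝ 2 Ψ x) (hG : DifferentiableAt ℝ G (Ψ x))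
    (hY : DifferentiableAt ℝ Y (Ψ x)) (hy : HasFDerivAt y y' x)
    (hYy : ∀ᶠ x' in 𝓝 x, Y (Ψ x') = fderiv ℝ Ψ x' (y x'))
    (hR : ∀ᶠ x' in 𝓝 x, ∀ u w, G (Ψ x') (fderiv ℝ Ψ x' u) (fderiv ℝ Ψ x' w) = R x' u w)
    (hr : ∀ u w, HasDerivAt (fun t : ℝ => R (x + t • y x) u w)
      (r u w - R x (y' u) w - R x u (y' w)) 0) (u w : E) :
    lieDeriv G Y (Ψ x) (fderiv ℝ Ψ x u) (fderiv ℝ Ψ x w) = r u w := by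
  have hΨ' := (hΨ.differentiableAt two_ne_zero).hasFDerivAt
  have hΨ'' := (differentiableAt_fderiv hΨ).hasFDerivAt
  have hGΨ := HasFDerivAt.comp (g := G) x hG.hasFDerivAt hΨ'
  have hGu := hGΨ.clm_apply (hΨ''.clm_apply (hasFDerivAt_const u x))
  have hpull := ((hGu.clm_apply (hΨ''.clm_apply (hasFDerivAt_const w x))).congr_of_eventuallyEq
    (f₁ := fun x' => R x' u w) (hR.mono fun x' h => (h u w).symm)).hasLineDerivAt (y x)
  have heq := HasDerivAt.unique hpull (hr u w)
  rw [← hR.self_of_nhds, ← hR.self_of_nhds] at heq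
  simp only [ContinuousLinearMap.comp_apply, add_apply, ContinuousLinearMap.flip_apply,
    Function.comp_apply, zero_apply, map_zero, zero_add] at heq
  rw [lieDeriv, fderiv_apply_fderiv_of_related hΨ hY hy hYy,
    fderiv_apply_fderiv_of_related hΨ hY hy hYy, hYy.self_of_nhds]
  simp only [map_add, add_apply]
  linarith

end Naturality

section Trace

theorem pi_smul_proj_eq_sum {ι : Type*} [Fintype ι] [DecidableEq ι] {V : ι → Type*}
    [∀ i, AddCommGroup (V i)] [∀ i, Module ℝ (V i)] (k : ι → ℝ) :
    (LinearMap.pi fun i => k i • LinearMap.proj i : (∀ i, V i) →ₗ[ℝ] ∀ i, V i)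
      = ∑ i, k i • (LinearMap.single ℝ V i ∘ₗ LinearMap.proj i) := by
  ext i v j
  simp only [LinearMap.coe_comp, Function.comp_apply, LinearMap.pi_apply, LinearMap.smul_apply,
    LinearMap.proj_apply, LinearMap.sum_apply, Finset.sum_apply, Pi.smul_apply,
    LinearMap.coe_single]
  rw [Finset.sum_eq_single j (fun b _ hb => by simp [Pi.single_eq_of_ne hb.symm]) (by simp)]
  simp

theorem trace_pi_smul_proj {ι : Type*} [Fintype ι] {V : ι → Type*} [∀ i, AddCommGroup (V i)]
    [∀ i, Module ℝ (V i)] [∀ i, FiniteDimensional ℝ (V i)] (k : ι → ℝ) :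
    LinearMap.trace ℝ (∀ i, V i) (LinearMap.pi fun i => k i • LinearMap.proj i)
      = ∑ i, k i * Module.finrank ℝ (V i) := by
  classical
  rw [pi_smul_proj_eq_sum, map_sum]
  refine Finset.sum_congr rfl fun i _ => ?_
  rw [map_smul, LinearMap.trace_comp_comm', LinearMap.proj_comp_single_same, LinearMap.trace_id,
    smul_eq_mul]

theorem finrank_real_Cn (n : ℕ) : Module.finrank ℝ (Cn n) = 2 * n :=
  (finrank_real_of_complex (Cn n)).trans (by rw [finrank_euclideanSpace_fin])

end Trace

namespace HamiltonianAnsatz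

variable {ℓ : ℕ} {M : KahlerManifold.{u}} {φ : TwoTensor M.dim M.Carrier} {I : Fin ℓ → Set ℝ}
  (A : HamiltonianAnsatz.{u, v, w} M φ I)

/-- The functions `F_j / p_c`. -/
def profile (j : Fin ℓ) (t : ℝ) : ℝ := A.F j t / pc A.B A.η t

/-- The differential of the identification of `𝒟 × P` with `M⁰`, in the coordinates of the
preferred charts. -/
def derivΦ (y : (Fin ℓ → ℝ) × A.Q.P) : ((Fin ℓ → ℝ) × A.Q.E) →L[ℝ] Cn M.dim :=
  mfderiv (𝓘(ℝ, Fin ℓ → ℝ).prod 𝓘(ℝ, A.Q.E)) 𝓘(ℝ, Cn M.dim) A.Φ y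

/-- The connection form at a point, in the coordinates of the preferred chart. -/
def conn (p : A.Q.P) : A.Q.E →L[ℝ] (Fin ℓ → ℝ) := A.Q.θ p

/-- The differential of the projection to a factor of the base, in the coordinates of the preferred
charts. -/
def projDeriv (a : Fin A.N) (p : A.Q.P) : A.Q.E →L[ℝ] Cn (A.B a).dim :=
  mfderiv 𝓘(ℝ, A.Q.E) 𝓘(ℝ, Cn (A.B a).dim) (A.Q.proj a) p

/-- The pull-back to `P` of the metric of a factor of the base. -/
def baseMetric (a : Fin A.N) (p : A.Q.P) (x y : A.Q.E) : ℝ :=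
  formAt (A.B a).g (A.Q.proj a p) (A.projDeriv a p x) (A.projDeriv a p y)

/-- The pull-back to `P` of the Kähler form of a factor of the base. -/
def baseForm (a : Fin A.N) (p : A.Q.P) (x y : A.Q.E) : ℝ :=
  formAt (A.B a).kahlerForm (A.Q.proj a p) (A.projDeriv a p x) (A.projDeriv a p y)

theorem derivΦ_bijective {ξ : Fin ℓ → ℝ} (hξ : ξ ∈ univ.pi I) (p : A.Q.P) :
    Function.Bijective (A.derivΦ (ξ, p)) := A.Φ_derivative ξ hξ p

theorem split_bijective (p : A.Q.P) : Function.Bijective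
    (fun x : A.Q.E => ((fun a => A.projDeriv a p x, A.conn p x) :
      (∀ a, Cn (A.B a).dim) × (Fin ℓ → ℝ))) := A.Q.splitting p

theorem pc_ne_zero {j : Fin ℓ} {t : ℝ} (ht : t ∈ I j) : pc A.B A.η t ≠ 0 := fun h => by
  simpa [h] using A.F_pos j t ht

theorem ne_η {ξ : Fin ℓ → ℝ} (hξ : ξ ∈ univ.pi I) (a : Fin A.N) (j : Fin ℓ) : ξ j ≠ A.η a := by
  intro h
  have := A.pnc_pos ξ hξ a
  rw [pnc, Finset.prod_eq_zero (Finset.mem_univ j) (sub_eq_zero.2 h.symm), mul_zero] at this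
  exact this.false

/-- The metric of the Ansatz, pulled back to `𝒟 × P`. -/
def ansatzMetric (ξ : Fin ℓ → ℝ) (p : A.Q.P) (x y : (Fin ℓ → ℝ) × A.Q.E) : ℝ :=
  ∑ a, A.ε a * pnc ξ (A.η a) * A.baseMetric a p x.2 y.2
    + fibreMetric A.profile ξ x.1 (A.conn p x.2) y.1 (A.conn p y.2)

/-- The Kähler form of the Ansatz, pulled back to `𝒟 × P`. -/
def ansatzForm (ξ : Fin ℓ → ℝ) (p : A.Q.P) (x y : (Fin ℓ → ℝ) × A.Q.E) : ℝ :=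
  ∑ a, A.ε a * pnc ξ (A.η a) * A.baseForm a p x.2 y.2
    + fibreForm ξ x.1 (A.conn p x.2) y.1 (A.conn p y.2)

theorem formAt_g_derivΦ {ξ : Fin ℓ → ℝ} (hξ : ξ ∈ univ.pi I) (p : A.Q.P)
    (x y : (Fin ℓ → ℝ) × A.Q.E) :
    formAt M.g (A.Φ (ξ, p)) (A.derivΦ (ξ, p) x) (A.derivΦ (ξ, p) y) = A.ansatzMetric ξ p x y := by
  have hq (j : Fin ℓ) : gradComp A.profile ξ j
      = A.F j (ξ j) / (pc A.B A.η (ξ j) * Δ ξ j) := div_div _ _ _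
  refine (A.metric_eq ξ hξ p x y).trans ?_
  simp only [ansatzMetric, add_assoc, fibreMetric, hq, inv_div]
  rfl

theorem formAt_kahlerForm_derivΦ {ξ : Fin ℓ → ℝ} (hξ : ξ ∈ univ.pi I) (p : A.Q.P)
    (x y : (Fin ℓ → ℝ) × A.Q.E) :
    formAt M.kahlerForm (A.Φ (ξ, p)) (A.derivΦ (ξ, p) x) (A.derivΦ (ξ, p) y)
      = A.ansatzForm ξ p x y := by
  rw [ansatzForm, ← fibreForm_eq]
  exact A.kahlerForm_eq ξ hξ p x y

theorem formAt_pos (x : M.Carrier) {v : Cn M.dim} (hv : v ≠ 0) : 0 < formAt M.g x v v :=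
  M.metric.pos x v hv

theorem formAt_g_derivΦ_single {ξ : Fin ℓ → ℝ} (hξ : ξ ∈ univ.pi I) (p : A.Q.P) (j : Fin ℓ)
    (δ : ℝ) : formAt M.g (A.Φ (ξ, p)) (A.derivΦ (ξ, p) (Pi.single j δ, 0))
      (A.derivΦ (ξ, p) (Pi.single j δ, 0)) = δ * δ * (gradComp A.profile ξ j)⁻¹ := by
  rw [A.formAt_g_derivΦ hξ]
  simp only [ansatzMetric, baseMetric, fibreMetric, map_zero, mul_zero, Finset.sum_const_zero,
    zero_add, tau_zero, add_zero]
  rw [Finset.sum_eq_single j (fun i _ hij => by simp [hij]) (by simp), Pi.single_eq_same]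
  ring

theorem gradComp_pos {ξ : Fin ℓ → ℝ} (hξ : ξ ∈ univ.pi I) (p : A.Q.P) (j : Fin ℓ) :
    0 < gradComp A.profile ξ j := by
  have hne : A.derivΦ (ξ, p) (Pi.single j 1, 0) ≠ 0 := fun h => by
    simpa using (A.derivΦ_bijective hξ p).1 (h.trans (map_zero _).symm)
  have hpos := formAt_pos (A.Φ (ξ, p)) hne
  rw [A.formAt_g_derivΦ_single hξ, one_mul, one_mul] at hpos
  exact inv_pos.1 hpos

theorem injective_of_mem {ξ : Fin ℓ → ℝ} (hξ : ξ ∈ univ.pi I) (p : A.Q.P) :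
    Function.Injective ξ := by
  intro i j hij
  by_contra hne
  have hΔ : Δ ξ i = 0 := Finset.prod_eq_zero
    (Finset.mem_erase.2 ⟨Ne.symm hne, Finset.mem_univ j⟩) (sub_eq_zero.2 hij)
  exact (A.gradComp_pos hξ p i).ne' (by rw [gradComp, hΔ, div_zero])

/-- The functions `τ_j`, as a linear endomorphism of the Lie algebra of the torus. -/
def tauLin (ξ : Fin ℓ → ℝ) : (Fin ℓ → ℝ) →ₗ[ℝ] (Fin ℓ → ℝ) where
  toFun θ := tau ξ θ
  map_add' θ θ' := by
    ext j
    simp [tau, mul_add, Finset.sum_add_distrib]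
  map_smul' r θ := by
    ext j
    simp [tau, Finset.mul_sum, mul_left_comm]

theorem tauLin_injective {ξ : Fin ℓ → ℝ} (hξ : ξ ∈ univ.pi I) (p : A.Q.P) :
    Function.Injective (tauLin ξ) := by
  rw [injective_iff_map_eq_zero]
  intro θ hθ
  obtain ⟨x, hx⟩ := (A.split_bijective p).2 (0, θ)
  have hproj : ∀ a, A.projDeriv a p x = 0 := fun a => congrFun (congrArg Prod.fst hx) a
  have hconn : A.conn p x = θ := congrArg Prod.snd hx
  have hτ : ∀ j, tau ξ θ j = 0 := fun j => congrFun hθ j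
  have hnorm : formAt M.g (A.Φ (ξ, p)) (A.derivΦ (ξ, p) (0, x)) (A.derivΦ (ξ, p) (0, x)) = 0 := by
    rw [A.formAt_g_derivΦ hξ]
    simp [ansatzMetric, baseMetric, hproj, fibreMetric, hconn, hτ]
  have hzero : A.derivΦ (ξ, p) (0, x) = 0 := by
    by_contra hne
    exact (formAt_pos _ hne).ne' hnorm
  have hx0 : x = 0 :=
    congrArg Prod.snd ((A.derivΦ_bijective hξ p).1 (hzero.trans (map_zero _).symm))
  rw [← hconn, hx0, map_zero]

/-- The decomposition of the tangent space of `P` into horizontal and vertical vectors. -/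
def splitEquiv (p : A.Q.P) : A.Q.E ≃ₗ[ℝ] (∀ a, Cn (A.B a).dim) × (Fin ℓ → ℝ) :=
  LinearEquiv.ofBijective
    ((LinearMap.pi fun a => (A.projDeriv a p : A.Q.E →ₗ[ℝ] Cn (A.B a).dim)).prod
      (A.conn p : A.Q.E →ₗ[ℝ] (Fin ℓ → ℝ))) (A.split_bijective p)

/-- The decomposition of the tangent space of `𝒟 × P` by the components `dξ_j`, the factors of the
base and the `τ_j`. -/
def tangentSplitting {ξ : Fin ℓ → ℝ} (hξ : ξ ∈ univ.pi I) (p : A.Q.P) :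
    ((Fin ℓ → ℝ) × A.Q.E) ≃ₗ[ℝ] (Fin ℓ → ℝ) × ((∀ a, Cn (A.B a).dim) × (Fin ℓ → ℝ)) :=
  (LinearEquiv.refl ℝ (Fin ℓ → ℝ)).prodCongr ((A.splitEquiv p).trans
    ((LinearEquiv.refl ℝ (∀ a, Cn (A.B a).dim)).prodCongr
      (LinearEquiv.ofInjectiveEndo (tauLin ξ) (A.tauLin_injective hξ p))))

/-- The endomorphism of `ℝ^ℓ ⊕ (⨁ₐ T Bₐ) ⊕ ℝ^ℓ` with eigenvalues `m_j` on both copies of `ℝ^ℓ` and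
`κₐ` on `T Bₐ`. -/
def diagonal (m : Fin ℓ → ℝ) (κ : Fin A.N → ℝ) :
    (Fin ℓ → ℝ) × ((∀ a, Cn (A.B a).dim) × (Fin ℓ → ℝ)) →ₗ[ℝ]
      (Fin ℓ → ℝ) × ((∀ a, Cn (A.B a).dim) × (Fin ℓ → ℝ)) :=
  (LinearMap.pi fun j => m j • LinearMap.proj j).prodMap
    ((LinearMap.pi fun a => κ a • LinearMap.proj a).prodMap
      (LinearMap.pi fun j => m j • LinearMap.proj j))

theorem trace_diagonal (m : Fin ℓ → ℝ) (κ : Fin A.N → ℝ) :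
    LinearMap.trace ℝ _ (A.diagonal m κ) = 2 * (∑ j, m j + ∑ a, κ a * (A.B a).dim) := by
  rw [diagonal, LinearMap.trace_prodMap', LinearMap.trace_prodMap', trace_pi_smul_proj,
    trace_pi_smul_proj]
  simp only [Module.finrank_self, Nat.cast_one, mul_one, finrank_real_Cn, Nat.cast_mul,
    Nat.cast_ofNat, mul_left_comm _ (2 : ℝ), ← Finset.mul_sum]
  ring

theorem exists_diagonal {ξ : Fin ℓ → ℝ} (hξ : ξ ∈ univ.pi I) (p : A.Q.P) (m : Fin ℓ → ℝ)
    (κ : Fin A.N → ℝ) :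
    ∃ C : ((Fin ℓ → ℝ) × A.Q.E) →ₗ[ℝ] ((Fin ℓ → ℝ) × A.Q.E),
      (∀ x j, (C x).1 j = m j * x.1 j) ∧
      (∀ x a, A.projDeriv a p (C x).2 = κ a • A.projDeriv a p x.2) ∧
      (∀ x j, tau ξ (A.conn p (C x).2) j = m j * tau ξ (A.conn p x.2) j) ∧
      LinearMap.trace ℝ _ C = 2 * (∑ j, m j + ∑ a, κ a * (A.B a).dim) := by
  set S := A.tangentSplitting hξ p
  have hC (x) : S (S.symm.conj (A.diagonal m κ) x) = A.diagonal m κ (S x) := by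
    rw [LinearEquiv.conj_apply_apply, LinearEquiv.apply_symm_apply]
    rfl
  refine ⟨S.symm.conj (A.diagonal m κ), fun x => congrFun (congrArg Prod.fst (hC x)),
    fun x => congrFun (congrArg (fun z => z.2.1) (hC x)),
    fun x => congrFun (congrArg (fun z => z.2.2) (hC x)), ?_⟩
  rw [LinearMap.trace_conj', trace_diagonal]

section Coordinates

variable (c : OpenPartialHomeomorph M.Carrier (Cn M.dim)) (e : OpenPartialHomeomorph A.Q.P A.Q.E)

/-- The change of coordinates from `𝒟 × P` to `M`. -/
def coord (x : (Fin ℓ → ℝ) × A.Q.E) : Cn M.dim := c (A.Φ (x.1, e.symm x.2))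

/-- The domain of the change of coordinates. -/
def coordDomain : Set ((Fin ℓ → ℝ) × A.Q.E) :=
  {x | (x.1 ∈ univ.pi I ∧ x.2 ∈ e.target) ∧ A.Φ (x.1, e.symm x.2) ∈ c.source}

/-- The differential of the inverse of a chart of `P`. -/
def symmDeriv (q : A.Q.E) : A.Q.E →L[ℝ] A.Q.E := mfderiv 𝓘(ℝ, A.Q.E) 𝓘(ℝ, A.Q.E) e.symm q

/-- The differential of `c ∘ Φ`. -/
def chartDerivΦ (y : (Fin ℓ → ℝ) × A.Q.P) : ((Fin ℓ → ℝ) × A.Q.E) →L[ℝ] Cn M.dim :=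
  (chartDeriv c (A.Φ y)).comp (A.derivΦ y)

variable {c e}

theorem contMDiffAt_Φ (hI : ∀ j, IsOpen (I j)) {ξ : Fin ℓ → ℝ} (hξ : ξ ∈ univ.pi I) (p : A.Q.P) :
    ContMDiffAt (𝓘(ℝ, Fin ℓ → ℝ).prod 𝓘(ℝ, A.Q.E)) 𝓘(ℝ, Cn M.dim) ∞ A.Φ (ξ, p) :=
  A.Φ_smooth.contMDiffAt (((isOpen_set_pi finite_univ fun j _ => hI j).prod isOpen_univ).mem_nhds
    ⟨hξ, mem_univ p⟩)

theorem contMDiffAt_prodMap_symm (he : e ∈ atlas A.Q.E A.Q.P) {x : (Fin ℓ → ℝ) × A.Q.E}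
    (hx : x.2 ∈ e.target) :
    ContMDiffAt 𝓘(ℝ, (Fin ℓ → ℝ) × A.Q.E) (𝓘(ℝ, Fin ℓ → ℝ).prod 𝓘(ℝ, A.Q.E)) ∞
      (fun x : (Fin ℓ → ℝ) × A.Q.E => (x.1, e.symm x.2)) x :=
  (contDiff_fst (𝕜 := ℝ) (E := Fin ℓ → ℝ) (F := A.Q.E)).contDiffAt.contMDiffAt.prodMk
    (ContMDiffAt.comp x
      (contMDiffAt_symm_of_mem_maximalAtlas (IsManifold.subset_maximalAtlas he) hx)
      (contDiff_snd (𝕜 := ℝ) (E := Fin ℓ → ℝ) (F := A.Q.E)).contDiffAt.contMDiffAt)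

theorem isOpen_coordDomain (hI : ∀ j, IsOpen (I j)) (he : e ∈ atlas A.Q.E A.Q.P) :
    IsOpen (A.coordDomain c e) := by
  have hopen : IsOpen {x : (Fin ℓ → ℝ) × A.Q.E | x.1 ∈ univ.pi I ∧ x.2 ∈ e.target} :=
    (isOpen_set_pi finite_univ fun j _ => hI j).prod e.open_target
  refine ContinuousOn.isOpen_inter_preimage (fun x hx => ?_) hopen c.open_source
  exact (ContinuousAt.comp (f := fun x : (Fin ℓ → ℝ) × A.Q.E => (x.1, e.symm x.2))
    (A.contMDiffAt_Φ hI hx.1 (e.symm x.2)).continuousAt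
    (A.contMDiffAt_prodMap_symm he hx.2).continuousAt).continuousWithinAt

theorem mem_coordDomain {ξ : Fin ℓ → ℝ} (hξ : ξ ∈ univ.pi I) {p : A.Q.P} (hp : p ∈ e.source)
    (hc : A.Φ (ξ, p) ∈ c.source) : (ξ, e p) ∈ A.coordDomain c e :=
  ⟨⟨hξ, e.map_source hp⟩, by rwa [e.left_inv hp]⟩

theorem coord_mem_target {x : (Fin ℓ → ℝ) × A.Q.E} (hx : x ∈ A.coordDomain c e) :
    A.coord c e x ∈ c.target := c.map_source hx.2

theorem contDiffAt_coord (hI : ∀ j, IsOpen (I j)) (hc : c ∈ atlas (Cn M.dim) M.Carrier)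
    (he : e ∈ atlas A.Q.E A.Q.P) {x : (Fin ℓ → ℝ) × A.Q.E} (hx : x ∈ A.coordDomain c e) :
    ContDiffAt ℝ ∞ (A.coord c e) x := by
  have hΦ := ContMDiffAt.comp x (A.contMDiffAt_Φ hI hx.1.1 (e.symm x.2))
    (A.contMDiffAt_prodMap_symm he hx.1.2)
  exact (ContMDiffAt.comp x (contMDiffAt_of_mem_maximalAtlas
    (IsManifold.subset_maximalAtlas hc) hx.2) hΦ).contDiffAt

theorem fderiv_coord (hI : ∀ j, IsOpen (I j)) (hc : c ∈ atlas (Cn M.dim) M.Carrier)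
    (he : e ∈ atlas A.Q.E A.Q.P) {x : (Fin ℓ → ℝ) × A.Q.E} (hx : x ∈ A.coordDomain c e)
    (u : (Fin ℓ → ℝ) × A.Q.E) :
    fderiv ℝ (A.coord c e) x u
      = A.chartDerivΦ c (x.1, e.symm x.2) (u.1, A.symmDeriv e x.2 u.2) := by
  have hfst : HasMFDerivAt 𝓘(ℝ, (Fin ℓ → ℝ) × A.Q.E) 𝓘(ℝ, Fin ℓ → ℝ)
      (Prod.fst : (Fin ℓ → ℝ) × A.Q.E → (Fin ℓ → ℝ)) x
      (ContinuousLinearMap.fst ℝ (Fin ℓ → ℝ) A.Q.E) := hasFDerivAt_fst.hasMFDerivAt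
  have hsnd : HasMFDerivAt 𝓘(ℝ, (Fin ℓ → ℝ) × A.Q.E) 𝓘(ℝ, A.Q.E)
      (Prod.snd : (Fin ℓ → ℝ) × A.Q.E → A.Q.E) x
      (ContinuousLinearMap.snd ℝ (Fin ℓ → ℝ) A.Q.E) := hasFDerivAt_snd.hasMFDerivAt
  have hsymm := hfst.prodMk
    (HasMFDerivAt.comp x (mdifferentiableAt_atlas_symm he hx.1.2).hasMFDerivAt hsnd)
  have hΦ := HasMFDerivAt.comp x
    ((A.contMDiffAt_Φ hI hx.1.1 (e.symm x.2)).mdifferentiableAt (by simp)).hasMFDerivAt hsymm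
  have hcomp := HasMFDerivAt.comp x (mdifferentiableAt_atlas hc hx.2).hasMFDerivAt hΦ
  have hcoord : HasFDerivAt (A.coord c e) ((A.chartDerivΦ c (x.1, e.symm x.2)).comp
      ((ContinuousLinearMap.fst ℝ (Fin ℓ → ℝ) A.Q.E).prod
        ((A.symmDeriv e x.2).comp (ContinuousLinearMap.snd ℝ (Fin ℓ → ℝ) A.Q.E)))) x :=
    hasMFDerivAt_iff_hasFDerivAt.1 hcomp
  rw [hcoord.fderiv]
  rfl

theorem symmDeriv_bijective (he : e ∈ atlas A.Q.E A.Q.P) {q : A.Q.E} (hq : q ∈ e.target) :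
    Function.Bijective (A.symmDeriv e q) :=
  (mdifferentiable_of_mem_atlas (I := 𝓘(ℝ, A.Q.E)) he).symm.mfderiv_bijective hq

theorem chartDerivΦ_bijective (hc : c ∈ atlas (Cn M.dim) M.Carrier) {ξ : Fin ℓ → ℝ}
    (hξ : ξ ∈ univ.pi I) {p : A.Q.P} (hp : A.Φ (ξ, p) ∈ c.source) :
    Function.Bijective (A.chartDerivΦ c (ξ, p)) :=
  (chartDeriv_bijective hc hp).comp (A.derivΦ_bijective hξ p)

theorem fderiv_coord_bijective (hI : ∀ j, IsOpen (I j)) (hc : c ∈ atlas (Cn M.dim) M.Carrier)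
    (he : e ∈ atlas A.Q.E A.Q.P) {x : (Fin ℓ → ℝ) × A.Q.E} (hx : x ∈ A.coordDomain c e) :
    Function.Bijective (fderiv ℝ (A.coord c e) x) := by
  have hcomp : ⇑(fderiv ℝ (A.coord c e) x)
      = A.chartDerivΦ c (x.1, e.symm x.2) ∘ Prod.map id (A.symmDeriv e x.2) :=
    funext fun u => A.fderiv_coord hI hc he hx u
  rw [hcomp]
  exact (A.chartDerivΦ_bijective hc hx.1.1 hx.2).comp
    (Function.bijective_id.prodMap (A.symmDeriv_bijective he hx.1.2))

theorem localForm_chartDerivΦ (hc : c ∈ atlas (Cn M.dim) M.Carrier) (β : TwoTensor M.dim M.Carrier)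
    {y : (Fin ℓ → ℝ) × A.Q.P} (hy : A.Φ y ∈ c.source) (u w : (Fin ℓ → ℝ) × A.Q.E) :
    localForm c β (c (A.Φ y)) (A.chartDerivΦ c y u) (A.chartDerivΦ c y w)
      = formAt β (A.Φ y) (A.derivΦ y u) (A.derivΦ y w) := by
  rw [localForm_apply, c.left_inv hy, chartDerivΦ, ContinuousLinearMap.comp_apply,
    ContinuousLinearMap.comp_apply, frameDeriv_chartDeriv hc hy, frameDeriv_chartDeriv hc hy]

variable (hc : c ∈ atlas (Cn M.dim) M.Carrier) {ξ : Fin ℓ → ℝ} (hξ : ξ ∈ univ.pi I) {p : A.Q.P}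
  (hp : A.Φ (ξ, p) ∈ c.source)
include hc hξ hp

theorem localForm_g_chartDerivΦ (u w : (Fin ℓ → ℝ) × A.Q.E) :
    localForm c M.g (c (A.Φ (ξ, p))) (A.chartDerivΦ c (ξ, p) u) (A.chartDerivΦ c (ξ, p) w)
      = A.ansatzMetric ξ p u w := by
  rw [A.localForm_chartDerivΦ hc M.g hp, A.formAt_g_derivΦ hξ]

theorem localForm_kahlerForm_chartDerivΦ (u w : (Fin ℓ → ℝ) × A.Q.E) :
    localForm c M.kahlerForm (c (A.Φ (ξ, p))) (A.chartDerivΦ c (ξ, p) u)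
      (A.chartDerivΦ c (ξ, p) w) = A.ansatzForm ξ p u w := by
  rw [A.localForm_chartDerivΦ hc M.kahlerForm hp, A.formAt_kahlerForm_derivΦ hξ]

end Coordinates

end HamiltonianAnsatz

theorem hasDerivAt_pc {N : ℕ} (B : Fin N → KahlerManifold.{v}) {η : Fin N → ℝ} {t : ℝ}
    (ht : ∀ a, t ≠ η a) :
    HasDerivAt (pc B η) (pc B η t * ∑ a, (B a).dim * (t - η a)⁻¹) t := by
  refine (HasDerivAt.fun_finsetProd (u := Finset.univ) (x := t)
    (f := fun (a : Fin N) (t : ℝ) => (t - η a) ^ (B a).dim)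
    (fun a _ => ((hasDerivAt_id t).sub_const (η a)).fun_pow (B a).dim)).congr_deriv ?_
  rw [Finset.mul_sum]
  refine Finset.sum_congr rfl fun a _ => ?_
  have hne : t - η a ≠ 0 := sub_ne_zero.2 (ht a)
  rw [pc, ← Finset.mul_prod_erase Finset.univ (fun k => (t - η k) ^ (B k).dim) (Finset.mem_univ a)]
  cases (B a).dim with
  | zero => simp
  | succ m =>
    simp only [Nat.add_sub_cancel, id_eq, smul_eq_mul, pow_succ]
    field_simp

theorem contDiff_pc {N : ℕ} (B : Fin N → KahlerManifold.{v}) (η : Fin N → ℝ) :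
    ContDiff ℝ ∞ (pc B η) :=
  contDiff_prod fun _ _ => (contDiff_id.sub contDiff_const).pow _

namespace HamiltonianAnsatz

variable {ℓ : ℕ} {M : KahlerManifold.{u}} {φ : TwoTensor M.dim M.Carrier} {I : Fin ℓ → Set ℝ}
  (A : HamiltonianAnsatz.{u, v, w} M φ I)

/-- The derivatives of the functions `F_j / p_c` at the point `ξ`. -/
def profileDeriv (ξ : Fin ℓ → ℝ) (j : Fin ℓ) : ℝ := deriv (A.profile j) (ξ j)

/-- The eigenvalues on the base of the endomorphism of `L_Y g`, where `Y` is the gradient of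
`σ_1`. -/
def baseEigen (ξ : Fin ℓ → ℝ) (a : Fin A.N) : ℝ :=
  ∑ j, gradComp A.profile ξ j * (ξ j - A.η a)⁻¹

/-- The eigenvalues on the fibres of the endomorphism of `L_Y g`, where `Y` is the gradient of
`σ_1`. -/
def fibreEigen (ξ : Fin ℓ → ℝ) (j : Fin ℓ) : ℝ :=
  hessEigen A.profile (A.profileDeriv ξ) ξ j

/-- The Laplacian of `σ_1`. -/
def laplacian (ξ : Fin ℓ → ℝ) : ℝ :=
  ∑ j, deriv (A.F j) (ξ j) / (pc A.B A.η (ξ j) * Δ ξ j)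

section Smoothness

variable (hI : ∀ j, IsOpen (I j)) {ξ : Fin ℓ → ℝ}
include hI

theorem contDiffAt_F {j : Fin ℓ} {t : ℝ} (ht : t ∈ I j) :
    ContDiffAt ℝ ∞ (A.F j) t := (A.F_smooth j).contDiffAt ((hI j).mem_nhds ht)

theorem contDiffAt_profile {j : Fin ℓ} {t : ℝ} (ht : t ∈ I j) :
    ContDiffAt ℝ ∞ (A.profile j) t :=
  (A.contDiffAt_F hI ht).div (contDiff_pc A.B A.η).contDiffAt (A.pc_ne_zero ht)

theorem hasDerivAt_profile (hξ : ξ ∈ univ.pi I) (j : Fin ℓ) :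
    HasDerivAt (A.profile j) (A.profileDeriv ξ j) (ξ j) :=
  ((A.contDiffAt_profile hI (hξ j (mem_univ j))).differentiableAt (by simp)).hasDerivAt

theorem contDiffAt_gradComp (hξ : ξ ∈ univ.pi I) (p : A.Q.P) :
    ContDiffAt ℝ ∞ (gradComp A.profile) ξ := by
  rw [contDiffAt_pi]
  intro j
  have hcoord (i : Fin ℓ) : ContDiffAt ℝ ∞ (fun ξ : Fin ℓ → ℝ => ξ i) ξ :=
    (contDiff_apply ℝ ℝ i).contDiffAt
  exact (ContDiffAt.comp ξ (A.contDiffAt_profile hI (hξ j (mem_univ j))) (hcoord j)).div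
    (contDiffAt_prod fun i _ => (hcoord j).sub (hcoord i))
    (Δ_ne_zero (A.injective_of_mem hξ p) j)

theorem fderiv_gradComp (hξ : ξ ∈ univ.pi I) (p : A.Q.P) (x : Fin ℓ → ℝ) :
    fderiv ℝ (gradComp A.profile) ξ x = gradCompDeriv A.profile (A.profileDeriv ξ) ξ x := by
  have hline : HasDerivAt (fun t : ℝ => ξ + t • x) x 0 := hasDerivAt_line ξ x 0
  have hbase : ξ + (0 : ℝ) • x = ξ := by simp
  refine HasDerivAt.unique (HasFDerivAt.hasLineDerivAt
    ((A.contDiffAt_gradComp hI hξ p).differentiableAt (by simp)).hasFDerivAt x)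
    (hasDerivAt_pi.2 fun j => ?_)
  refine (hasDerivAt_gradComp (q := A.profile) (q' := A.profileDeriv ξ) (j := j) hline
    (by rw [hbase]; exact A.injective_of_mem hξ p)
    (by rw [hbase]; exact A.hasDerivAt_profile hI hξ j)).congr_deriv ?_
  rw [hbase]

theorem deriv_F_div (hξ : ξ ∈ univ.pi I) (p : A.Q.P) (j : Fin ℓ) :
    deriv (A.F j) (ξ j) / (pc A.B A.η (ξ j) * Δ ξ j) = A.profileDeriv ξ j / Δ ξ j
      + gradComp A.profile ξ j * ∑ a, ((A.B a).dim : ℝ) * (ξ j - A.η a)⁻¹ := by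
  have hF := ((A.contDiffAt_F hI (hξ j (mem_univ j))).differentiableAt (by simp)).hasDerivAt
  have hpc := hasDerivAt_pc A.B fun a => A.ne_η hξ a j
  have hpc0 := A.pc_ne_zero (hξ j (mem_univ j))
  have hprofile : A.profileDeriv ξ j = _ := (hF.div hpc hpc0).deriv
  have hΔ := Δ_ne_zero (A.injective_of_mem hξ p) j
  rw [hprofile, gradComp, profile]
  field_simp
  ring

theorem sum_eigen (hξ : ξ ∈ univ.pi I) (p : A.Q.P) :
    ∑ j, A.fibreEigen ξ j + ∑ a, A.baseEigen ξ a * (A.B a).dim = A.laplacian ξ := by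
  simp only [fibreEigen, sum_hessEigen, baseEigen, laplacian, Finset.sum_mul]
  rw [Finset.sum_comm, ← Finset.sum_add_distrib]
  refine Finset.sum_congr rfl fun j _ => ?_
  rw [A.deriv_F_div hI hξ p, Finset.mul_sum]
  exact congrArg _ (Finset.sum_congr rfl fun _ _ => by ring)

end Smoothness

section LieDerivatives

/-- The endomorphism of `T(𝒟 × P)` that gives the Lie derivatives of the metric and of the Kähler
form along the gradient of `σ_1`. -/
structure IsHessian (ξ : Fin ℓ → ℝ) (p : A.Q.P)
    (D : ((Fin ℓ → ℝ) × A.Q.E) →ₗ[ℝ] ((Fin ℓ → ℝ) × A.Q.E)) : Prop where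
  fst_apply : ∀ x j, (D x).1 j = A.fibreEigen ξ j * x.1 j
  projDeriv_apply : ∀ x a, A.projDeriv a p (D x).2 = A.baseEigen ξ a • A.projDeriv a p x.2
  tau_conn_apply : ∀ x j,
    tau ξ (A.conn p (D x).2) j = A.fibreEigen ξ j * tau ξ (A.conn p x.2) j

theorem exists_isHessian (hI : ∀ j, IsOpen (I j)) {ξ : Fin ℓ → ℝ} (hξ : ξ ∈ univ.pi I)
    (p : A.Q.P) : ∃ D, A.IsHessian ξ p D ∧ (1 / 2) * LinearMap.trace ℝ _ D = A.laplacian ξ := by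
  obtain ⟨D, hfst, hproj, htau, htrace⟩ :=
    A.exists_diagonal hξ p (A.fibreEigen ξ) (A.baseEigen ξ)
  refine ⟨D, ⟨hfst, hproj, htau⟩, ?_⟩
  rw [htrace, ← A.sum_eigen hI hξ p]
  ring

variable {ξ : Fin ℓ → ℝ} {p : A.Q.P} {D : ((Fin ℓ → ℝ) × A.Q.E) →ₗ[ℝ] ((Fin ℓ → ℝ) × A.Q.E)}

theorem ansatzMetric_hessian (hD : A.IsHessian ξ p D) (u w : (Fin ℓ → ℝ) × A.Q.E) :
    A.ansatzMetric ξ p (D u) w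
      = ∑ a, A.baseEigen ξ a * (A.ε a * pnc ξ (A.η a) * A.baseMetric a p u.2 w.2)
        + ∑ j, A.fibreEigen ξ j * ((gradComp A.profile ξ j)⁻¹ * (u.1 j * w.1 j)
          + gradComp A.profile ξ j * (tau ξ (A.conn p u.2) j * tau ξ (A.conn p w.2) j)) := by
  rw [ansatzMetric, fibreMetric, ← Finset.sum_add_distrib]
  refine congrArg₂ _ (Finset.sum_congr rfl fun a _ => ?_) (Finset.sum_congr rfl fun j _ => ?_)
  · simp only [baseMetric, hD.projDeriv_apply, map_smul, smul_apply, smul_eq_mul]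
    ring
  · rw [hD.fst_apply, hD.tau_conn_apply]
    ring

theorem ansatzForm_hessian (hD : A.IsHessian ξ p D) (u w : (Fin ℓ → ℝ) × A.Q.E) :
    A.ansatzForm ξ p (D u) w
      = ∑ a, A.baseEigen ξ a * (A.ε a * pnc ξ (A.η a) * A.baseForm a p u.2 w.2)
        + ∑ j, A.fibreEigen ξ j
          * (u.1 j * tau ξ (A.conn p w.2) j - w.1 j * tau ξ (A.conn p u.2) j) := by
  rw [ansatzForm, fibreForm]
  refine congrArg₂ _ (Finset.sum_congr rfl fun a _ => ?_) (Finset.sum_congr rfl fun j _ => ?_)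
  · simp only [baseForm, hD.projDeriv_apply, map_smul, smul_apply, smul_eq_mul]
    ring
  · rw [hD.fst_apply, hD.tau_conn_apply]
    ring

variable {x : ℝ → Fin ℓ → ℝ} {t : ℝ}

theorem hasDerivAt_base (hx : HasDerivAt x (gradComp A.profile (x t)) t) (hmem : x t ∈ univ.pi I)
    (b : Fin A.N → ℝ) :
    HasDerivAt (fun t : ℝ => ∑ a, A.ε a * pnc (x t) (A.η a) * b a)
      (∑ a, A.baseEigen (x t) a * (A.ε a * pnc (x t) (A.η a) * b a)) t := by
  refine (HasDerivAt.fun_sum fun a _ => ((hasDerivAt_pnc hx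
    (fun j => A.ne_η hmem a j)).const_mul (A.ε a)).mul_const (b a)).congr_deriv ?_
  refine Finset.sum_congr rfl fun a _ => ?_
  rw [baseEigen]
  ring

theorem hasDerivAt_ansatzMetric (hI : ∀ j, IsOpen (I j))
    (hx : HasDerivAt x (gradComp A.profile (x t)) t) (hmem : x t ∈ univ.pi I)
    (hD : A.IsHessian (x t) p D) (u w : (Fin ℓ → ℝ) × A.Q.E) :
    HasDerivAt (fun t => A.ansatzMetric (x t) p u w)
      (A.ansatzMetric (x t) p (D u) w
        - A.ansatzMetric (x t) p (gradCompDeriv A.profile (A.profileDeriv (x t)) (x t) u.1, 0) w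
        - A.ansatzMetric (x t) p u (gradCompDeriv A.profile (A.profileDeriv (x t)) (x t) w.1, 0))
      t := by
  refine ((A.hasDerivAt_base hx hmem _).add (hasDerivAt_fibreMetric hx
    (A.injective_of_mem hmem p) (A.hasDerivAt_profile hI hmem)
    (fun j => (A.gradComp_pos hmem p j).ne') u.1 _ w.1 _)).congr_deriv ?_
  rw [A.ansatzMetric_hessian hD]
  simp only [ansatzMetric, baseMetric, fibreEigen, map_zero, zero_apply, mul_zero,
    Finset.sum_const_zero, zero_add]
  ring

theorem hasDerivAt_ansatzForm (hx : HasDerivAt x (gradComp A.profile (x t)) t)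
    (hmem : x t ∈ univ.pi I) (hD : A.IsHessian (x t) p D) (u w : (Fin ℓ → ℝ) × A.Q.E) :
    HasDerivAt (fun t => A.ansatzForm (x t) p u w)
      (A.ansatzForm (x t) p (D u) w
        - A.ansatzForm (x t) p (gradCompDeriv A.profile (A.profileDeriv (x t)) (x t) u.1, 0) w
        - A.ansatzForm (x t) p u (gradCompDeriv A.profile (A.profileDeriv (x t)) (x t) w.1, 0))
      t := by
  refine ((A.hasDerivAt_base hx hmem _).add (hasDerivAt_fibreForm (q := A.profile)
    (q' := A.profileDeriv (x t)) hx (A.injective_of_mem hmem p) u.1 _ w.1 _)).congr_deriv ?_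
  rw [A.ansatzForm_hessian hD]
  simp only [ansatzForm, baseForm, fibreEigen, map_zero, zero_apply, mul_zero,
    Finset.sum_const_zero, zero_add]
  ring

variable {ξ : Fin ℓ → ℝ} (hξ : ξ ∈ univ.pi I) (hD : A.IsHessian ξ p D)
include hξ hD

theorem hasDerivAt_ansatzMetric_line (hI : ∀ j, IsOpen (I j)) (u w : (Fin ℓ → ℝ) × A.Q.E) :
    HasDerivAt (fun t : ℝ => A.ansatzMetric (ξ + t • gradComp A.profile ξ) p u w)
      (A.ansatzMetric ξ p (D u) w
        - A.ansatzMetric ξ p (gradCompDeriv A.profile (A.profileDeriv ξ) ξ u.1, 0) w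
        - A.ansatzMetric ξ p u (gradCompDeriv A.profile (A.profileDeriv ξ) ξ w.1, 0)) 0 := by
  have hbase : ξ + (0 : ℝ) • gradComp A.profile ξ = ξ := by simp
  have h := A.hasDerivAt_ansatzMetric (x := fun t => ξ + t • gradComp A.profile ξ) (t := 0) hI
    (by rw [hbase]; exact hasDerivAt_line ξ _ 0) (by rwa [hbase]) (by rwa [hbase]) u w
  rwa [hbase] at h

theorem hasDerivAt_ansatzForm_line (u w : (Fin ℓ → ℝ) × A.Q.E) :
    HasDerivAt (fun t : ℝ => A.ansatzForm (ξ + t • gradComp A.profile ξ) p u w)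
      (A.ansatzForm ξ p (D u) w
        - A.ansatzForm ξ p (gradCompDeriv A.profile (A.profileDeriv ξ) ξ u.1, 0) w
        - A.ansatzForm ξ p u (gradCompDeriv A.profile (A.profileDeriv ξ) ξ w.1, 0)) 0 := by
  have hbase : ξ + (0 : ℝ) • gradComp A.profile ξ = ξ := by simp
  have h := A.hasDerivAt_ansatzForm (x := fun t => ξ + t • gradComp A.profile ξ) (t := 0)
    (by rw [hbase]; exact hasDerivAt_line ξ _ 0) (by rwa [hbase]) (by rwa [hbase]) u w
  rwa [hbase] at h

end LieDerivatives

end HamiltonianAnsatz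

section LocalInverse

theorem exists_openPartialHomeomorph {E F : Type*} [NormedAddCommGroup E] [NormedSpace ℝ E]
    [FiniteDimensional ℝ E] [NormedAddCommGroup F] [NormedSpace ℝ F]
    {Ψ : E → F} {V : Set E} (hV : IsOpen V) (hΨ : ∀ x ∈ V, ContDiffAt ℝ ∞ Ψ x)
    (hbij : ∀ x ∈ V, Function.Bijective (fderiv ℝ Ψ x)) {x₀ : E} (hx₀ : x₀ ∈ V) :
    ∃ P : OpenPartialHomeomorph E F, ⇑P = Ψ ∧ x₀ ∈ P.source ∧ P.source ⊆ V ∧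
      ∀ z ∈ P.target, ContDiffAt ℝ ∞ P.symm z := by
  have : CompleteSpace E := FiniteDimensional.complete ℝ E
  let L (x : E) (hx : x ∈ V) : E ≃L[ℝ] F :=
    (LinearEquiv.ofBijective (fderiv ℝ Ψ x : E →ₗ[ℝ] F) (hbij x hx)).toContinuousLinearEquiv
  have hL (x : E) (hx : x ∈ V) : HasFDerivAt Ψ (L x hx : E →L[ℝ] F) x :=
    ((hΨ x hx).differentiableAt (by simp)).hasFDerivAt.congr_fderiv
      (ContinuousLinearMap.ext fun _ => rfl)
  let P := ((hΨ x₀ hx₀).toOpenPartialHomeomorph Ψ (hL x₀ hx₀) (by simp)).restrOpen V hV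
  have hPV : P.source ⊆ V := fun x hx => hx.2
  refine ⟨P, rfl,
    ⟨(hΨ x₀ hx₀).mem_toOpenPartialHomeomorph_source (hL x₀ hx₀) (by simp), hx₀⟩, hPV,
    fun z hz => ?_⟩
  have hsymm := hPV (P.map_target hz)
  exact P.contDiffAt_symm hz (hL _ hsymm) (hΨ _ hsymm)

end LocalInverse

namespace HamiltonianAnsatz

variable {ℓ : ℕ} {M : KahlerManifold.{u}} {φ : TwoTensor M.dim M.Carrier} {I : Fin ℓ → Set ℝ}
  (A : HamiltonianAnsatz.{u, v, w} M φ I)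

section Gradient

/-- The gradient of `σ_1` on `𝒟 × P`, in a chart of `P`. -/
def gradField (x : (Fin ℓ → ℝ) × A.Q.E) : (Fin ℓ → ℝ) × A.Q.E := (gradComp A.profile x.1, 0)

theorem gradField_line (x : (Fin ℓ → ℝ) × A.Q.E) (t : ℝ) :
    x + t • A.gradField x = (x.1 + t • gradComp A.profile x.1, x.2) :=
  Prod.ext rfl (by simp [gradField])

variable (hI : ∀ j, IsOpen (I j))
include hI

theorem contDiffAt_gradField {x : (Fin ℓ → ℝ) × A.Q.E} (hξ : x.1 ∈ univ.pi I) (p : A.Q.P) :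
    ContDiffAt ℝ ∞ A.gradField x :=
  (ContDiffAt.comp x (A.contDiffAt_gradComp hI hξ p) contDiffAt_fst).prodMk contDiffAt_const

theorem fderiv_gradField_apply {x : (Fin ℓ → ℝ) × A.Q.E} (hξ : x.1 ∈ univ.pi I) (p : A.Q.P)
    (u : (Fin ℓ → ℝ) × A.Q.E) :
    fderiv ℝ A.gradField x u
      = (gradCompDeriv A.profile (A.profileDeriv x.1) x.1 u.1, 0) := by
  have hgrad := ((A.contDiffAt_gradComp hI hξ p).differentiableAt (by simp)).hasFDerivAt
  have hfield : HasFDerivAt A.gradField _ x :=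
    (hgrad.comp x hasFDerivAt_fst).prodMk (hasFDerivAt_const (0 : A.Q.E) x)
  rw [hfield.fderiv, ← A.fderiv_gradComp hI hξ p]
  rfl

variable {c : OpenPartialHomeomorph M.Carrier (Cn M.dim)}
  {e : OpenPartialHomeomorph A.Q.P A.Q.E} (hc : c ∈ atlas (Cn M.dim) M.Carrier)
  (he : e ∈ atlas A.Q.E A.Q.P) {x : (Fin ℓ → ℝ) × A.Q.E} (hx : x ∈ A.coordDomain c e)
include hc he hx

theorem localForm_gradField (u : (Fin ℓ → ℝ) × A.Q.E) :
    localForm c M.g (A.coord c e x) (fderiv ℝ (A.coord c e) x (A.gradField x))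
      (fderiv ℝ (A.coord c e) x u) = ∑ j, u.1 j := by
  rw [A.fderiv_coord hI hc he hx, A.fderiv_coord hI hc he hx]
  refine (A.localForm_g_chartDerivΦ hc hx.1.1 hx.2 _ _).trans ?_
  simp only [gradField, ansatzMetric, baseMetric, fibreMetric, map_zero, zero_apply, mul_zero,
    Finset.sum_const_zero, zero_add, tau_zero, zero_mul, add_zero]
  refine Finset.sum_congr rfl fun j _ => ?_
  rw [← mul_assoc, inv_mul_cancel₀ (A.gradComp_pos hx.1.1 (e.symm x.2) j).ne', one_mul]

theorem localField_smul_J {K : ∀ x, M.T x} (hK : A.IsHamiltonianField 1 K) (a : ℝ) :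
    localField c (fun x => a • J x (K x)) (A.coord c e x)
      = (-a) • fderiv ℝ (A.coord c e) x (A.gradField x) := by
  let K' : M.Carrier → Cn M.dim := K
  set y := A.Φ (x.1, e.symm x.2)
  have hz := A.coord_mem_target hx
  have hsymm : c.symm (A.coord c e x) = y := c.left_inv hx.2
  have hfield : localField c (fun x => a • J x (K x)) (A.coord c e x)
      = chartDeriv c (c.symm (A.coord c e x))
        (a • (Complex.I • K' (c.symm (A.coord c e x)))) := rfl
  have hJK : Complex.I • chartDeriv c y (K' y)
      = -fderiv ℝ (A.coord c e) x (A.gradField x) := by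
    refine (M.isHermitianForm_localForm hc hz).eq_of_forall fun w => ?_
    obtain ⟨u, rfl⟩ := (A.fderiv_coord_bijective hI hc he hx).2 w
    have hframe := frameDeriv_chartDeriv hc hx.2
    rw [form_neg_apply, A.localForm_gradField hI hc he hx,
      ← localForm_fundamentalForm hc hz, A.fderiv_coord hI hc he hx, localForm_apply, hsymm,
      chartDerivΦ, ContinuousLinearMap.comp_apply, coord, hframe, hframe, ← dσ_one x.1]
    exact hK x.1 hx.1.1 (e.symm x.2) _
  rw [hfield, hsymm, ContinuousLinearMap.map_smul, chartDeriv_I_smul hc hx.2, hJK, smul_neg,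
    neg_smul]

variable {Y : Cn M.dim → Cn M.dim} (hY : DifferentiableAt ℝ Y (A.coord c e x))
  (hYx : ∀ᶠ x' in 𝓝 x, Y (A.coord c e x') = fderiv ℝ (A.coord c e) x' (A.gradField x'))
include hY hYx

theorem lieDeriv_coord {H : Cn M.dim → Cn M.dim →L[ℝ] Cn M.dim →L[ℝ] ℝ}
    {R : (Fin ℓ → ℝ) → A.Q.P → (Fin ℓ → ℝ) × A.Q.E → (Fin ℓ → ℝ) × A.Q.E → ℝ}
    {D : ((Fin ℓ → ℝ) × A.Q.E) →ₗ[ℝ] ((Fin ℓ → ℝ) × A.Q.E)}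
    (hH : DifferentiableAt ℝ H (A.coord c e x))
    (hR : ∀ x' ∈ A.coordDomain c e, ∀ u w, H (A.coord c e x')
      (A.chartDerivΦ c (x'.1, e.symm x'.2) u) (A.chartDerivΦ c (x'.1, e.symm x'.2) w)
        = R x'.1 (e.symm x'.2) u w)
    (hD : ∀ u w, HasDerivAt (fun t : ℝ => R (x.1 + t • gradComp A.profile x.1) (e.symm x.2) u w)
      (R x.1 (e.symm x.2) (D u) w
        - R x.1 (e.symm x.2) (gradCompDeriv A.profile (A.profileDeriv x.1) x.1 u.1, 0) w
        - R x.1 (e.symm x.2) u (gradCompDeriv A.profile (A.profileDeriv x.1) x.1 w.1, 0)) 0)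
    (u w : (Fin ℓ → ℝ) × A.Q.E) :
    lieDeriv H Y (A.coord c e x) (fderiv ℝ (A.coord c e) x u) (fderiv ℝ (A.coord c e) x w)
      = R x.1 (e.symm x.2) (D (u.1, A.symmDeriv e x.2 u.2)) (w.1, A.symmDeriv e x.2 w.2) := by
  refine lieDeriv_pullback (y := A.gradField)
    (R := fun x u w => R x.1 (e.symm x.2) (u.1, A.symmDeriv e x.2 u.2)
      (w.1, A.symmDeriv e x.2 w.2))
    (r := fun u w => R x.1 (e.symm x.2) (D (u.1, A.symmDeriv e x.2 u.2))
      (w.1, A.symmDeriv e x.2 w.2))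
    ((A.contDiffAt_coord hI hc he hx).of_le ENat.LEInfty.out) hH hY
    ((A.contDiffAt_gradField hI hx.1.1 (e.symm x.2)).differentiableAt (by simp)).hasFDerivAt
    hYx ?_ (fun u w => ?_) u w
  · filter_upwards [(A.isOpen_coordDomain hI he).mem_nhds hx] with x' hx' u w
    rw [A.fderiv_coord hI hc he hx', A.fderiv_coord hI hc he hx', hR x' hx']
  · simp only [A.gradField_line, A.fderiv_gradField_apply hI hx.1.1 (e.symm x.2), map_zero]
    exact hD _ _

theorem exists_lieEndomorphism : ∃ C : Cn M.dim →ₗ[ℝ] Cn M.dim,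
    (∀ u w, lieDeriv (localForm c M.g) Y (A.coord c e x) u w
      = localForm c M.g (A.coord c e x) (C u) w) ∧
    (∀ u w, lieDeriv (jForm (localForm c M.g)) Y (A.coord c e x) u w
      = jForm (localForm c M.g) (A.coord c e x) (C u) w) ∧
    (1 / 2) * LinearMap.trace ℝ (Cn M.dim) C = A.laplacian x.1 := by
  obtain ⟨D, hD, htrace⟩ := A.exists_isHessian hI hx.1.1 (e.symm x.2)
  have hmetric := A.hasDerivAt_ansatzMetric_line hx.1.1 hD hI
  have hform := A.hasDerivAt_ansatzForm_line hx.1.1 hD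
  let T := LinearEquiv.ofBijective (A.chartDerivΦ c (x.1, e.symm x.2)).toLinearMap
    (A.chartDerivΦ_bijective hc hx.1.1 hx.2)
  have hconj (u : (Fin ℓ → ℝ) × A.Q.E) : T.conj D (A.chartDerivΦ c (x.1, e.symm x.2) u)
      = A.chartDerivΦ c (x.1, e.symm x.2) (D u) := by
    change T (D (T.symm (T u))) = T (D u)
    rw [T.symm_apply_apply]
  have hjForm (x') (hx' : x' ∈ A.coordDomain c e) (u w) :
      jForm (localForm c M.g) (A.coord c e x') (A.chartDerivΦ c (x'.1, e.symm x'.2) u)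
        (A.chartDerivΦ c (x'.1, e.symm x'.2) w) = A.ansatzForm x'.1 (e.symm x'.2) u w := by
    rw [← M.localForm_kahlerForm hc (A.coord_mem_target hx')]
    exact A.localForm_kahlerForm_chartDerivΦ hc hx'.1.1 hx'.2 u w
  have hsurj := (A.fderiv_coord_bijective hI hc he hx).2
  refine ⟨T.conj D, fun u w => ?_, fun u w => ?_, by rw [LinearMap.trace_conj', htrace]⟩ <;>
    obtain ⟨u, rfl⟩ := hsurj u <;> obtain ⟨w, rfl⟩ := hsurj w
  · rw [A.lieDeriv_coord hI hc he hx hY hYx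
        ((M.contDiffAt_localForm_g hc (A.coord_mem_target hx)).differentiableAt (by simp))
        (fun x' hx' => A.localForm_g_chartDerivΦ hc hx'.1.1 hx'.2) hmetric,
      A.fderiv_coord hI hc he hx, A.fderiv_coord hI hc he hx, hconj]
    exact (A.localForm_g_chartDerivΦ hc hx.1.1 hx.2 _ _).symm
  · rw [A.lieDeriv_coord hI hc he hx hY hYx (differentiableAt_jForm
        ((M.contDiffAt_localForm_g hc (A.coord_mem_target hx)).differentiableAt (by simp)))
        hjForm hform, A.fderiv_coord hI hc he hx, A.fderiv_coord hI hc he hx, hconj]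
    exact (hjForm x hx _ _).symm

end Gradient

section SolitonEquation

/-- `P` is a smooth local diffeomorphism from the `ξ_j` and a chart `e` of the torus bundle to
the chart `c` of `M`. -/
structure IsCoordChange (c : OpenPartialHomeomorph M.Carrier (Cn M.dim))
    (e : OpenPartialHomeomorph A.Q.P A.Q.E)
    (P : OpenPartialHomeomorph ((Fin ℓ → ℝ) × A.Q.E) (Cn M.dim)) : Prop where
  coe_eq : ⇑P = A.coord c e
  source_subset : P.source ⊆ A.coordDomain c e
  contDiffAt_symm : ∀ z ∈ P.target, ContDiffAt ℝ ∞ P.symm z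

/-- The gradient of `σ_1` in the coordinates of `M` on the target of `P`. -/
def localGrad (P : OpenPartialHomeomorph ((Fin ℓ → ℝ) × A.Q.E) (Cn M.dim)) (z : Cn M.dim) :
    Cn M.dim :=
  fderiv ℝ P (P.symm z) (A.gradField (P.symm z))

/-- The function `σ_1 = ∑ ξ_j` in the coordinates of `M` on the target of `P`. -/
def localPotential (P : OpenPartialHomeomorph ((Fin ℓ → ℝ) × A.Q.E) (Cn M.dim))
    (z : Cn M.dim) : ℝ :=
  ∑ j, (P.symm z).1 j

variable {A}
variable (hI : ∀ j, IsOpen (I j))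
  {c : OpenPartialHomeomorph M.Carrier (Cn M.dim)}
  {e : OpenPartialHomeomorph A.Q.P A.Q.E} (hc : c ∈ atlas (Cn M.dim) M.Carrier)
  (he : e ∈ atlas A.Q.E A.Q.P)
  {P : OpenPartialHomeomorph ((Fin ℓ → ℝ) × A.Q.E) (Cn M.dim)} (hP : A.IsCoordChange c e P)

include hP

theorem IsCoordChange.coord_symm {z : Cn M.dim} (hz : z ∈ P.target) :
    A.coord c e (P.symm z) = z := by
  rw [← hP.coe_eq, P.right_inv hz]

theorem IsCoordChange.symm_mem_coordDomain {z : Cn M.dim} (hz : z ∈ P.target) :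
    P.symm z ∈ A.coordDomain c e :=
  hP.source_subset (P.map_target hz)

theorem IsCoordChange.target_subset : P.target ⊆ c.target := fun z hz => by
  rw [← hP.coord_symm hz]
  exact A.coord_mem_target (hP.symm_mem_coordDomain hz)

theorem IsCoordChange.contDiffAt_localPotential {z : Cn M.dim} (hz : z ∈ P.target) :
    ContDiffAt ℝ ∞ (A.localPotential P) z :=
  ContDiffAt.sum fun j _ =>
    (contDiff_apply ℝ ℝ j).contDiffAt.comp z (contDiffAt_fst.comp z (hP.contDiffAt_symm z hz))

include hI hc he

theorem IsCoordChange.contDiffAt_localGrad {z : Cn M.dim} (hz : z ∈ P.target) :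
    ContDiffAt ℝ ∞ (A.localGrad P) z := by
  have hx := hP.symm_mem_coordDomain hz
  have hsymm := hP.contDiffAt_symm z hz
  have hderiv : ContDiffAt ℝ ∞ (fderiv ℝ P) (P.symm z) := by
    rw [hP.coe_eq]
    exact (A.contDiffAt_coord hI hc he hx).fderiv_right (m := ∞) (by simp)
  exact (ContDiffAt.comp (g := fderiv ℝ P) z hderiv hsymm).clm_apply
    (ContDiffAt.comp z (A.contDiffAt_gradField hI hx.1.1 (e.symm (P.symm z).2)) hsymm)

theorem IsCoordChange.fderiv_localPotential {x : (Fin ℓ → ℝ) × A.Q.E} (hx : x ∈ P.source)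
    (u : (Fin ℓ → ℝ) × A.Q.E) :
    fderiv ℝ (A.localPotential P) (P x) (fderiv ℝ P x u) = ∑ j, u.1 j := by
  let L : ((Fin ℓ → ℝ) × A.Q.E) →L[ℝ] ℝ :=
    ∑ j, (ContinuousLinearMap.proj (R := ℝ) (φ := fun _ : Fin ℓ => ℝ) j).comp
      (ContinuousLinearMap.fst ℝ (Fin ℓ → ℝ) A.Q.E)
  have hL (y : (Fin ℓ → ℝ) × A.Q.E) : L y = ∑ j, y.1 j := by simp [L]
  have hPx : DifferentiableAt ℝ P x := by
    rw [hP.coe_eq]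
    exact (A.contDiffAt_coord hI hc he (hP.source_subset hx)).differentiableAt (by simp)
  have hpot := (hP.contDiffAt_localPotential (P.map_source hx)).differentiableAt (by simp)
  have hcomp : HasFDerivAt (A.localPotential P ∘ P) L x := by
    refine L.hasFDerivAt.congr_of_eventuallyEq ?_
    filter_upwards [P.open_source.mem_nhds hx] with y hy
    rw [hL, Function.comp_apply, localPotential, P.left_inv hy]
  rw [← hL, (hpot.hasFDerivAt.comp x hPx.hasFDerivAt).unique hcomp |>.symm]
  rfl

theorem IsCoordChange.isGradientOn :
    IsGradientOn (localForm c M.g) (A.localGrad P) (A.localPotential P) P.target where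
  contDiffOn z hz :=
    ((hP.contDiffAt_localGrad hI hc he hz).of_le ENat.LEInfty.out).contDiffWithinAt
  contDiffOn_potential z hz :=
    ((hP.contDiffAt_localPotential hz).of_le ENat.LEInfty.out).contDiffWithinAt
  apply_eq z hz w := by
    have hx := hP.symm_mem_coordDomain hz
    obtain ⟨u, rfl⟩ := (A.fderiv_coord_bijective hI hc he hx).2 w
    have hgrad := A.localForm_gradField hI hc he hx u
    have hpot := hP.fderiv_localPotential hI hc he (P.map_target hz) u
    rw [hP.coord_symm hz] at hgrad
    rw [P.right_inv hz, hP.coe_eq] at hpot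
    rw [localGrad, hP.coe_eq, hgrad, hpot]

theorem IsCoordChange.exists_isLieEndomorphism :
    ∃ C : Cn M.dim → Cn M.dim →ₗ[ℝ] Cn M.dim,
      IsLieEndomorphism (localForm c M.g) (A.localGrad P) C P.target ∧
      ∀ z ∈ P.target, (1 / 2) * LinearMap.trace ℝ (Cn M.dim) (C z)
        = A.laplacian (P.symm z).1 := by
  have hex (z) (hz : z ∈ P.target) := A.exists_lieEndomorphism hI hc he
    (hP.symm_mem_coordDomain hz) (Y := A.localGrad P)
    (by
      rw [hP.coord_symm hz]
      exact (hP.contDiffAt_localGrad hI hc he hz).differentiableAt (by simp))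
    (by
      filter_upwards [P.open_source.mem_nhds (P.map_target hz)] with x hx
      rw [localGrad, ← hP.coe_eq, P.left_inv hx])
  choose! C hmetric hform htrace using hex
  refine ⟨C, ⟨fun z hz u w => ?_, fun z hz u w => ?_⟩, htrace⟩
  · have := hmetric z hz u w
    rwa [hP.coord_symm hz] at this
  · have := hform z hz u w
    rwa [hP.coord_symm hz] at this

theorem IsCoordChange.localField_smul_J {K : ∀ x, M.T x} (hK : A.IsHamiltonianField 1 K)
    (a : ℝ) {z : Cn M.dim} (hz : z ∈ P.target) :
    localField c (fun x => a • J x (K x)) z = (-a) • A.localGrad P z := by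
  have := A.localField_smul_J hI hc he (hP.symm_mem_coordDomain hz) hK a
  rwa [hP.coord_symm hz, ← hP.coe_eq] at this

theorem IsCoordChange.iddbar_add_lieDeriv {K : ∀ x, M.T x} (hK : A.IsHamiltonianField 1 K)
    {a lam : ℝ} (hsol : IsGradientKahlerRicciSoliton M (fun x => a • J x (K x)) lam)
    {z : Cn M.dim} (hz : z ∈ P.target) (u w : Cn M.dim) :
    iddbar (fun z' => -logDet (localForm c M.g) z') z u w
        + (1 / 2) * lieDeriv (jForm (localForm c M.g)) (-a • A.localGrad P) z u w
      = lam * jForm (localForm c M.g) z u w := by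
  have hzc := hP.target_subset hz
  have hfield : localField c (fun x => a • J x (K x)) =ᶠ[𝓝 z] -a • A.localGrad P := by
    filter_upwards [P.open_target.mem_nhds hz] with z' hz'
    exact hP.localField_smul_J hI hc he hK a hz'
  rw [← lieDeriv_congr _ hfield, ← M.lieKahlerForm_eq_lieDeriv hc hzc,
    ← M.localForm_kahlerForm hc hzc]
  exact hsol.equation c hc z hzc u w

theorem IsCoordChange.hasFDerivAt_soliton {K : ∀ x, M.T x} (hK : A.IsHamiltonianField 1 K)
    {a lam : ℝ} (hsol : IsGradientKahlerRicciSoliton M (fun x => a • J x (K x)) lam)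
    {x : (Fin ℓ → ℝ) × A.Q.E} (hx : x ∈ P.source) :
    HasFDerivAt (fun ξ => A.laplacian ξ + a * ∑ j, gradComp A.profile ξ j + 2 * lam * ∑ j, ξ j)
      (0 : (Fin ℓ → ℝ) →L[ℝ] ℝ) x.1 := by
  obtain ⟨C, hC, htrace⟩ := hP.exists_isLieEndomorphism hI hc he
  have hG := M.isKahlerOn_localForm hc P.open_target hP.target_subset
  have hconst := hG.hasFDerivAt_soliton (hP.isGradientOn hI hc he) hC (P.map_source hx)
    (hP.iddbar_add_lieDeriv hI hc he hK hsol (P.map_source hx))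
  have hPx : DifferentiableAt ℝ P x := by
    rw [hP.coe_eq]
    exact (A.contDiffAt_coord hI hc he (hP.source_subset hx)).differentiableAt (by simp)
  have hslice : HasFDerivAt (fun ξ : Fin ℓ → ℝ => (ξ, x.2))
      (ContinuousLinearMap.inl ℝ (Fin ℓ → ℝ) A.Q.E) x.1 :=
    hasFDerivAt_prodMk_left x.1 x.2
  refine ((hconst.comp x.1 (HasFDerivAt.comp x.1 hPx.hasFDerivAt hslice)).congr_fderiv
    (ContinuousLinearMap.zero_comp _)).congr_of_eventuallyEq ?_
  filter_upwards [hslice.continuousAt.eventually (P.open_source.mem_nhds hx)] with ξ hξ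
  have hξ : (ξ, x.2) ∈ P.source := hξ
  have htr := htrace _ (P.map_source hξ)
  have hgrad : fderiv ℝ (A.localPotential P) (P (ξ, x.2)) (A.localGrad P (P (ξ, x.2)))
      = ∑ j, gradComp A.profile ξ j := by
    rw [localGrad, P.left_inv hξ]
    exact hP.fderiv_localPotential hI hc he hξ _
  have hpot : A.localPotential P (P (ξ, x.2)) = ∑ j, ξ j := by
    rw [localPotential, P.left_inv hξ]
  rw [P.left_inv hξ, ← hG.divergence_eq_trace hC (P.map_source hξ)] at htr
  rw [← htr, ← hgrad, ← hpot]
  rfl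

end SolitonEquation

theorem hasFDerivAt_soliton (hI : ∀ j, IsOpen (I j)) {K : ∀ x, M.T x}
    (hK : A.IsHamiltonianField 1 K) {a lam : ℝ}
    (hsol : IsGradientKahlerRicciSoliton M (fun x => a • J x (K x)) lam)
    {ξ₀ : Fin ℓ → ℝ} (hξ₀ : ξ₀ ∈ univ.pi I) (p : A.Q.P) :
    HasFDerivAt (fun ξ => A.laplacian ξ + a * ∑ j, gradComp A.profile ξ j + 2 * lam * ∑ j, ξ j)
      (0 : (Fin ℓ → ℝ) →L[ℝ] ℝ) ξ₀ := by
  let e := chartAt A.Q.E p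
  let c := chartAt (Cn M.dim) (A.Φ (ξ₀, p))
  have hc : c ∈ atlas (Cn M.dim) M.Carrier := chart_mem_atlas _ _
  have he : e ∈ atlas A.Q.E A.Q.P := chart_mem_atlas _ _
  obtain ⟨P, hcoe, hx, hsource, hsymm⟩ := exists_openPartialHomeomorph
    (A.isOpen_coordDomain hI he) (fun x hx => A.contDiffAt_coord hI hc he hx)
    (fun x hx => A.fderiv_coord_bijective hI hc he hx)
    (A.mem_coordDomain hξ₀ (mem_chart_source _ p) (mem_chart_source _ _))
  exact IsCoordChange.hasFDerivAt_soliton hI hc he ⟨hcoe, hsource, hsymm⟩ hK hsol hx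

end HamiltonianAnsatz

section ScalarEquation

variable {h h' : ℝ → ℝ}

theorem exists_eventually_eq_affine {m : ℝ} (hd : ∀ᶠ t in atTop, HasDerivAt h m t) :
    ∃ b, ∀ᶠ t in atTop, h t = m * t + b := by
  obtain ⟨T, hT⟩ := eventually_atTop.1 hd
  have hder : ∀ t ∈ Ici T, HasDerivWithinAt (fun t => h t - m * t) 0 (Ici T) t := fun t ht =>
    (((hT t ht).sub ((hasDerivAt_id t).const_mul m)).congr_deriv (by ring)).hasDerivWithinAt
  refine ⟨h T - m * T, (eventually_ge_atTop T).mono fun t ht => ?_⟩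
  have hconst := (convex_Ici T).norm_image_sub_le_of_norm_hasDerivWithin_le (C := 0) hder
    (fun _ _ => norm_zero.le) self_mem_Ici ht
  rw [zero_mul, norm_le_zero_iff] at hconst
  linarith

theorem false_of_deriv_le_neg_one (hpos : ∀ᶠ t in atTop, 0 < h t)
    (hd : ∀ᶠ t in atTop, HasDerivAt h (h' t) t) (hle : ∀ᶠ t in atTop, h' t ≤ -1) : False := by
  obtain ⟨T, hT⟩ := eventually_atTop.1 ((hpos.and hd).and hle)
  have hder : ∀ t ∈ Ici T, HasDerivAt (fun t => h t + t) (h' t + 1) t := fun t ht =>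
    (hT t ht).1.2.add (hasDerivAt_id t)
  have hanti : AntitoneOn (fun t => h t + t) (Ici T) := by
    refine antitoneOn_of_hasDerivWithinAt_nonpos (convex_Ici T)
      (fun t ht => (hder t ht).continuousAt.continuousWithinAt)
      (fun t ht => (hder t (interior_subset ht)).hasDerivWithinAt) fun t ht => ?_
    linarith [(hT t (interior_subset ht)).2]
  have hmem : T + h T ∈ Ici T := by simpa using (hT T le_rfl).1.1.le
  have hdecrease : h (T + h T) + (T + h T) ≤ h T + T := hanti self_mem_Ici hmem hmem
  linarith [(hT (T + h T) hmem).1.1]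

theorem exp_le_of_mul_le_deriv {k : ℝ} (hpos : ∀ᶠ t in atTop, 0 < h t)
    (hd : ∀ᶠ t in atTop, HasDerivAt h (h' t) t) (hle : ∀ᶠ t in atTop, k * h t ≤ h' t) :
    ∃ C > 0, ∀ᶠ t in atTop, C * Real.exp (k * t) ≤ h t := by
  obtain ⟨T, hT⟩ := eventually_atTop.1 ((hpos.and hd).and hle)
  have hder : ∀ t ∈ Ici T, HasDerivAt (fun t => h t * Real.exp (-(k * t)))
      (h' t * Real.exp (-(k * t)) + h t * (Real.exp (-(k * t)) * -(k * 1))) t := fun t ht =>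
    (hT t ht).1.2.mul ((hasDerivAt_id t).const_mul k).neg.exp
  have hmono : MonotoneOn (fun t => h t * Real.exp (-(k * t))) (Ici T) := by
    refine monotoneOn_of_hasDerivWithinAt_nonneg (convex_Ici T)
      (fun t ht => (hder t ht).continuousAt.continuousWithinAt)
      (fun t ht => (hder t (interior_subset ht)).hasDerivWithinAt) fun t ht => ?_
    have := mul_nonneg (sub_nonneg.2 (hT t (interior_subset ht)).2) (Real.exp_pos (-(k * t))).le
    linarith
  refine ⟨h T * Real.exp (-(k * T)), mul_pos (hT T le_rfl).1.1 (Real.exp_pos _), ?_⟩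
  filter_upwards [eventually_ge_atTop T] with t ht
  calc h T * Real.exp (-(k * T)) * Real.exp (k * t)
      ≤ h t * Real.exp (-(k * t)) * Real.exp (k * t) :=
        mul_le_mul_of_nonneg_right (hmono self_mem_Ici ht ht) (Real.exp_pos _).le
    _ = h t := by rw [mul_assoc, ← Real.exp_add, neg_add_cancel, Real.exp_zero, mul_one]

variable {r b : ℝ → ℝ} {c lam L : ℝ}

theorem tendsto_linear_add (hlam : lam < 0) (hb : Tendsto b atTop (𝓝 L)) :
    Tendsto (fun t => -2 * lam * t + b t) atTop atTop :=
  (tendsto_id.const_mul_atTop (by linarith : 0 < -2 * lam)).atTop_add hb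

theorem false_of_shrinking (hlam : 0 < lam) (hc : 0 ≤ c) (hpos : ∀ᶠ t in atTop, 0 < h t)
    (hr : ∀ᶠ t in atTop, 0 ≤ r t) (hb : Tendsto b atTop (𝓝 L))
    (hd : ∀ᶠ t in atTop, HasDerivAt h (-(c + r t) * h t - 2 * lam * t + b t) t) : False := by
  refine false_of_deriv_le_neg_one hpos hd ?_
  filter_upwards [(tendsto_linear_add (neg_neg_of_pos hlam) hb.neg).eventually_ge_atTop 1, hpos,
    hr] with t hlinear hht hrt
  have := mul_nonneg (add_nonneg hc hrt) hht.le
  linarith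

theorem exp_le_of_expanding (hlam : lam < 0) (hc : c < 0) (hpos : ∀ᶠ t in atTop, 0 < h t)
    (hr : Tendsto r atTop (𝓝 0)) (hb : Tendsto b atTop (𝓝 L))
    (hd : ∀ᶠ t in atTop, HasDerivAt h (-(c + r t) * h t - 2 * lam * t + b t) t) :
    ∃ k > 0, ∃ C > 0, ∀ᶠ t in atTop, C * Real.exp (k * t) ≤ h t := by
  refine ⟨-c / 2, by linarith, exp_le_of_mul_le_deriv hpos hd ?_⟩
  filter_upwards [(tendsto_linear_add hlam hb).eventually_ge_atTop 0, hpos,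
    hr.eventually_le_const (show (0 : ℝ) < -c / 2 by linarith)] with t hlinear hht hrt
  have := mul_nonneg (sub_nonneg.2 hrt) hht.le
  linarith

end ScalarEquation

section Ray

variable {ℓ : ℕ}

/-- The ray `ξ_j = δt`, along which the other coordinates stay constant. -/
def ray (ξ : Fin ℓ → ℝ) (j : Fin ℓ) (δ t : ℝ) : Fin ℓ → ℝ := Function.update ξ j (δ * t)

variable (ξ : Fin ℓ → ℝ) {i j : Fin ℓ} (δ t : ℝ)

theorem ray_self : ray ξ j δ t j = δ * t := Function.update_self ..

theorem ray_of_ne (hij : i ≠ j) : ray ξ j δ t i = ξ i := Function.update_of_ne hij ..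

theorem contDiff_ray : ContDiff ℝ ∞ (ray ξ j δ) :=
  (contDiff_update ∞ ξ j).comp (contDiff_const.mul contDiff_id)

theorem hasDerivAt_ray : HasDerivAt (ray ξ j δ) (Pi.single j δ) t := by
  refine hasDerivAt_pi.2 fun i => ?_
  rcases eq_or_ne i j with rfl | hij
  · simpa only [ray_self, Pi.single_eq_same, id_eq, mul_one] using (hasDerivAt_id t).const_mul δ
  · simpa only [ray_of_ne ξ _ _ hij, Pi.single_eq_of_ne hij] using hasDerivAt_const t (ξ i)

theorem Δ_ray_of_ne (hij : i ≠ j) : Δ (ray ξ j δ t) i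
    = (ξ i - δ * t) * ∏ k ∈ (Finset.univ.erase i).erase j, (ξ i - ξ k) := by
  rw [Δ, ← Finset.mul_prod_erase _ _ (Finset.mem_erase.2 ⟨hij.symm, Finset.mem_univ j⟩), ray_self,
    ray_of_ne ξ _ _ hij]
  congr 1
  exact Finset.prod_congr rfl fun k hk => by rw [ray_of_ne ξ _ _ (Finset.ne_of_mem_erase hk)]

theorem ray_mem_pi {I : Fin ℓ → Set ℝ} (hξ : ξ ∈ univ.pi I) (ht : δ * t ∈ I j) :
    ray ξ j δ t ∈ univ.pi I :=
  (update_mem_pi_iff_of_mem hξ).2 fun _ => ht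

theorem exists_eventually_ray_mem_pi {I : Fin ℓ → Set ℝ} (htop : ∃ j, I j ∈ atTop)
    (hbot : ∃ j, I j ∈ atBot) (hξ : ξ ∈ univ.pi I) (hδ : δ ≠ 0) :
    ∃ j, ∀ᶠ t in atTop, ray ξ j δ t ∈ univ.pi I := by
  rcases lt_or_gt_of_ne hδ with hneg | hpos
  · obtain ⟨j, hj⟩ := hbot
    exact ⟨j, (tendsto_id.const_mul_atTop_of_neg hneg).eventually
      (eventually_of_mem hj fun _ ht => ht) |>.mono fun t ht => ray_mem_pi ξ δ t hξ ht⟩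
  · obtain ⟨j, hj⟩ := htop
    exact ⟨j, (tendsto_id.const_mul_atTop hpos).eventually
      (eventually_of_mem hj fun _ ht => ht) |>.mono fun t ht => ray_mem_pi ξ δ t hξ ht⟩

end Ray

theorem tendsto_sum_mul_inv_sub {ι : Type*} (s : Finset ι) (m y : ι → ℝ) :
    Tendsto (fun t => ∑ i ∈ s, m i * (t - y i)⁻¹) atTop (𝓝 0) := by
  have hterm : ∀ i ∈ s, Tendsto (fun t => m i * (t - y i)⁻¹) atTop (𝓝 0) := fun i _ => by
    have hsub : Tendsto (fun t => t - y i) atTop atTop := by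
      simpa only [sub_eq_add_neg, id_eq] using
        tendsto_atTop_add_const_right atTop (-y i) tendsto_id
    simpa only [mul_zero, Pi.inv_apply] using hsub.inv_tendsto_atTop.const_mul (m i)
  simpa only [Finset.sum_const_zero] using tendsto_finsetSum s hterm

theorem eventually_sum_mul_inv_sub_nonneg {ι : Type*} (s : Finset ι) {m : ι → ℝ}
    (hm : ∀ i, 0 ≤ m i) (y : ι → ℝ) : ∀ᶠ t in atTop, 0 ≤ ∑ i ∈ s, m i * (t - y i)⁻¹ := by
  have hge : ∀ᶠ t in atTop, ∀ i ∈ s, y i ≤ t :=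
    (Finset.eventually_all s).2 fun i _ => eventually_ge_atTop (y i)
  filter_upwards [hge] with t ht
  exact Finset.sum_nonneg fun i hi => mul_nonneg (hm i) (inv_nonneg.2 (sub_nonneg.2 (ht i hi)))

theorem mul_inv_mul_sub {δ : ℝ} (hδ : δ ≠ 0) (t y : ℝ) : δ * (δ * t - y)⁻¹ = (t - y / δ)⁻¹ := by
  rw [show δ * t - y = δ * (t - y / δ) by field_simp, mul_inv, mul_inv_cancel_left₀ hδ]

namespace HamiltonianAnsatz

variable {ℓ : ℕ} {M : KahlerManifold.{u}} {φ : TwoTensor M.dim M.Carrier} {I : Fin ℓ → Set ℝ}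
  (A : HamiltonianAnsatz.{u, v, w} M φ I)

/-- The contribution of `ξ_j` to `Δσ_1 + a|∇σ_1|² + 2λσ_1`. -/
def solitonTerm (a lam : ℝ) (ξ : Fin ℓ → ℝ) (j : Fin ℓ) : ℝ :=
  deriv (A.F j) (ξ j) / (pc A.B A.η (ξ j) * Δ ξ j) + a * gradComp A.profile ξ j + 2 * lam * ξ j

/-- The decay rate of `Y_j` along the ray `ξ_j = δt` that comes from the differences `ξ_j - ξ_i` and
`ξ_j - η_b`. -/
def decayRate (ξ : Fin ℓ → ℝ) (j : Fin ℓ) (δ t : ℝ) : ℝ :=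
  ∑ i ∈ Finset.univ.erase j, (t - ξ i / δ)⁻¹ + ∑ b, ((A.B b).dim : ℝ) * (t - A.η b / δ)⁻¹

theorem sum_solitonTerm (a lam : ℝ) (ξ : Fin ℓ → ℝ) : ∑ j, A.solitonTerm a lam ξ j
    = A.laplacian ξ + a * ∑ j, gradComp A.profile ξ j + 2 * lam * ∑ j, ξ j := by
  simp only [solitonTerm, laplacian, Finset.sum_add_distrib, Finset.mul_sum]

variable {ξ : Fin ℓ → ℝ} {j : Fin ℓ} {δ : ℝ}

theorem tendsto_decayRate : Tendsto (A.decayRate ξ j δ) atTop (𝓝 0) := by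
  simpa only [one_mul, add_zero] using!
    (tendsto_sum_mul_inv_sub (Finset.univ.erase j) (fun _ => 1) fun i => ξ i / δ).add
      (tendsto_sum_mul_inv_sub Finset.univ (fun b => ((A.B b).dim : ℝ)) fun b => A.η b / δ)

theorem eventually_decayRate_nonneg : ∀ᶠ t in atTop, 0 ≤ A.decayRate ξ j δ t := by
  filter_upwards [eventually_sum_mul_inv_sub_nonneg (Finset.univ.erase j) (m := fun _ => 1)
      (fun _ => zero_le_one) fun i => ξ i / δ,
    eventually_sum_mul_inv_sub_nonneg Finset.univ (fun b => Nat.cast_nonneg (A.B b).dim)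
      fun b => A.η b / δ] with t hfibre hbase
  simp only [one_mul] at hfibre
  exact add_nonneg hfibre hbase

theorem tendsto_solitonTerm_ray (a lam : ℝ) (hδ : δ ≠ 0) {i : Fin ℓ} (hij : i ≠ j) :
    Tendsto (fun t => A.solitonTerm a lam (ray ξ j δ t) i) atTop (𝓝 (2 * lam * ξ i)) := by
  have hlim := (tendsto_sum_mul_inv_sub {i} (fun i => -((deriv (A.F i) (ξ i)
    / pc A.B A.η (ξ i) + a * A.profile i (ξ i))
    / ∏ k ∈ (Finset.univ.erase i).erase j, (ξ i - ξ k)) / δ) fun i => ξ i / δ).add_const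
      (2 * lam * ξ i)
  rw [zero_add] at hlim
  refine hlim.congr fun t => ?_
  rw [solitonTerm, gradComp, ray_of_ne ξ _ _ hij, Δ_ray_of_ne ξ _ _ hij, Finset.sum_singleton,
    ← neg_sub (δ * t) (ξ i), ← mul_inv_mul_sub hδ]
  simp only [div_eq_mul_inv, mul_inv, inv_neg]
  linear_combination (-(deriv (A.F i) (ξ i) * (pc A.B A.η (ξ i))⁻¹ + a * A.profile i (ξ i))
    * (∏ k ∈ (Finset.univ.erase i).erase j, (ξ i - ξ k))⁻¹ * (δ * t - ξ i)⁻¹)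
      * inv_mul_cancel₀ hδ

theorem exists_eventually_sum_solitonTerm_ray_eq (hI : ∀ j, IsOpen (I j)) {K : ∀ x, M.T x}
    (hK : A.IsHamiltonianField 1 K) {a lam : ℝ}
    (hsol : IsGradientKahlerRicciSoliton M (fun x => a • J x (K x)) lam) (p : A.Q.P)
    (hray : ∀ᶠ t in atTop, ray ξ j δ t ∈ univ.pi I) :
    ∃ k, ∀ᶠ t in atTop, ∑ i, A.solitonTerm a lam (ray ξ j δ t) i = k := by
  have hd : ∀ᶠ t in atTop,
      HasDerivAt (fun t => ∑ i, A.solitonTerm a lam (ray ξ j δ t) i) 0 t := by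
    filter_upwards [hray] with t ht
    simp only [sum_solitonTerm]
    exact (A.hasFDerivAt_soliton hI hK hsol ht p).comp_hasDerivAt t (hasDerivAt_ray ξ δ t)
  obtain ⟨k, hk⟩ := exists_eventually_eq_affine hd
  exact ⟨k, hk.mono fun t ht => by rw [ht, zero_mul, zero_add]⟩

theorem hasDerivAt_gradComp_ray (hI : ∀ j, IsOpen (I j)) (hδ : δ ≠ 0) (p : A.Q.P) {t : ℝ}
    (ht : ray ξ j δ t ∈ univ.pi I) (a lam : ℝ) :
    HasDerivAt (fun t => gradComp A.profile (ray ξ j δ t) j)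
      (-(δ * a + A.decayRate ξ j δ t) * gradComp A.profile (ray ξ j δ t) j
        - 2 * (lam * δ ^ 2) * t + δ * A.solitonTerm a lam (ray ξ j δ t) j) t := by
  refine (hasDerivAt_gradComp (hasDerivAt_ray ξ δ t) (A.injective_of_mem ht p)
    (A.hasDerivAt_profile hI ht j)).congr_deriv ?_
  have hdiag : δ * ∑ i, (ray ξ j δ t j - ray ξ j δ t i)⁻¹
      = ∑ i ∈ Finset.univ.erase j, (t - ξ i / δ)⁻¹ := by
    rw [← Finset.add_sum_erase _ _ (Finset.mem_univ j), sub_self, inv_zero, zero_add,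
      Finset.mul_sum]
    refine Finset.sum_congr rfl fun i hi => ?_
    rw [ray_self, ray_of_ne ξ _ _ (Finset.ne_of_mem_erase hi), mul_inv_mul_sub hδ]
  have hoff : ∑ i, (ray ξ j δ t j - ray ξ j δ t i)⁻¹ * (Pi.single j δ : Fin ℓ → ℝ) i = 0 := by
    rw [Finset.sum_eq_single j (fun i _ hij => by rw [Pi.single_eq_of_ne hij, mul_zero])
      fun hj => absurd (Finset.mem_univ j) hj, sub_self, inv_zero, zero_mul]
  have hbase : δ * ∑ b, ((A.B b).dim : ℝ) * (ray ξ j δ t j - A.η b)⁻¹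
      = ∑ b, ((A.B b).dim : ℝ) * (t - A.η b / δ)⁻¹ := by
    rw [Finset.mul_sum]
    refine Finset.sum_congr rfl fun b _ => ?_
    rw [ray_self, ← mul_inv_mul_sub hδ]
    ring
  rw [gradCompDeriv, gradCompDiag, hoff, Pi.single_eq_same, solitonTerm,
    A.deriv_F_div hI ht p, decayRate, ← hdiag, ← hbase, ray_self]
  ring

/-- Along an end of the momentum domain, where only `ξ_j` tends to `±∞`, the other terms of the
soliton equation converge, so that it becomes a linear equation of first order for `|∇ξ_j|²`. -/
theorem exists_end_equation (hI : ∀ j, IsOpen (I j)) {K : ∀ x, M.T x}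
    (hK : A.IsHamiltonianField 1 K) {a lam : ℝ}
    (hsol : IsGradientKahlerRicciSoliton M (fun x => a • J x (K x)) lam) (p : A.Q.P) (hδ : δ ≠ 0)
    (hray : ∀ᶠ t in atTop, ray ξ j δ t ∈ univ.pi I) :
    ∃ (b : ℝ → ℝ) (L : ℝ), Tendsto b atTop (𝓝 L) ∧ ∀ᶠ t in atTop,
      HasDerivAt (fun t => gradComp A.profile (ray ξ j δ t) j)
        (-(δ * a + A.decayRate ξ j δ t) * gradComp A.profile (ray ξ j δ t) j
          - 2 * (lam * δ ^ 2) * t + b t) t := by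
  obtain ⟨k, hk⟩ := A.exists_eventually_sum_solitonTerm_ray_eq hI hK hsol p hray
  have hrest : Tendsto (fun t => ∑ i ∈ Finset.univ.erase j, A.solitonTerm a lam (ray ξ j δ t) i)
      atTop (𝓝 (∑ i ∈ Finset.univ.erase j, 2 * lam * ξ i)) :=
    tendsto_finsetSum _ fun i hi =>
      A.tendsto_solitonTerm_ray a lam hδ (Finset.ne_of_mem_erase hi)
  refine ⟨_, _, ((tendsto_const_nhds (x := k)).sub hrest).const_mul δ, ?_⟩
  filter_upwards [hray, hk] with t ht hkt
  rw [← hkt, ← Finset.add_sum_erase _ _ (Finset.mem_univ j), add_sub_cancel_right]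
  exact A.hasDerivAt_gradComp_ray hI hδ p ht a lam

end HamiltonianAnsatz

section Completeness

/-- The Riemannian distance. -/
def KahlerManifold.edist (M : KahlerManifold.{u}) (x y : M.Carrier) : ℝ≥0∞ :=
  letI : RiemannianBundle (fun x : M.Carrier => TangentSpace 𝓘(ℝ, Cn M.dim) x) :=
    ⟨M.metric.toRiemannianMetric⟩
  Manifold.riemannianEDist 𝓘(ℝ, Cn M.dim) x y

/-- The speed `|γ'(t)|` of a curve in a Kähler manifold. -/
def KahlerManifold.speed (M : KahlerManifold.{u}) (γ : ℝ → M.Carrier) (t : ℝ) : ℝ :=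
  Real.sqrt (M.g (γ t) (mfderiv 𝓘(ℝ, ℝ) 𝓘(ℝ, Cn M.dim) γ t (1 : ℝ))
    (mfderiv 𝓘(ℝ, ℝ) 𝓘(ℝ, Cn M.dim) γ t (1 : ℝ)))

variable {M : KahlerManifold.{u}} {γ : ℝ → M.Carrier}

theorem KahlerManifold.edist_comm (x y : M.Carrier) : M.edist x y = M.edist y x :=
  letI : RiemannianBundle (fun x : M.Carrier => TangentSpace 𝓘(ℝ, Cn M.dim) x) :=
    ⟨M.metric.toRiemannianMetric⟩
  Manifold.riemannianEDist_comm

theorem KahlerManifold.edist_le_integral {v : ℝ → ℝ} {s t : ℝ} (hst : s ≤ t)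
    (hγ : ContMDiffOn 𝓘(ℝ, ℝ) 𝓘(ℝ, Cn M.dim) 1 γ (Icc s t)) (hv : ContinuousOn v (Icc s t))
    (hspeed : ∀ u ∈ Icc s t, M.speed γ u ≤ v u) :
    M.edist (γ s) (γ t) ≤ ENNReal.ofReal (∫ u in s..t, v u) := by
  let : RiemannianBundle (fun x : M.Carrier => TangentSpace 𝓘(ℝ, Cn M.dim) x) :=
      ⟨M.metric.toRiemannianMetric⟩
  have henorm : ∀ u, ‖mfderiv 𝓘(ℝ, ℝ) 𝓘(ℝ, Cn M.dim) γ u (1 : ℝ)‖ₑ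
      = ENNReal.ofReal (M.speed γ u) := fun u => by
    rw [← ofReal_norm, norm_eq_sqrt_real_inner]
    rfl
  have hnonneg : ∀ u ∈ Icc s t, 0 ≤ v u := fun u hu => (Real.sqrt_nonneg _).trans (hspeed u hu)
  calc M.edist (γ s) (γ t)
      ≤ ∫⁻ u in Icc s t, ‖mfderiv 𝓘(ℝ, ℝ) 𝓘(ℝ, Cn M.dim) γ u (1 : ℝ)‖ₑ :=
        (Manifold.riemannianEDist_le_pathELength hγ rfl rfl hst).trans_eq
          (Manifold.pathELength_eq_lintegral_mfderiv_Icc ..)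
    _ ≤ ∫⁻ u in Icc s t, ENNReal.ofReal (v u) :=
        MeasureTheory.setLIntegral_mono' measurableSet_Icc fun u hu =>
          (henorm u).trans_le (ENNReal.ofReal_le_ofReal (hspeed u hu))
    _ = ENNReal.ofReal (∫ u in s..t, v u) := by
        rw [intervalIntegral.integral_of_le hst, ← MeasureTheory.integral_Icc_eq_integral_Ioc,
          MeasureTheory.ofReal_integral_eq_lintegral_ofReal hv.integrableOn_Icc
            ((MeasureTheory.ae_restrict_iff' measurableSet_Icc).2 (Eventually.of_forall hnonneg))]

theorem integral_exp_neg_mul_le {C k : ℝ} (hC : 0 ≤ C) (hk : 0 < k) (s t : ℝ) :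
    ∫ u in s..t, C * Real.exp (-(k * u)) ≤ C / k * Real.exp (-(k * s)) := by
  have hd : ∀ u, HasDerivAt (fun u => -(C / k) * Real.exp (-(k * u)))
      (C * Real.exp (-(k * u))) u := fun u => by
    refine ((((hasDerivAt_id u).const_mul k).neg.exp).const_mul (-(C / k))).congr_deriv ?_
    simp only [id_eq, mul_one, Pi.neg_apply]
    field_simp
  rw [intervalIntegral.integral_eq_sub_of_hasDerivAt (fun u _ => hd u)
    ((by fun_prop : Continuous fun u => C * Real.exp (-(k * u))).intervalIntegrable s t)]
  have := mul_nonneg (div_nonneg hC hk.le) (Real.exp_pos (-(k * t))).le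
  linarith

theorem tendsto_ofReal_exp_neg_mul (C : ℝ) {k : ℝ} (hk : 0 < k) :
    Tendsto (fun n : ℕ => ENNReal.ofReal (C * Real.exp (-(k * n)))) atTop (𝓝 0) := by
  have hexp := (Real.tendsto_exp_neg_atTop_nhds_zero.comp
    (tendsto_natCast_atTop_atTop.const_mul_atTop hk)).const_mul C
  rw [mul_zero] at hexp
  simpa only [ENNReal.ofReal_zero] using! ENNReal.tendsto_ofReal hexp

theorem KahlerManifold.IsComplete.exists_tendsto_of_speed_le (hM : M.IsComplete) {C k : ℝ}
    (hk : 0 < k) (hγ : ∀ᶠ t in atTop, ContMDiffAt 𝓘(ℝ, ℝ) 𝓘(ℝ, Cn M.dim) 1 γ t)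
    (hspeed : ∀ᶠ t in atTop, M.speed γ t ≤ C * Real.exp (-(k * t))) :
    ∃ x, Tendsto (fun n : ℕ => γ n) atTop (𝓝 x) := by
  obtain ⟨T, hT⟩ := eventually_atTop.1 (hγ.and hspeed)
  have hC : 0 ≤ C := nonneg_of_mul_nonneg_left
    ((Real.sqrt_nonneg _).trans (hT T le_rfl).2) (Real.exp_pos _)
  have hedist : ∀ s ≥ T, ∀ t ≥ s,
      M.edist (γ s) (γ t) ≤ ENNReal.ofReal (C / k * Real.exp (-(k * s))) := fun s hs t hst =>
    (edist_le_integral hst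
      (fun u hu => (hT u (hs.trans hu.1)).1.contMDiffWithinAt)
      (by fun_prop) fun u hu => (hT u (hs.trans hu.1)).2).trans
      (ENNReal.ofReal_le_ofReal (integral_exp_neg_mul_le hC hk s t))
  refine hM (fun n : ℕ => γ n) fun ε hε => ?_
  obtain ⟨N, hN⟩ := eventually_atTop.1 (((tendsto_ofReal_exp_neg_mul (C / k) hk).eventually_lt_const
    hε).and (tendsto_natCast_atTop_atTop.eventually_ge_atTop T))
  have hlt : ∀ i ≥ N, ∀ j ≥ i, M.edist (γ i) (γ j) < ε := fun i hi j hj =>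
    (hedist i (hN i hi).2 j (Nat.cast_le.2 hj)).trans_lt (hN i hi).1
  refine ⟨N, fun i hi j hj => ?_⟩
  rcases le_total i j with hij | hji
  · exact hlt i hi j hij
  · exact (edist_comm _ _).trans_lt (hlt j hj i hji)

end Completeness

namespace HamiltonianAnsatz

variable {ℓ : ℕ} {M : KahlerManifold.{u}} {φ : TwoTensor M.dim M.Carrier} {I : Fin ℓ → Set ℝ}
  (A : HamiltonianAnsatz.{u, v, w} M φ I)

/-- The curve in `M` over the ray `ξ_j = δt`. -/
def endCurve (ξ : Fin ℓ → ℝ) (p : A.Q.P) (j : Fin ℓ) (δ t : ℝ) : M.Carrier :=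
  A.Φ (ray ξ j δ t, p)

section EndCurve

variable (hI : ∀ j, IsOpen (I j)) {ξ : Fin ℓ → ℝ} (p : A.Q.P) {j : Fin ℓ} {δ t : ℝ}
include hI

theorem contMDiffAt_endCurve (ht : ray ξ j δ t ∈ univ.pi I) :
    ContMDiffAt 𝓘(ℝ, ℝ) 𝓘(ℝ, Cn M.dim) ∞ (A.endCurve ξ p j δ) t :=
  ContMDiffAt.comp (g := A.Φ) t (A.contMDiffAt_Φ hI ht p)
    ((contDiff_ray ξ δ).contMDiff.contMDiffAt.prodMk contMDiffAt_const)

theorem mfderiv_endCurve (ht : ray ξ j δ t ∈ univ.pi I) :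
    mfderiv 𝓘(ℝ, ℝ) 𝓘(ℝ, Cn M.dim) (A.endCurve ξ p j δ) t (1 : ℝ)
      = A.derivΦ (ray ξ j δ t, p) (Pi.single j δ, 0) := by
  have hray : HasMFDerivAt 𝓘(ℝ, ℝ) 𝓘(ℝ, Fin ℓ → ℝ) (ray ξ j δ) t
      (ContinuousLinearMap.toSpanSingleton ℝ (Pi.single j δ : Fin ℓ → ℝ)) :=
    (hasDerivAt_ray ξ δ t).hasFDerivAt.hasMFDerivAt
  have hp : HasMFDerivAt 𝓘(ℝ, ℝ) 𝓘(ℝ, A.Q.E) (fun _ : ℝ => p) t _ := hasMFDerivAt_const p t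
  have hΦ := ((A.contMDiffAt_Φ hI ht p).mdifferentiableAt (by simp)).hasMFDerivAt
  change mfderiv 𝓘(ℝ, ℝ) 𝓘(ℝ, Cn M.dim) (A.Φ ∘ fun t => (ray ξ j δ t, p)) t (1 : ℝ) = _
  rw [(HasMFDerivAt.comp (g := A.Φ) t hΦ (hray.prodMk hp)).mfderiv]
  change A.derivΦ (ray ξ j δ t, p) ((1 : ℝ) • Pi.single j δ, 0) = _
  rw [one_smul]

theorem speed_endCurve (ht : ray ξ j δ t ∈ univ.pi I) : M.speed (A.endCurve ξ p j δ) t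
    = Real.sqrt (δ * δ * (gradComp A.profile (ray ξ j δ t) j)⁻¹) := by
  rw [KahlerManifold.speed, A.mfderiv_endCurve hI p ht]
  exact congrArg Real.sqrt (A.formAt_g_derivΦ_single ht p j δ)

theorem speed_endCurve_le {C k : ℝ} (hC : 0 < C) (ht : ray ξ j δ t ∈ univ.pi I)
    (hgrowth : C * Real.exp (k * t) ≤ gradComp A.profile (ray ξ j δ t) j) :
    M.speed (A.endCurve ξ p j δ) t
      ≤ Real.sqrt (δ * δ * C⁻¹) * Real.exp (-(k / 2 * t)) := by
  have hinv : (gradComp A.profile (ray ξ j δ t) j)⁻¹ ≤ C⁻¹ * Real.exp (-(k * t)) := by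
    rw [Real.exp_neg, ← mul_inv]
    exact inv_anti₀ (mul_pos hC (Real.exp_pos _)) hgrowth
  calc M.speed (A.endCurve ξ p j δ) t
      ≤ Real.sqrt (δ * δ * (C⁻¹ * Real.exp (-(k * t)))) := by
        rw [A.speed_endCurve hI p ht]
        exact Real.sqrt_le_sqrt (mul_le_mul_of_nonneg_left hinv (mul_self_nonneg δ))
    _ = Real.sqrt (δ * δ * C⁻¹) * Real.exp (-(k / 2 * t)) := by
        rw [← mul_assoc, Real.sqrt_mul (mul_nonneg (mul_self_nonneg δ) (inv_nonneg.2 hC.le)),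
          ← Real.exp_half]
        ring_nf

theorem hasDerivAt_potential_endCurve {K : ∀ x, M.T x} (hK : A.IsHamiltonianField 1 K) {a : ℝ}
    {f : M.Carrier → ℝ} (hf : ContMDiff 𝓘(ℝ, Cn M.dim) 𝓘(ℝ, ℝ) ∞ f)
    (hgrad : ∀ (x : M.Carrier) (v : M.T x), M.g x (a • J x (K x)) v
      = mfderiv 𝓘(ℝ, Cn M.dim) 𝓘(ℝ, ℝ) f x v) (ht : ray ξ j δ t ∈ univ.pi I) :
    HasDerivAt (fun t => f (A.endCurve ξ p j δ t)) (-(a * δ)) t := by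
  have hcurve := ((A.contMDiffAt_endCurve hI p ht).mdifferentiableAt (by simp)).hasMFDerivAt
  have hfderiv := ((hf (A.endCurve ξ p j δ t)).mdifferentiableAt (by simp)).hasMFDerivAt
  let L : ℝ →L[ℝ] ℝ := ContinuousLinearMap.comp
    (mfderiv 𝓘(ℝ, Cn M.dim) 𝓘(ℝ, ℝ) f (A.endCurve ξ p j δ t))
    (mfderiv 𝓘(ℝ, ℝ) 𝓘(ℝ, Cn M.dim) (A.endCurve ξ p j δ) t)
  have hL : HasFDerivAt (fun t => f (A.endCurve ξ p j δ t)) L t :=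
    (HasMFDerivAt.comp t hfderiv hcurve).hasFDerivAt
  refine hL.hasDerivAt.congr_deriv ?_
  change mfderiv 𝓘(ℝ, Cn M.dim) 𝓘(ℝ, ℝ) f (A.endCurve ξ p j δ t)
    (mfderiv 𝓘(ℝ, ℝ) 𝓘(ℝ, Cn M.dim) (A.endCurve ξ p j δ) t (1 : ℝ)) = _
  rw [A.mfderiv_endCurve hI p ht]
  refine (hgrad _ _).symm.trans ?_
  have hham := hK _ ht p (Pi.single j δ, 0)
  rw [dσ_one] at hham
  rw [map_smul]
  refine (congrArg (a * ·) hham).trans ?_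
  simp

include p in
/-- If `|∇ξ_j|²` grows exponentially along a ray, the ray has finite length, but the potential of
`aJK_1` is unbounded along it. -/
theorem not_isComplete_of_exp_le {K : ∀ x, M.T x} (hK : A.IsHamiltonianField 1 K) {a lam : ℝ}
    (ha : a ≠ 0) (hsol : IsGradientKahlerRicciSoliton M (fun x => a • J x (K x)) lam)
    (hδ : δ ≠ 0) (hray : ∀ᶠ t in atTop, ray ξ j δ t ∈ univ.pi I) {k C : ℝ} (hk : 0 < k)
    (hC : 0 < C)
    (hgrowth : ∀ᶠ t in atTop, C * Real.exp (k * t) ≤ gradComp A.profile (ray ξ j δ t) j) :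
    ¬ M.IsComplete := by
  intro hM
  obtain ⟨f, hf, hgrad⟩ := hsol.gradient
  obtain ⟨x, hx⟩ := hM.exists_tendsto_of_speed_le (γ := A.endCurve ξ p j δ) (half_pos hk)
    (hray.mono fun t ht => (A.contMDiffAt_endCurve hI p ht).of_le (by norm_num))
    (hray.mp (hgrowth.mono fun t hgt ht => A.speed_endCurve_le hI p hC ht hgt))
  obtain ⟨b, hb⟩ := exists_eventually_eq_affine
    (hray.mono fun t ht => A.hasDerivAt_potential_endCurve hI p hK hf hgrad ht)
  have hne : -(a * δ) ≠ 0 := neg_ne_zero.2 (mul_ne_zero ha hδ)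
  have hlim : Tendsto (fun n : ℕ => (n : ℝ)) atTop (𝓝 ((f x - b) / -(a * δ))) := by
    refine ((((hf.continuous.tendsto x).comp hx).sub_const b).div_const _).congr' ?_
    filter_upwards [tendsto_natCast_atTop_atTop.eventually hb] with n hn
    rw [Function.comp_apply, hn, add_sub_cancel_right, mul_div_cancel_left₀ _ hne]
  exact not_tendsto_nhds_of_tendsto_atTop tendsto_natCast_atTop_atTop _ hlim

end EndCurve

section Solitons

variable (hI : ∀ j, IsOpen (I j)) {K : ∀ x, M.T x} (hK : A.IsHamiltonianField 1 K) {a lam : ℝ}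
  (hsol : IsGradientKahlerRicciSoliton M (fun x => a • J x (K x)) lam)
  {ξ : Fin ℓ → ℝ} (p : A.Q.P) {j : Fin ℓ} {δ : ℝ}
  (hray : ∀ᶠ t in atTop, ray ξ j δ t ∈ univ.pi I)
include hI hK hsol p hray

theorem nonpos_of_mul_nonneg (hδ : δ ≠ 0) (hδa : 0 ≤ δ * a) : lam ≤ 0 := by
  by_contra! hlam
  obtain ⟨b, L, hb, hd⟩ := A.exists_end_equation hI hK hsol p hδ hray
  exact false_of_shrinking (mul_pos hlam (sq_pos_of_ne_zero hδ)) hδa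
    (hray.mono fun t ht => A.gradComp_pos ht p j) A.eventually_decayRate_nonneg hb hd

theorem not_isComplete_of_mul_neg (hlam : lam < 0) (hδa : δ * a < 0) : ¬ M.IsComplete := by
  have hδ := left_ne_zero_of_mul hδa.ne
  obtain ⟨b, L, hb, hd⟩ := A.exists_end_equation hI hK hsol p hδ hray
  obtain ⟨k, hk, C, hC, hgrowth⟩ := exp_le_of_expanding
    (mul_neg_of_neg_of_pos hlam (sq_pos_of_ne_zero hδ)) hδa
    (hray.mono fun t ht => A.gradComp_pos ht p j) A.tendsto_decayRate hb hd
  exact A.not_isComplete_of_exp_le hI p hK (right_ne_zero_of_mul hδa.ne) hsol hδ hray hk hC hgrowth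

end Solitons

end HamiltonianAnsatz

section TypeTwo

variable {ℓ : ℕ} (α : Fin ℓ → ℝ)

theorem isOpen_type2Interval (j : Fin ℓ) : IsOpen (type2Interval α j) := by
  unfold type2Interval
  split_ifs
  exacts [isOpen_Ioi, isOpen_Iio, isOpen_Ioo]

theorem exists_type2Interval_mem_atTop (hℓ : 1 ≤ ℓ) : ∃ j, type2Interval α j ∈ atTop :=
  ⟨⟨ℓ - 1, by omega⟩, by
    rw [type2Interval, if_pos (Nat.sub_add_cancel hℓ)]
    exact Ioi_mem_atTop _⟩

theorem exists_type2Interval_mem_atBot (hℓ : 2 ≤ ℓ) : ∃ j, type2Interval α j ∈ atBot :=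
  ⟨⟨0, by omega⟩, by
    rw [type2Interval, if_neg (by simp only; omega), if_pos rfl]
    exact Iio_mem_atBot _⟩

end TypeTwo

end KRS

end

theorem lemmal_general (M : KRS.KahlerManifold.{u}) (hM : Nonempty M.Carrier)
    {ℓ : ℕ} {I : Fin ℓ → Set ℝ} {φ : KRS.TwoTensor M.dim M.Carrier}
    (A : KRS.HamiltonianAnsatz.{u, v, w} M φ I) (hI : ∀ j, IsOpen (I j))
    (htop : ∃ j, I j ∈ atTop) (hbot : ∃ j, I j ∈ atBot)
    {K₁ : ∀ x, M.T x} (hK₁ : A.IsHamiltonianField 1 K₁) {a lam : ℝ} (hlam : lam ≠ 0)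
    (hexp : lam < 0 → a ≠ 0 ∧ M.IsComplete) :
    ¬ KRS.IsGradientKahlerRicciSoliton M (fun x => a • KRS.J x (K₁ x)) lam := by
  intro hsol
  obtain ⟨_, ⟨⟨ξ, p⟩, ⟨hξ, -⟩, -⟩⟩ := A.Φ_dense.nonempty
  have hrays : ∀ δ : ℝ, δ ≠ 0 → ∃ j, ∀ᶠ t in atTop, KRS.ray ξ j δ t ∈ univ.pi I :=
    fun δ hδ => KRS.exists_eventually_ray_mem_pi ξ δ htop hbot hξ hδ
  rcases hlam.lt_or_gt with hneg | hpos
  · obtain ⟨ha, hcomplete⟩ := hexp hneg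
    obtain ⟨j, hray⟩ := hrays (-a) (neg_ne_zero.2 ha)
    exact A.not_isComplete_of_mul_neg hI hK₁ hsol p hray hneg
      (by simpa only [neg_mul, neg_lt_zero] using mul_self_pos.2 ha) hcomplete
  · obtain ⟨δ, hδ, hδa⟩ : ∃ δ : ℝ, δ ≠ 0 ∧ 0 ≤ δ * a :=
      (le_total 0 a).elim (fun ha => ⟨1, one_ne_zero, by rwa [one_mul]⟩)
        fun ha => ⟨-1, neg_ne_zero.2 one_ne_zero, by rwa [neg_one_mul, neg_nonneg]⟩
    obtain ⟨j, hray⟩ := hrays δ hδ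
    exact hpos.not_ge (A.nonpos_of_mul_nonneg hI hK₁ hsol p hray hδ hδa)

theorem lemmal (M : KRS.KahlerManifold.{u}) (hM : Nonempty M.Carrier)
    (ℓ : ℕ) (hℓ : 2 ≤ ℓ) (α : Fin ℓ → ℝ) (hα : KRS.IsType2 α)
    (φ : KRS.TwoTensor M.dim M.Carrier) (hφ : KRS.IsHamiltonianTwoForm M φ)
    (A : KRS.HamiltonianAnsatz.{u, v, w} M φ (KRS.type2Interval α))
    (K₁ : ∀ x, M.T x) (hK₁ : A.IsHamiltonianField 1 K₁)
    (a lam : ℝ) (hlam : lam ≠ 0) (ha : lam < 0 → a ≠ 0) :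
    ¬ (M.IsComplete ∧
      KRS.IsGradientKahlerRicciSoliton M (fun x => a • KRS.J x (K₁ x)) lam) :=
  fun ⟨hcomplete, hsol⟩ => lemmal_general M hM A (KRS.isOpen_type2Interval α)
    (KRS.exists_type2Interval_mem_atTop α (by omega)) (KRS.exists_type2Interval_mem_atBot α hℓ)
    hK₁ hlam (fun hneg => ⟨ha hneg, hcomplete⟩) hsol
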